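/- Notation. $\mathcal G(\mathbb R^d)$ is the Colombeau algebra of nets $(u_\varepsilon)_{\varepsilon\in(0,1]}$ of smooth functions, moderate modulo negligible, with respect to the suprema of all derivatives on compact sets; $\mathcal G_c$ is the set of its elements with compact support. A net $(\mu_\varepsilon)$ is slow scale if $|\mu_\varepsilon|^q=O(\varepsilon^{-1})$ for all $q\ge 0$. A generalised function is slow scale regular if it has a representative each of whose derivatives is, on each compact set, $O(\mu_\varepsilon)$ for some slow scale net $(\mu_\varepsilon)$; it is of slow scale logarithmic type if it has a representative which is, on each compact set, $O(\log\mu_\varepsilon)$ for some slow scale net $\mu_\varepsilon\ge 1$. For $v\in\mathcal G(\mathbb R^n)$, a point $(x_0,\xi_0)$ with $\xi_0\ne 0$ does not belong to $\mathrm{WF}_{\mathcal G^\infty}v$ iff there are a representative $(v_\varepsilon)$, a function $\varphi\in C_c^\infty(\mathbb R^n)$ with $\varphi(x_0)=1$, an open conic neighbourhood $\Gamma$ of $\xi_0$ and $N\in\mathbb N$ such that $\sup_{\xi\in\Gamma}(1+|\xi|^2)^{l/2}|\widehat{\varphi v_\varepsilon}(\xi)|=O(\varepsilon^{-N})$ for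 all $l\in\mathbb R$. Finally $D=-i\partial$. Proposition. Let $a_{1,j}\in\mathcal G(\mathbb R)$, $j=1,\dots,n$, be real valued and slow scale regular. Let $a_0\in\mathcal G(\mathbb R^{1+n})$ be slow scale regular, of slow scale logarithmic type, and compactly supported in $x$ (locally uniformly in $t$). Let $u_0\in\mathcal G_c(\mathbb R^n)$. Suppose that there are real valued representatives $(a_{1,j,\varepsilon})_\varepsilon$ of $a_{1,j}$ such that $\Lambda_{j,\varepsilon}(t)=-\int_0^t a_{1,j,\varepsilon}(z)\,dz$ converges to a real number $\Lambda_j(t)$ as $\varepsilon\to0$, for every $t\in\mathbb R$ and every $j$. Then the Cauchy problem $$D_tu=\sum_{j=1}^n a_{1,j}(t)D_ju+a_0(t,x)u,\qquad u(0,\cdot)=u_0,$$ has a solution $u\in\mathcal G(\mathbb R^{1+n})$ with the following properties. (1) $u$ is given by the Fourier integral operator formula $$u_\varepsilon(t,x)=(2\pi)^{-n}\int_{\mathbb R^n} e^{i\sum_h\gamma_{h,\varepsilon}(x,t,0)\eta_h}\,b_\varepsilon(t,x)\,\widehat{u_{0,\varepsilon}}(\eta)\,d\eta ,$$ where $\gamma_\varepsilon(x,t,s)=x+\Lambda_\varepsilon(s)-\Lambda_\varepsilon(t)$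 and $b_\varepsilon(t,x)=\exp\big(i\int_0^t a_{0,\varepsilon}(s,\gamma_\varepsilon(x,t,s))\,ds\big)$, for all representatives $(a_{0,\varepsilon})$ of $a_0$ that vanish, for each $T$ and all $|t|\le T$, outside a ball $|x|\le R_T$ independent of $\varepsilon$, and all representatives $(u_{0,\varepsilon})$ of $u_0$ supported in one fixed compact set. (2) If for each $T$ the functions $\Lambda_\varepsilon$ are bounded on $[-T,T]$ uniformly for small $\varepsilon$, then $u$ is the unique solution in $\mathcal G(\mathbb R^{1+n})$. (3) For every $t\in\mathbb R$, $$\mathrm{WF}_{\mathcal G^\infty}u(t,\cdot)=\chi_t^{-1}(\mathrm{WF}_{\mathcal G^\infty}u_0),\qquad \chi_t^{-1}(y,\eta)=(y+\Lambda(t),\eta).$$ In particular, if the solution in $\mathcal G(\mathbb R^{1+n})$ is unique, then (3) holds for it. -/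

import Mathlib

open Filter Topology
open scoped ContDiff

noncomputable section

namespace Colombeau

/-! ## Nets and asymptotics -/

/-- The index set `(0,1]` of the parameter `ε`. -/
abbrev Eps : Type := Set.Ioc (0 : ℝ) 1

/-- The filter `ε → 0` on `(0,1]`. -/
def toZero : Filter Eps := Filter.comap (fun ε : Eps => (ε : ℝ)) (𝓝 0)

/-- `sup_{x ∈ S} f ε x = O(g ε)` as `ε → 0`. -/
def SupO {X : Type*} (S : Set X) (f : Eps → X → ℝ) (g : Eps → ℝ) : Prop :=
  ∃ C : ℝ, ∀ᶠ ε in toZero, ∀ x ∈ S, f ε x ≤ C * g ε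

/-- `(r_ε)` is a slow scale net: `|r_ε|^q = O(ε⁻¹)` for every `q ≥ 0`. -/
def IsSlowScale (r : Eps → ℝ) : Prop :=
  ∀ q : ℝ, 0 ≤ q → ∃ C : ℝ, ∀ᶠ ε in toZero, |r ε| ^ q ≤ C * (ε : ℝ)⁻¹

section Spaces

variable {E : Type*} [NormedAddCommGroup E] [NormedSpace ℝ E]
variable {F : Type*} [NormedAddCommGroup F] [NormedSpace ℝ F]

/-- Moderate nets of smooth functions: on each compact set every derivative is `O(ε^{-N})` for
some `N`. -/
def IsModerate (u : Eps → E → ℂ) : Prop :=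
  (∀ ε, ContDiff ℝ ∞ (u ε)) ∧
    ∀ K : Set E, IsCompact K → ∀ k : ℕ, ∃ N : ℕ,
      SupO K (fun ε x => ‖iteratedFDeriv ℝ k (u ε) x‖) (fun ε => ((ε : ℝ)⁻¹) ^ N)

/-- All derivatives of the net are `O(ε^q)` for all `q`, uniformly on compact subsets of `U`. -/
def IsNegligibleOn (U : Set E) (u : Eps → E → ℂ) : Prop :=
  ∀ K : Set E, IsCompact K → K ⊆ U → ∀ k q : ℕ,
    SupO K (fun ε x => ‖iteratedFDeriv ℝ k (u ε) x‖) (fun ε => (ε : ℝ) ^ q)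

/-! ### Closure properties needed to form the quotient algebra -/

theorem SupO.exists_nonneg {X : Type*} {S : Set X} {f : Eps → X → ℝ} {g : Eps → ℝ}
    (h : SupO S f g) (hg : ∀ ε, 0 ≤ g ε) :
    ∃ C : ℝ, 0 ≤ C ∧ ∀ᶠ ε in toZero, ∀ x ∈ S, f ε x ≤ C * g ε := by
  obtain ⟨C, hC⟩ := h
  refine ⟨max C 0, le_max_right _ _, ?_⟩
  filter_upwards [hC] with ε h x hx
  exact (h x hx).trans (mul_le_mul_of_nonneg_right (le_max_left _ _) (hg ε))

theorem SupO.mono {X : Type*} {S : Set X} {f f' : Eps → X → ℝ} {g g' : Eps → ℝ}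
    (h : SupO S f g) (hg0 : ∀ ε, 0 ≤ g ε) (hf : ∀ ε, ∀ x ∈ S, f' ε x ≤ f ε x)
    (hg : ∀ ε, g ε ≤ g' ε) : SupO S f' g' := by
  obtain ⟨C, hC0, hC⟩ := h.exists_nonneg hg0
  refine ⟨C, ?_⟩
  filter_upwards [hC] with ε h x hx
  exact (hf ε x hx).trans ((h x hx).trans (mul_le_mul_of_nonneg_left (hg ε) hC0))

theorem SupO.add {X : Type*} {S : Set X} {f f' : Eps → X → ℝ} {g : Eps → ℝ}
    (h : SupO S f g) (h' : SupO S f' g) : SupO S (fun ε x => f ε x + f' ε x) g := by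
  obtain ⟨C, hC⟩ := h
  obtain ⟨C', hC'⟩ := h'
  refine ⟨C + C', ?_⟩
  filter_upwards [hC, hC'] with ε h h' x hx
  rw [add_mul]
  exact add_le_add (h x hx) (h' x hx)

theorem SupO.mul {X : Type*} {S : Set X} {f f' : Eps → X → ℝ} {g g' : Eps → ℝ}
    (h : SupO S f g) (h' : SupO S f' g') (hg : ∀ ε, 0 ≤ g ε) (hg' : ∀ ε, 0 ≤ g' ε)
    (hf' : ∀ ε x, 0 ≤ f' ε x) :
    SupO S (fun ε x => f ε x * f' ε x) (fun ε => g ε * g' ε) := by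
  obtain ⟨C, hC0, hC⟩ := h.exists_nonneg hg
  obtain ⟨C', hC0', hC'⟩ := h'.exists_nonneg hg'
  refine ⟨C * C', ?_⟩
  filter_upwards [hC, hC'] with ε h h' x hx
  calc f ε x * f' ε x ≤ (C * g ε) * (C' * g' ε) :=
        mul_le_mul (h x hx) (h' x hx) (hf' ε x) (mul_nonneg hC0 (hg ε))
    _ = C * C' * (g ε * g' ε) := by ring

theorem SupO.const_mul {X : Type*} {S : Set X} {f : Eps → X → ℝ} {g : Eps → ℝ}
    (h : SupO S f g) {c : ℝ} (hc : 0 ≤ c) : SupO S (fun ε x => c * f ε x) g := by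
  obtain ⟨C, hC⟩ := h
  refine ⟨c * C, ?_⟩
  filter_upwards [hC] with ε h x hx
  rw [mul_assoc]
  exact mul_le_mul_of_nonneg_left (h x hx) hc

theorem SupO.sum {X ι : Type*} {S : Set X} (s : Finset ι) {f : ι → Eps → X → ℝ} {g : Eps → ℝ}
    (h : ∀ i ∈ s, SupO S (f i) g) : SupO S (fun ε x => ∑ i ∈ s, f i ε x) g := by
  classical
  induction s using Finset.induction_on with
  | empty => exact ⟨0, by simp⟩
  | insert a s ha ih =>
    have := (h a (Finset.mem_insert_self a s)).add
      (ih fun i hi => h i (Finset.mem_insert_of_mem hi))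
    simpa [Finset.sum_insert ha] using this

theorem inv_pow_nonneg (N : ℕ) (ε : Eps) : 0 ≤ ((ε : ℝ)⁻¹) ^ N :=
  pow_nonneg (inv_nonneg.2 ε.2.1.le) N

theorem pow_nonneg' (N : ℕ) (ε : Eps) : 0 ≤ (ε : ℝ) ^ N := pow_nonneg ε.2.1.le N

theorem inv_pow_mono {M N : ℕ} (h : M ≤ N) (ε : Eps) : ((ε : ℝ)⁻¹) ^ M ≤ ((ε : ℝ)⁻¹) ^ N :=
  pow_le_pow_right₀ ((one_le_inv₀ ε.2.1).2 ε.2.2) h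

theorem IsModerate.add {u v : Eps → E → ℂ} (hu : IsModerate u) (hv : IsModerate v) :
    IsModerate (u + v) := by
  refine ⟨fun ε => (hu.1 ε).add (hv.1 ε), fun K hK k => ?_⟩
  obtain ⟨M, hM⟩ := hu.2 K hK k
  obtain ⟨N, hN⟩ := hv.2 K hK k
  refine ⟨max M N, ?_⟩
  have h1 := hM.mono (inv_pow_nonneg M) (fun _ _ _ => le_rfl) (inv_pow_mono (le_max_left M N))
  have h2 := hN.mono (inv_pow_nonneg N) (fun _ _ _ => le_rfl) (inv_pow_mono (le_max_right M N))
  refine (h1.add h2).mono (inv_pow_nonneg _) (fun ε x _ => ?_) (fun _ => le_rfl)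
  have hk : ((k : ℕ∞ω)) ≤ ∞ := by exact_mod_cast le_top
  rw [Pi.add_apply, iteratedFDeriv_add_apply ((hu.1 ε).of_le hk).contDiffAt
    ((hv.1 ε).of_le hk).contDiffAt]
  exact norm_add_le _ _

theorem IsModerate.mul {u v : Eps → E → ℂ} (hu : IsModerate u) (hv : IsModerate v) :
    IsModerate (u * v) := by
  refine ⟨fun ε => (hu.1 ε).mul (hv.1 ε), fun K hK k => ?_⟩
  choose M hM using fun i => hu.2 K hK i
  choose N hN using fun i => hv.2 K hK i
  refine ⟨∑ i ∈ Finset.range (k + 1), (M i + N (k - i)), ?_⟩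
  have hk : ((k : ℕ∞ω)) ≤ ∞ := by exact_mod_cast le_top
  have key : ∀ i ∈ Finset.range (k + 1), SupO K
      (fun ε x => (k.choose i : ℝ) * ‖iteratedFDeriv ℝ i (u ε) x‖
        * ‖iteratedFDeriv ℝ (k - i) (v ε) x‖)
      (fun ε => ((ε : ℝ)⁻¹) ^ (∑ i ∈ Finset.range (k + 1), (M i + N (k - i)))) := by
    intro i hi
    have h := ((hM i).mul (hN (k - i)) (inv_pow_nonneg _) (inv_pow_nonneg _)
      (fun _ _ => norm_nonneg _)).const_mul (c := (k.choose i : ℝ)) (Nat.cast_nonneg _)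
    refine h.mono (fun ε => mul_nonneg (inv_pow_nonneg _ ε) (inv_pow_nonneg _ ε))
      (fun ε x _ => le_of_eq (by ring)) (fun ε => ?_)
    rw [← pow_add]
    exact inv_pow_mono (Finset.single_le_sum (f := fun i => M i + N (k - i))
      (fun _ _ => Nat.zero_le _) hi) ε
  exact (SupO.sum _ key).mono (inv_pow_nonneg _)
    (fun ε x _ => norm_iteratedFDeriv_mul_le (hu.1 ε) (hv.1 ε) x hk) (fun _ => le_rfl)

theorem isModerate_const (c : ℂ) : IsModerate (fun (_ : Eps) (_ : E) => c) := by
  refine ⟨fun _ => contDiff_const, fun K _ k => ⟨0, ‖c‖, Eventually.of_forall fun ε x _ => ?_⟩⟩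
  rcases Nat.eq_zero_or_pos k with rfl | hk
  · simp
  · simp [iteratedFDeriv_const_of_ne hk.ne']

/-- The algebra of moderate nets on the space `E`. -/
def moderateNets (E : Type*) [NormedAddCommGroup E] [NormedSpace ℝ E] :
    Subalgebra ℂ (Eps → E → ℂ) where
  carrier := {u | IsModerate u}
  mul_mem' := IsModerate.mul
  add_mem' := IsModerate.add
  algebraMap_mem' := isModerate_const

theorem IsNegligibleOn.add {U : Set E} {u v : Eps → E → ℂ} (hsu : ∀ ε, ContDiff ℝ ∞ (u ε))
    (hsv : ∀ ε, ContDiff ℝ ∞ (v ε)) (hu : IsNegligibleOn U u) (hv : IsNegligibleOn U v) :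
    IsNegligibleOn U (u + v) := by
  intro K hK hKU k q
  refine ((hu K hK hKU k q).add (hv K hK hKU k q)).mono (pow_nonneg' _) (fun ε x _ => ?_)
    (fun _ => le_rfl)
  have hk : ((k : ℕ∞ω)) ≤ ∞ := by exact_mod_cast le_top
  rw [Pi.add_apply, iteratedFDeriv_add_apply ((hsu ε).of_le hk).contDiffAt
    ((hsv ε).of_le hk).contDiffAt]
  exact norm_add_le _ _

theorem IsNegligibleOn.moderate_mul {U : Set E} {u v : Eps → E → ℂ} (hu : IsModerate u)
    (hsv : ∀ ε, ContDiff ℝ ∞ (v ε)) (hv : IsNegligibleOn U v) : IsNegligibleOn U (u * v) := by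
  intro K hK hKU k q
  choose M hM using fun i => hu.2 K hK i
  have hk : ((k : ℕ∞ω)) ≤ ∞ := by exact_mod_cast le_top
  have key : ∀ i ∈ Finset.range (k + 1), SupO K
      (fun ε x => (k.choose i : ℝ) * ‖iteratedFDeriv ℝ i (u ε) x‖
        * ‖iteratedFDeriv ℝ (k - i) (v ε) x‖) (fun ε => (ε : ℝ) ^ q) := by
    intro i _
    have h := ((hM i).mul (hv K hK hKU (k - i) (q + M i)) (inv_pow_nonneg _) (pow_nonneg' _)
      (fun _ _ => norm_nonneg _)).const_mul (c := (k.choose i : ℝ)) (Nat.cast_nonneg _)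
    refine h.mono (fun ε => mul_nonneg (inv_pow_nonneg _ ε) (pow_nonneg' _ ε))
      (fun ε x _ => le_of_eq (by ring)) (fun ε => le_of_eq ?_)
    have hε : (ε : ℝ) ≠ 0 := ε.2.1.ne'
    rw [pow_add, inv_pow]
    field_simp
  exact (SupO.sum _ key).mono (pow_nonneg' _)
    (fun ε x _ => norm_iteratedFDeriv_mul_le (hu.1 ε) (hsv ε) x hk) (fun _ => le_rfl)

/-- The ideal of negligible nets. -/
def negligibleNets (E : Type*) [NormedAddCommGroup E] [NormedSpace ℝ E] :
    Ideal (moderateNets E) where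
  carrier := {u | IsNegligibleOn Set.univ (u : Eps → E → ℂ)}
  add_mem' {u v} hu hv := IsNegligibleOn.add u.2.1 v.2.1 hu hv
  zero_mem' := by
    intro K _ _ k q
    refine ⟨0, Eventually.of_forall fun ε x _ => ?_⟩
    have h : (((0 : moderateNets E) : Eps → E → ℂ) ε) = 0 := rfl
    simp [h]
  smul_mem' u v hv := IsNegligibleOn.moderate_mul u.2 v.2.1 hv

/-- The Colombeau algebra `𝒢(E)` of generalised functions on the whole space `E`: moderate nets
modulo negligible nets. -/
abbrev GenFun (E : Type*) [NormedAddCommGroup E] [NormedSpace ℝ E] : Type _ :=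
  moderateNets E ⧸ negligibleNets E

/-- The net `w` is a representative of the generalised function `u`. -/
def Represents (w : Eps → E → ℂ) (u : GenFun E) : Prop :=
  ∃ hw : w ∈ moderateNets E, Ideal.Quotient.mk (negligibleNets E) ⟨w, hw⟩ = u

/-! ### Partial derivatives and composition with affine maps -/

theorem norm_iteratedFDeriv_dir_le {f : E → ℂ} (hf : ContDiff ℝ ∞ f) (v : E) (k : ℕ) (x : E) :
    ‖iteratedFDeriv ℝ k (fun y => fderiv ℝ f y v) x‖
      ≤ ‖v‖ * ‖iteratedFDeriv ℝ (k + 1) f x‖ := by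
  have hk : ((k : ℕ∞ω)) ≤ ∞ := by exact_mod_cast le_top
  have h : ContDiff ℝ ∞ (fderiv ℝ f) := hf.fderiv_right (by simp)
  rw [← norm_iteratedFDeriv_fderiv]
  exact norm_iteratedFDeriv_clm_apply_const h.contDiffAt hk

theorem IsModerate.dir {u : Eps → E → ℂ} (hu : IsModerate u) (v : E) :
    IsModerate (fun ε x => fderiv ℝ (u ε) x v) := by
  refine ⟨fun ε => ((hu.1 ε).fderiv_right (m := ∞) (by simp)).clm_apply contDiff_const,
    fun K hK k => ?_⟩
  obtain ⟨N, hN⟩ := hu.2 K hK (k + 1)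
  exact ⟨N, (hN.const_mul (norm_nonneg v)).mono (inv_pow_nonneg _)
    (fun ε x _ => norm_iteratedFDeriv_dir_le (hu.1 ε) v k x) (fun _ => le_rfl)⟩

theorem IsNegligibleOn.dir {U : Set E} {u : Eps → E → ℂ} (hs : ∀ ε, ContDiff ℝ ∞ (u ε))
    (hu : IsNegligibleOn U u) (v : E) :
    IsNegligibleOn U (fun ε x => fderiv ℝ (u ε) x v) := by
  intro K hK hKU k q
  exact ((hu K hK hKU (k + 1) q).const_mul (norm_nonneg v)).mono (pow_nonneg' _)
    (fun ε x _ => norm_iteratedFDeriv_dir_le (hs ε) v k x) (fun _ => le_rfl)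

/-- Directional derivative on moderate nets. -/
def netDir (v : E) : moderateNets E →ₗ[ℂ] moderateNets E where
  toFun u := ⟨fun ε x => fderiv ℝ (u.1 ε) x v, IsModerate.dir u.2 v⟩
  map_add' u w := by
    ext ε x
    have hu := (u.2.1 ε).differentiable (by simp) x
    have hw := (w.2.1 ε).differentiable (by simp) x
    change fderiv ℝ (u.1 ε + w.1 ε) x v = fderiv ℝ (u.1 ε) x v + fderiv ℝ (w.1 ε) x v
    rw [fderiv_add hu hw]
    rfl
  map_smul' c u := by
    ext ε x
    have hu := (u.2.1 ε).differentiable (by simp) x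
    change fderiv ℝ (c • u.1 ε) x v = c • fderiv ℝ (u.1 ε) x v
    rw [fderiv_const_smul hu]
    rfl

/-- The derivative `∂_v u` of a generalised function in the direction `v`. -/
def GenFun.dir (v : E) : GenFun E →ₗ[ℂ] GenFun E :=
  Submodule.mapQ ((negligibleNets E).restrictScalars ℂ) ((negligibleNets E).restrictScalars ℂ)
    (netDir v) (fun u hu => IsNegligibleOn.dir u.2.1 hu v)

theorem norm_iteratedFDeriv_affine_le {f : F → ℂ} (hf : ContDiff ℝ ∞ f) (c : F) (L : E →L[ℝ] F)
    (k : ℕ) (x : E) :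
    ‖iteratedFDeriv ℝ k (fun y => f (c + L y)) x‖
      ≤ ‖L‖ ^ k * ‖iteratedFDeriv ℝ k f (c + L x)‖ := by
  have hk : ((k : ℕ∞ω)) ≤ ∞ := by exact_mod_cast le_top
  have hg : ContDiff ℝ ∞ (fun z => f (c + z)) := hf.comp (contDiff_const.add contDiff_id)
  have h := L.iteratedFDeriv_comp_right hg x hk
  have h' : (fun y => f (c + L y)) = (fun z => f (c + z)) ∘ L := rfl
  rw [h', h, iteratedFDeriv_comp_add_left]
  refine (ContinuousMultilinearMap.norm_compContinuousLinearMap_le _ _).trans ?_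
  simp [mul_comm]

theorem IsModerate.affine {u : Eps → F → ℂ} (hu : IsModerate u) (c : F) (L : E →L[ℝ] F) :
    IsModerate (fun ε x => u ε (c + L x)) := by
  refine ⟨fun ε => (hu.1 ε).comp (contDiff_const.add L.contDiff), fun K hK k => ?_⟩
  obtain ⟨N, C, hC⟩ := hu.2 ((fun x => c + L x) '' K)
    (hK.image (continuous_const.add L.continuous)) k
  refine ⟨N, ‖L‖ ^ k * C, ?_⟩
  filter_upwards [hC] with ε h x hx
  refine (norm_iteratedFDeriv_affine_le (hu.1 ε) c L k x).trans ?_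
  rw [mul_assoc]
  exact mul_le_mul_of_nonneg_left (h _ ⟨x, hx, rfl⟩) (by positivity)

theorem IsNegligibleOn.affine {u : Eps → F → ℂ} (hs : ∀ ε, ContDiff ℝ ∞ (u ε))
    (hu : IsNegligibleOn Set.univ u) (c : F) (L : E →L[ℝ] F) :
    IsNegligibleOn Set.univ (fun ε x => u ε (c + L x)) := by
  intro K hK _ k q
  obtain ⟨C, hC⟩ := hu ((fun x => c + L x) '' K)
    (hK.image (continuous_const.add L.continuous)) (Set.subset_univ _) k q
  refine ⟨‖L‖ ^ k * C, ?_⟩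
  filter_upwards [hC] with ε h x hx
  refine (norm_iteratedFDeriv_affine_le (hs ε) c L k x).trans ?_
  rw [mul_assoc]
  exact mul_le_mul_of_nonneg_left (h _ ⟨x, hx, rfl⟩) (by positivity)

/-- Composition of moderate nets with the affine map `x ↦ c + L x`. -/
def netAffine (c : F) (L : E →L[ℝ] F) : moderateNets F →ₐ[ℂ] moderateNets E where
  toFun u := ⟨fun ε x => u.1 ε (c + L x), IsModerate.affine u.2 c L⟩
  map_one' := rfl
  map_mul' _ _ := rfl
  map_zero' := rfl
  map_add' _ _ := rfl
  commutes' _ := rfl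

/-- The generalised function `x ↦ u (c + L x)`. -/
def GenFun.affine (c : F) (L : E →L[ℝ] F) : GenFun F →ₐ[ℂ] GenFun E :=
  Ideal.quotientMapₐ (negligibleNets E) (netAffine c L)
    (fun u hu => IsNegligibleOn.affine u.2.1 hu c L)

/-! ## Special types of generalised functions -/

/-- The restriction of `u` to the open set `U` is zero. -/
def VanishesOn (U : Set E) (u : GenFun E) : Prop :=
  ∃ w, Represents w u ∧ IsNegligibleOn U w

/-- `u ∈ 𝒢_c(E)`: the support of `u` is compact. -/
def HasCompactSupp (u : GenFun E) : Prop :=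
  ∃ K : Set E, IsCompact K ∧ VanishesOn Kᶜ u

/-- `u` is slow scale regular. -/
def IsSlowScaleRegular (u : GenFun E) : Prop :=
  ∃ w, Represents w u ∧ ∀ K : Set E, IsCompact K → ∀ k : ℕ, ∃ μ : Eps → ℝ, IsSlowScale μ ∧
    SupO K (fun ε x => ‖iteratedFDeriv ℝ k (w ε) x‖) (fun ε => |μ ε|)

/-- `u` is of slow scale logarithmic type.  The slow scale net is taken `≥ 1`, so that its
logarithm is nonnegative and grows slowly. -/
def IsSlowScaleLog (u : GenFun E) : Prop :=
  ∃ w, Represents w u ∧ ∀ K : Set E, IsCompact K → ∃ μ : Eps → ℝ, IsSlowScale μ ∧ (∀ ε, 1 ≤ μ ε) ∧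
    SupO K (fun ε x => ‖w ε x‖) (fun ε => Real.log (μ ε))

end Spaces

/-! ## The wave front set -/

/-- The Euclidean space `ℝⁿ`. -/
abbrev Rn (n : ℕ) : Type := EuclideanSpace ℝ (Fin n)

/-- The Fourier transform `∫ e^{-i x·ξ} f(x) dx`. -/
def fourierHat {n : ℕ} (f : Rn n → ℂ) (ξ : Rn n) : ℂ :=
  ∫ x, Complex.exp (-Complex.I * ((inner ℝ x ξ : ℝ) : ℂ)) * f x

/-- `u` is microlocally `𝒢^∞`-regular at `(x₀, ξ₀)`. -/
def IsMicroRegular {n : ℕ} (u : GenFun (Rn n)) (x₀ ξ₀ : Rn n) : Prop :=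
  ∃ w, Represents w u ∧
    ∃ φ : Rn n → ℂ, ContDiff ℝ ∞ φ ∧ HasCompactSupport φ ∧ φ x₀ = 1 ∧
      ∃ Γ : Set (Rn n), IsOpen Γ ∧ ξ₀ ∈ Γ ∧ (∀ c : ℝ, 0 < c → ∀ ξ ∈ Γ, c • ξ ∈ Γ) ∧
        ∃ N : ℕ, ∀ l : ℝ,
          SupO Γ (fun ε ξ => (1 + ‖ξ‖ ^ 2) ^ (l / 2) * ‖fourierHat (fun x => φ x * w ε x) ξ‖)
            (fun ε => ((ε : ℝ)⁻¹) ^ N)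

/-- The `𝒢^∞`-wave front set, a subset of `T*ℝⁿ ∖ 0`. -/
def waveFront {n : ℕ} (u : GenFun (Rn n)) : Set (Rn n × Rn n) :=
  {p | p.2 ≠ 0 ∧ ¬ IsMicroRegular u p.1 p.2}

/-! ## The transport equation -/

/-- The `x`-support of `a ∈ 𝒢(ℝ × ℝⁿ)` is bounded, locally uniformly in `t`. -/
def HasCompactSuppInX {n : ℕ} (a : GenFun (ℝ × Rn n)) : Prop :=
  ∀ T : ℝ, ∃ R : ℝ, VanishesOn {p : ℝ × Rn n | |p.1| < T ∧ R < ‖p.2‖} a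

/-- The generalised function `(t,x) ↦ a(t)`. -/
def ofTime {n : ℕ} (a : GenFun ℝ) : GenFun (ℝ × Rn n) :=
  GenFun.affine 0 (ContinuousLinearMap.fst ℝ ℝ (Rn n)) a

/-- The restriction `u(t,·) ∈ 𝒢(ℝⁿ)`. -/
def slice {n : ℕ} (t : ℝ) (u : GenFun (ℝ × Rn n)) : GenFun (Rn n) :=
  GenFun.affine (t, 0) (ContinuousLinearMap.inr ℝ ℝ (Rn n)) u

/-- `D_t = -i ∂_t`. -/
def Dt {n : ℕ} (u : GenFun (ℝ × Rn n)) : GenFun (ℝ × Rn n) :=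
  (-Complex.I) • GenFun.dir ((1 : ℝ), (0 : Rn n)) u

/-- `D_j = -i ∂_{x_j}`. -/
def Dx {n : ℕ} (j : Fin n) (u : GenFun (ℝ × Rn n)) : GenFun (ℝ × Rn n) :=
  (-Complex.I) • GenFun.dir ((0 : ℝ), EuclideanSpace.single j (1 : ℝ)) u

/-- `u` solves `D_t u = ∑ⱼ a₁ⱼ(t) Dⱼ u + a₀(t,x) u`, `u(0,·) = u₀` in the Colombeau algebra. -/
def SolvesTransport {n : ℕ} (a₁ : Fin n → GenFun ℝ) (a₀ : GenFun (ℝ × Rn n))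
    (u₀ : GenFun (Rn n)) (u : GenFun (ℝ × Rn n)) : Prop :=
  Dt u = ∑ j, ofTime (a₁ j) * Dx j u + a₀ * u ∧ slice 0 u = u₀

/-- `Λ_{j,ε}(t) = -∫₀ᵗ a_{1,j,ε}(z) dz`. -/
def lam {n : ℕ} (A₁ : Fin n → Eps → ℝ → ℝ) (ε : Eps) (t : ℝ) : Rn n :=
  WithLp.toLp 2 fun j => -∫ z in (0 : ℝ)..t, A₁ j ε z

/-- The characteristic curve `γ_ε(x,t,s)` with `dγ_{j,ε}/ds = -a_{1,j,ε}(s)`, `γ_ε(x,t,t) = x`. -/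
def charCurve {n : ℕ} (A₁ : Fin n → Eps → ℝ → ℝ) (ε : Eps) (x : Rn n) (t s : ℝ) : Rn n :=
  x + lam A₁ ε s - lam A₁ ε t

/-- The phase function `φ_ε(t,x,η) = ∑ₕ γ_{h,ε}(x,t,0) ηₕ`. -/
def phase {n : ℕ} (A₁ : Fin n → Eps → ℝ → ℝ) (ε : Eps) (t : ℝ) (x η : Rn n) : ℝ :=
  ∑ h, charCurve A₁ ε x t 0 h * η h

/-- The amplitude `b_ε(t,x) = exp(i ∫₀ᵗ a_{0,ε}(s, γ_ε(x,t,s)) ds)`. -/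
def amplitude {n : ℕ} (A₁ : Fin n → Eps → ℝ → ℝ) (A₀ : Eps → ℝ × Rn n → ℂ) (ε : Eps)
    (t : ℝ) (x : Rn n) : ℂ :=
  Complex.exp (Complex.I * ∫ s in (0 : ℝ)..t, A₀ ε (s, charCurve A₁ ε x t s))

/-- The net `(2π)⁻ⁿ ∫ e^{i φ_ε(t,x,η)} b_ε(t,x) û_{0,ε}(η) dη`. -/
def fioNet {n : ℕ} (A₁ : Fin n → Eps → ℝ → ℝ) (A₀ : Eps → ℝ × Rn n → ℂ)
    (U₀ : Eps → Rn n → ℂ) : Eps → ℝ × Rn n → ℂ :=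
  fun ε p => (((2 * Real.pi) ^ n)⁻¹ : ℝ) *
    ∫ η, Complex.exp (Complex.I * (phase A₁ ε p.1 p.2 η : ℂ)) * amplitude A₁ A₀ ε p.1 p.2 *
      fourierHat (U₀ ε) η

/-- The characteristic curves solve their defining initial value problem. -/
theorem charCurve_hasDerivAt {n : ℕ} {A₁ : Fin n → Eps → ℝ → ℝ} {ε : Eps}
    (hA : ∀ j, Continuous (A₁ j ε)) (x : Rn n) (t s : ℝ) (j : Fin n) :
    HasDerivAt (fun s => charCurve A₁ ε x t s j) (-A₁ j ε s) s ∧ charCurve A₁ ε x t t = x := by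
  refine ⟨?_, by simp [charCurve]⟩
  have h := ((hA j).integral_hasStrictDerivAt 0 s).hasDerivAt.neg
  simpa [charCurve, lam] using (h.const_add (x j)).sub_const (lam A₁ ε t j)

/-- The inverse limiting Hamiltonian flow `χ_t⁻¹(y,η) = (y + Λ(t), η)`. -/
def flowInv {n : ℕ} (Λ : ℝ → Rn n) (t : ℝ) (p : Rn n × Rn n) : Rn n × Rn n :=
  (p.1 + Λ t, p.2)

end Colombeau

end

noncomputable section

namespace Colombeau

/-! ## Growth classes -/

/-! For fixed ε the equation is solved in closed form. The principal coefficients depend on t only,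
so the characteristics are the translates x = y + Λ_ε(t). Along them the equation is the ODE w' = i
a₀ w, hence u_ε(t,x) = exp(i C_ε(t, x - Λ_ε(t))) u₀_ε(x - Λ_ε(t)) with C_ε(t,y) = ∫₀ᵗ a₀_ε(s, y +
Λ_ε(s)) ds (`transportNet`). The phase is linear in η and the amplitude is free of η, so Fourier
inversion identifies this net with the oscillatory integral (`fioNet_eq_transportNet`).

Growth. Λ_ε and C_ε have slow scale bounds with all derivatives. Since a₀ is of slow scale
logarithmic type, exp(±i C_ε) is bounded by a power of a slow scale net, so it is slow scale too
(`IsTransportData.exp_integral_bounded`). As Λ_ε need not be bounded uniformly in t, estimates are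
made on slabs |t| ≤ T, unbounded in x; the bounded supports of a₀ and u₀ allow this. A moderate net
is negligible once its values are (`IsModerate.isNegligibleOn_univ`, by Landau's inequality). This
reduces independence of the representatives and uniqueness to estimates of values. For uniqueness,
exp(-i C_ε) is an integrating factor, and bounded Λ_ε keeps the characteristics in a compact set,
where the residual is negligible.

Wave front set. The slice u(t,·) is a slow scale regular factor times a translate of u₀ by a
convergent vector, and u₀ is recovered from u(t,·) in the same way. Both directions follow from
`IsMicroRegular.mul_translate`. Translation preserves the modulus of a Fourier transform.
Multiplication by the factor is convolution with a rapidly decreasing kernel whose bounds are slow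
scale, hence O(ε⁻¹) for every order of decay, so the exponent N stays independent of that order. The
convergence of Λ_ε(t) keeps the translated cutoffs in place. -/

theorem eventually_toZero {P : ℝ → Prop} (h : ∀ᶠ x in 𝓝 (0 : ℝ), P x) :
    ∀ᶠ ε : Eps in toZero, P ε :=
  tendsto_comap.eventually h

theorem one_le_inv_eps (ε : Eps) : 1 ≤ (ε : ℝ)⁻¹ := (one_le_inv₀ ε.2.1).2 ε.2.2

/-- Nets of real numbers that are `O(ε^{-N})` for some `N`. -/
def moderateScale : Subalgebra ℝ (Eps → ℝ) where
  carrier := {r | ∃ N : ℕ, ∃ C : ℝ, 0 ≤ C ∧ ∀ᶠ ε in toZero, |r ε| ≤ C * ((ε : ℝ)⁻¹) ^ N}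
  mul_mem' := by
    rintro r s ⟨N, C, hC, h⟩ ⟨M, D, hD, h'⟩
    refine ⟨N + M, C * D, mul_nonneg hC hD, ?_⟩
    filter_upwards [h, h'] with ε h h'
    rw [Pi.mul_apply, abs_mul, pow_add, mul_mul_mul_comm]
    exact mul_le_mul h h' (abs_nonneg _) (mul_nonneg hC (inv_pow_nonneg N ε))
  add_mem' := by
    rintro r s ⟨N, C, hC, h⟩ ⟨M, D, hD, h'⟩
    refine ⟨max N M, C + D, add_nonneg hC hD, ?_⟩
    filter_upwards [h, h'] with ε h h'
    rw [Pi.add_apply, add_mul]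
    exact (abs_add_le _ _).trans (add_le_add
      (h.trans (mul_le_mul_of_nonneg_left (inv_pow_mono (le_max_left N M) ε) hC))
      (h'.trans (mul_le_mul_of_nonneg_left (inv_pow_mono (le_max_right N M) ε) hD)))
  algebraMap_mem' c := ⟨0, |c|, abs_nonneg c, Eventually.of_forall fun ε => by simp⟩

theorem IsSlowScale.add {r s : Eps → ℝ} (hr : IsSlowScale r) (hs : IsSlowScale s) :
    IsSlowScale (r + s) := by
  intro q hq
  obtain ⟨C, hC⟩ := hr q hq
  obtain ⟨D, hD⟩ := hs q hq
  refine ⟨2 ^ q * (C + D), ?_⟩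
  filter_upwards [hC, hD] with ε h h'
  have h2 : |r ε + s ε| ≤ 2 * max |r ε| |s ε| := by
    refine (abs_add_le _ _).trans ?_
    rw [two_mul]
    exact add_le_add (le_max_left _ _) (le_max_right _ _)
  calc |(r + s) ε| ^ q ≤ (2 * max |r ε| |s ε|) ^ q :=
        Real.rpow_le_rpow (abs_nonneg _) h2 hq
    _ = 2 ^ q * (max |r ε| |s ε|) ^ q :=
        Real.mul_rpow (by norm_num) (le_max_of_le_left (abs_nonneg _))
    _ ≤ 2 ^ q * (|r ε| ^ q + |s ε| ^ q) := by
        refine mul_le_mul_of_nonneg_left ?_ (by positivity)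
        rcases max_choice |r ε| |s ε| with h | h <;> rw [h]
        · exact le_add_of_nonneg_right (by positivity)
        · exact le_add_of_nonneg_left (by positivity)
    _ ≤ 2 ^ q * (C + D) * (ε : ℝ)⁻¹ := by
        rw [mul_assoc, add_mul]
        exact mul_le_mul_of_nonneg_left (add_le_add h h') (by positivity)

theorem IsSlowScale.mul {r s : Eps → ℝ} (hr : IsSlowScale r) (hs : IsSlowScale s) :
    IsSlowScale (r * s) := by
  intro q hq
  -- The exponent is doubled so that xy ≤ x² + y² separates the two factors.
  obtain ⟨C, hC⟩ := hr (2 * q) (by positivity)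
  obtain ⟨D, hD⟩ := hs (2 * q) (by positivity)
  refine ⟨C + D, ?_⟩
  filter_upwards [hC, hD] with ε h h'
  rw [mul_comm 2 q, Real.rpow_mul (abs_nonneg _), Real.rpow_two] at h h'
  rw [Pi.mul_apply, abs_mul, Real.mul_rpow (abs_nonneg _) (abs_nonneg _), add_mul]
  nlinarith [sq_nonneg (|r ε| ^ q - |s ε| ^ q), Real.rpow_nonneg (abs_nonneg (r ε)) q,
    Real.rpow_nonneg (abs_nonneg (s ε)) q]

theorem isSlowScale_const (c : ℝ) : IsSlowScale fun _ => c := fun q _ =>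
  ⟨|c| ^ q, Eventually.of_forall fun ε =>
    le_mul_of_one_le_right (by positivity) (one_le_inv_eps ε)⟩

/-- The slow scale nets of real numbers. -/
def slowScale : Subalgebra ℝ (Eps → ℝ) where
  carrier := {r | IsSlowScale r}
  mul_mem' := IsSlowScale.mul
  add_mem' := IsSlowScale.add
  algebraMap_mem' := isSlowScale_const

theorem slowScale_le_moderateScale : slowScale ≤ moderateScale := by
  intro r hr
  obtain ⟨C, hC⟩ := hr 1 zero_le_one
  refine ⟨1, max C 0, le_max_right _ _, ?_⟩
  filter_upwards [hC] with ε h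
  rw [Real.rpow_one] at h
  rw [pow_one]
  exact h.trans (mul_le_mul_of_nonneg_right (le_max_left _ _) (inv_nonneg.2 ε.2.1.le))

theorem const_mem_growth (G : Subalgebra ℝ (Eps → ℝ)) (c : ℝ) : (fun _ => c) ∈ G :=
  G.algebraMap_mem c

/-! ### Nets of smooth maps bounded in a growth class -/

section Bounds

variable {E : Type*} [NormedAddCommGroup E] [NormedSpace ℝ E]
variable {F : Type*} [NormedAddCommGroup F] [NormedSpace ℝ F]
variable {V : Type*} [NormedAddCommGroup V] [NormedSpace ℝ V]
variable {G : Subalgebra ℝ (Eps → ℝ)}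

/-- The net `f` is bounded on `S` by a net of real numbers in `G`. -/
def BoundedOn {X : Type*} (G : Subalgebra ℝ (Eps → ℝ)) (S : Set X) (f : Eps → X → V) : Prop :=
  ∃ r ∈ G, ∀ᶠ ε in toZero, ∀ x ∈ S, ‖f ε x‖ ≤ r ε

/-- The net `f` of smooth functions is bounded on `S` by nets in `G`, with all derivatives. -/
def SmoothBoundedOn (G : Subalgebra ℝ (Eps → ℝ)) (S : Set E) (f : Eps → E → V) : Prop :=
  (∀ ε, ContDiff ℝ ∞ (f ε)) ∧ ∀ k, BoundedOn G S fun ε => iteratedFDeriv ℝ k (f ε)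

theorem BoundedOn.mono_scale {X W : Type*} [NormedAddCommGroup W] {G' : Subalgebra ℝ (Eps → ℝ)}
    (hG : G ≤ G') {S : Set X} {f : Eps → X → W} (h : BoundedOn G S f) : BoundedOn G' S f :=
  let ⟨r, hr, h⟩ := h
  ⟨r, hG hr, h⟩

theorem SmoothBoundedOn.mono_scale {G' : Subalgebra ℝ (Eps → ℝ)} (hG : G ≤ G') {S : Set E}
    {f : Eps → E → V} (h : SmoothBoundedOn G S f) : SmoothBoundedOn G' S f :=
  ⟨h.1, fun k => (h.2 k).mono_scale hG⟩

theorem BoundedOn.mono {X W : Type*} [NormedAddCommGroup W] {S S' : Set X} (hS : S ⊆ S')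
    {f : Eps → X → W}
    (h : BoundedOn G S' f) : BoundedOn G S f :=
  let ⟨r, hr, h⟩ := h
  ⟨r, hr, h.mono fun _ h x hx => h x (hS hx)⟩

theorem SmoothBoundedOn.mono {S S' : Set E} (hS : S ⊆ S') {f : Eps → E → V}
    (h : SmoothBoundedOn G S' f) : SmoothBoundedOn G S f :=
  ⟨h.1, fun k => (h.2 k).mono hS⟩

theorem SmoothBoundedOn.zeroth {S : Set E} {f : Eps → E → V} (h : SmoothBoundedOn G S f) :
    BoundedOn G S f := by
  simpa [BoundedOn] using h.2 0

theorem natCast_le_infty (k : ℕ) : (k : ℕ∞ω) ≤ ∞ := by exact_mod_cast le_top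

theorem SmoothBoundedOn.add {S : Set E} {f g : Eps → E → V} (hf : SmoothBoundedOn G S f)
    (hg : SmoothBoundedOn G S g) : SmoothBoundedOn G S fun ε x => f ε x + g ε x := by
  refine ⟨fun ε => (hf.1 ε).add (hg.1 ε), fun k => ?_⟩
  obtain ⟨r, hr, h⟩ := hf.2 k
  obtain ⟨s, hs, h'⟩ := hg.2 k
  refine ⟨r + s, add_mem hr hs, ?_⟩
  filter_upwards [h, h'] with ε h h' x hx
  have := iteratedFDeriv_add_apply (x := x) ((hf.1 ε).of_le (natCast_le_infty k)).contDiffAt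
    ((hg.1 ε).of_le (natCast_le_infty k)).contDiffAt
  exact (congrArg norm this).le.trans
    ((norm_add_le _ _).trans (add_le_add (h x hx) (h' x hx)))

theorem SmoothBoundedOn.clm_comp {S : Set E} {f : Eps → E → F} (hf : SmoothBoundedOn G S f)
    (L : F →L[ℝ] V) : SmoothBoundedOn G S fun ε x => L (f ε x) := by
  refine ⟨fun ε => L.contDiff.comp (hf.1 ε), fun k => ?_⟩
  obtain ⟨r, hr, h⟩ := hf.2 k
  refine ⟨(fun _ => ‖L‖) * r, mul_mem (const_mem_growth G _) hr, ?_⟩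
  filter_upwards [h] with ε h x hx
  exact (L.norm_iteratedFDeriv_comp_left (hf.1 ε).contDiffAt (natCast_le_infty k)).trans
    (mul_le_mul_of_nonneg_left (h x hx) (norm_nonneg _))

theorem SmoothBoundedOn.mul {S : Set E} {f g : Eps → E → ℂ} (hf : SmoothBoundedOn G S f)
    (hg : SmoothBoundedOn G S g) : SmoothBoundedOn G S fun ε x => f ε x * g ε x := by
  refine ⟨fun ε => (hf.1 ε).mul (hg.1 ε), fun k => ?_⟩
  choose r hr h using hf.2
  choose s hs h' using hg.2
  refine ⟨∑ i ∈ Finset.range (k + 1), (fun _ => (k.choose i : ℝ)) * r i * s (k - i),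
    sum_mem fun i _ => mul_mem (mul_mem (const_mem_growth G _) (hr i)) (hs _), ?_⟩
  filter_upwards [(eventually_all_finset (Finset.range (k + 1))).2 fun i _ => h i,
    (eventually_all_finset (Finset.range (k + 1))).2 fun i _ => h' (k - i)] with ε h h' x hx
  refine (norm_iteratedFDeriv_mul_le (hf.1 ε) (hg.1 ε) x (natCast_le_infty k)).trans ?_
  rw [Finset.sum_apply]
  refine Finset.sum_le_sum fun i hi => ?_
  have h1 := h i hi x hx
  exact mul_le_mul (mul_le_mul_of_nonneg_left h1 (Nat.cast_nonneg _)) (h' i hi x hx)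
    (norm_nonneg _) (mul_nonneg (Nat.cast_nonneg _) ((norm_nonneg _).trans h1))

/-- Composition with a net of maps whose derivatives of positive order are controlled. -/
theorem SmoothBoundedOn.comp {S : Set E} {S' : Set F} {g : Eps → F → V} {f : Eps → E → F}
    (hg : SmoothBoundedOn G S' g) (hf : ∀ ε, ContDiff ℝ ∞ (f ε))
    (hf' : ∀ k, 1 ≤ k → BoundedOn G S fun ε => iteratedFDeriv ℝ k (f ε))
    (hS : ∀ᶠ ε in toZero, Set.MapsTo (f ε) S S') :
    SmoothBoundedOn G S fun ε x => g ε (f ε x) := by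
  refine ⟨fun ε => (hg.1 ε).comp (hf ε), fun k => ?_⟩
  choose r hr h using hg.2
  choose s hs h' using fun k => hf' (k + 1) (Nat.le_add_left _ _)
  set C : Eps → ℝ := ∑ i ∈ Finset.range (k + 1), r i with hC
  -- The Faà di Bruno estimate asks for the j-th derivative of the inner map to be at most D ^ j. A
  -- single D ≥ 1 dominating all the bounds achieves this.
  set D : Eps → ℝ := (fun _ => 1) + ∑ i ∈ Finset.range k, s i with hD
  refine ⟨(fun _ => (k.factorial : ℝ)) * C * D ^ k, mul_mem (mul_mem (const_mem_growth G _)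
    (sum_mem fun i _ => hr i)) (pow_mem (add_mem (const_mem_growth G _)
      (sum_mem fun i _ => hs i)) k), ?_⟩
  filter_upwards [(eventually_all_finset (Finset.range (k + 1))).2 fun i _ => h i,
    (eventually_all_finset (Finset.range k)).2 fun i _ => h' i, hS] with ε h h' hS x hx
  refine norm_iteratedFDeriv_comp_le (hg.1 ε) (hf ε) (natCast_le_infty k) x (C := C ε) (D := D ε)
    (fun i hi => ?_) (fun i hi hi' => ?_)
  · have hpos : ∀ j ∈ Finset.range (k + 1), 0 ≤ r j ε := fun j hj =>
      (norm_nonneg _).trans (h j hj _ (hS hx))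
    have hi : i ∈ Finset.range (k + 1) := Finset.mem_range.2 (by omega)
    rw [hC, Finset.sum_apply]
    exact (h i hi _ (hS hx)).trans (Finset.single_le_sum (f := fun j => r j ε) hpos hi)
  · obtain ⟨j, rfl⟩ := Nat.exists_eq_add_of_le' hi
    have hpos : ∀ j ∈ Finset.range k, 0 ≤ s j ε := fun j hj =>
      (norm_nonneg _).trans (h' j hj x hx)
    have hj : j ∈ Finset.range k := Finset.mem_range.2 (by omega)
    have h1 : ‖iteratedFDeriv ℝ (j + 1) (f ε) x‖ ≤ ∑ j ∈ Finset.range k, s j ε :=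
      (h' j hj x hx).trans (Finset.single_le_sum (f := fun j => s j ε) hpos hj)
    have h2 : D ε = 1 + ∑ j ∈ Finset.range k, s j ε := by simp [hD]
    have h3 : 0 ≤ ∑ j ∈ Finset.range k, s j ε := Finset.sum_nonneg hpos
    have h4 : 1 ≤ D ε := by linarith
    calc ‖iteratedFDeriv ℝ (j + 1) (f ε) x‖ ≤ D ε := by linarith
      _ ≤ D ε ^ (j + 1) := le_self_pow₀ h4 (by omega)

/-- The real derivative of exp at z is multiplication by exp z, and the embedding of ℂ into its
multiplication operators has norm at most 1, so the bound passes from order k to k + 1. -/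
theorem norm_iteratedFDeriv_cexp_le (k : ℕ) (z : ℂ) :
    ‖iteratedFDeriv ℝ k Complex.exp z‖ ≤ ‖Complex.exp z‖ := by
  induction k with
  | zero => simp
  | succ k ih =>
    let L : ℂ →L[ℝ] ℂ →L[ℝ] ℂ := ContinuousLinearMap.mul ℝ ℂ
    have hL : ‖L‖ ≤ 1 := ContinuousLinearMap.opNorm_mul_le ℝ ℂ
    have h : fderiv ℝ Complex.exp = fun z => L (Complex.exp z) := by
      ext1 z
      have := (Complex.hasDerivAt_exp z).hasFDerivAt.restrictScalars ℝ
      rw [this.fderiv]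
      ext x
      simp [L, mul_comm]
    rw [← norm_iteratedFDeriv_fderiv, h]
    refine (L.norm_iteratedFDeriv_comp_left (f := Complex.exp) (N := ∞)
      Complex.contDiff_exp.contDiffAt (natCast_le_infty k)).trans ?_
    exact (mul_le_mul hL ih (norm_nonneg _) zero_le_one).trans_eq (one_mul _)

/-- A growth class is not closed under exponentials, so the size of exp ∘ f is a separate
hypothesis. Each derivative is exp ∘ f times a polynomial in derivatives of f, and needs nothing
more. -/
theorem SmoothBoundedOn.cexp {S : Set E} {f : Eps → E → ℂ} (hf : SmoothBoundedOn G S f)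
    (h : BoundedOn G S fun ε x => Complex.exp (f ε x)) :
    SmoothBoundedOn G S fun ε x => Complex.exp (f ε x) := by
  obtain ⟨r, hr, h⟩ := h
  refine ⟨fun ε => Complex.contDiff_exp.comp (hf.1 ε), fun k => ?_⟩
  choose s hs h' using hf.2
  set D : Eps → ℝ := (fun _ => 1) + ∑ i ∈ Finset.range (k + 1), s i with hD
  refine ⟨(fun _ => (k.factorial : ℝ)) * r * D ^ k, mul_mem (mul_mem (const_mem_growth G _)
    hr) (pow_mem (add_mem (const_mem_growth G _) (sum_mem fun i _ => hs i)) k), ?_⟩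
  filter_upwards [(eventually_all_finset (Finset.range (k + 1))).2 fun i _ => h' i, h]
    with ε h' h x hx
  refine norm_iteratedFDeriv_comp_le (N := ∞) Complex.contDiff_exp (hf.1 ε) (natCast_le_infty k) x
    (C := r ε) (D := D ε) (fun i hi => (norm_iteratedFDeriv_cexp_le i _).trans (h x hx))
    (fun i hi hi' => ?_)
  have hpos : ∀ j ∈ Finset.range (k + 1), 0 ≤ s j ε := fun j hj =>
    (norm_nonneg _).trans (h' j hj x hx)
  have hj : i ∈ Finset.range (k + 1) := Finset.mem_range.2 (by omega)
  have h1 : ‖iteratedFDeriv ℝ i (f ε) x‖ ≤ ∑ j ∈ Finset.range (k + 1), s j ε :=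
    (h' i hj x hx).trans (Finset.single_le_sum (f := fun j => s j ε) hpos hj)
  have h2 : D ε = 1 + ∑ j ∈ Finset.range (k + 1), s j ε := by simp [hD]
  have h3 : 0 ≤ ∑ j ∈ Finset.range (k + 1), s j ε := Finset.sum_nonneg hpos
  have h4 : 1 ≤ D ε := by linarith
  calc ‖iteratedFDeriv ℝ i (f ε) x‖ ≤ D ε := by linarith
    _ ≤ D ε ^ i := le_self_pow₀ h4 (by omega)

end Bounds

section Calculus

/-! ## Integrals depending on a parameter -/

/-- Differentiation in the parameter stays within the jointly smooth families, which makes the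
inductions on the order below possible. -/
theorem continuous_fderiv_param {E V : Type*} [NormedAddCommGroup E] [NormedSpace ℝ E]
    [NormedAddCommGroup V] [NormedSpace ℝ V] {H : ℝ → E → V}
    (hH : ContDiff ℝ ∞ (Function.uncurry H)) :
    ContDiff ℝ ∞ (Function.uncurry fun σ x => fderiv ℝ (H σ) x) := by
  have h1 : ContDiff ℝ ∞ (Function.uncurry fun (p : ℝ × E) => H p.1) :=
    hH.comp ((contDiff_fst.comp contDiff_fst).prodMk contDiff_snd)
  exact h1.fderiv (g := fun p : ℝ × E => p.2) contDiff_snd (by simp)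

theorem hasFDerivAt_integral_of_contDiff {E V : Type*} [NormedAddCommGroup E] [NormedSpace ℝ E]
    [NormedAddCommGroup V] [NormedSpace ℝ V] [FiniteDimensional ℝ E]
    {H : ℝ → E → V} (hH : ContDiff ℝ ∞ (Function.uncurry H)) (x : E) :
    HasFDerivAt (fun x => ∫ σ in (0 : ℝ)..1, H σ x) (∫ σ in (0 : ℝ)..1, fderiv ℝ (H σ) x) x := by
  have : ProperSpace E := FiniteDimensional.proper ℝ E
  have hd := (continuous_fderiv_param hH).continuous
  have hc : ∀ x, Continuous fun σ => H σ x := fun x =>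
    hH.continuous.comp (Continuous.prodMk continuous_id continuous_const)
  have hc' : Continuous fun σ => fderiv ℝ (H σ) x :=
    hd.comp (Continuous.prodMk continuous_id (continuous_const (y := x)))
  obtain ⟨C, hC⟩ := ((isCompact_Icc (a := (0 : ℝ)) (b := 1)).prod
    (isCompact_closedBall x 1)).exists_bound_of_continuousOn hd.continuousOn
  refine intervalIntegral.hasFDerivAt_integral_of_dominated_of_fderiv_le
    (F := fun x σ => H σ x) (F' := fun x σ => fderiv ℝ (H σ) x) (bound := fun _ => C)
    (Metric.closedBall_mem_nhds x one_pos)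
    (Eventually.of_forall fun x => (hc x).aestronglyMeasurable) ((hc x).intervalIntegrable _ _)
    hc'.aestronglyMeasurable (Eventually.of_forall fun t ht y hy => ?_)
    (continuous_const.intervalIntegrable _ _) (Eventually.of_forall fun t _ y _ => ?_)
  · rw [Set.uIoc_of_le zero_le_one] at ht
    exact hC (t, y) ⟨⟨ht.1.le, ht.2⟩, hy⟩
  · have : ContDiff ℝ ∞ (H t) := hH.comp (contDiff_prodMk_right t)
    exact (this.differentiable (by simp) y).hasFDerivAt

/-- Induction on the order, with `V` replaced by `E →L[ℝ] V` at each step; this is why `E` and `V`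
share a universe. -/
theorem contDiff_integral_of_contDiff.{u} {E V : Type u} [NormedAddCommGroup E] [NormedSpace ℝ E]
    [NormedAddCommGroup V] [NormedSpace ℝ V] [FiniteDimensional ℝ E]
    {H : ℝ → E → V} (hH : ContDiff ℝ ∞ (Function.uncurry H)) :
    ContDiff ℝ ∞ fun x => ∫ σ in (0 : ℝ)..1, H σ x := by
  refine contDiff_infty.2 fun n => ?_
  induction n generalizing V with
  | zero =>
    exact contDiff_zero.2 (continuous_iff_continuousAt.2 fun x =>
      (hasFDerivAt_integral_of_contDiff hH x).continuousAt)
  | succ n ih =>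
    rw [Nat.cast_add, Nat.cast_one, contDiff_succ_iff_fderiv]
    refine ⟨fun x => (hasFDerivAt_integral_of_contDiff hH x).differentiableAt, by simp, ?_⟩
    rw [funext fun x => (hasFDerivAt_integral_of_contDiff hH x).fderiv]
    exact ih (continuous_fderiv_param hH)

theorem norm_iteratedFDeriv_integral_le.{u} {E V : Type u} [NormedAddCommGroup E]
    [NormedSpace ℝ E] [NormedAddCommGroup V] [NormedSpace ℝ V] [FiniteDimensional ℝ E]
    {H : ℝ → E → V} (hH : ContDiff ℝ ∞ (Function.uncurry H)) (k : ℕ) (x : E) {C : ℝ}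
    (hC : ∀ σ ∈ Set.Icc (0 : ℝ) 1, ‖iteratedFDeriv ℝ k (H σ) x‖ ≤ C) :
    ‖iteratedFDeriv ℝ k (fun x => ∫ σ in (0 : ℝ)..1, H σ x) x‖ ≤ C := by
  induction k generalizing V with
  | zero =>
    rw [norm_iteratedFDeriv_zero]
    refine (intervalIntegral.norm_integral_le_of_norm_le_const (C := C) fun σ hσ => ?_).trans
      (by simp)
    rw [Set.uIoc_of_le zero_le_one] at hσ
    simpa using hC σ ⟨hσ.1.le, hσ.2⟩
  | succ k ih =>
    rw [← norm_iteratedFDeriv_fderiv, funext fun x => (hasFDerivAt_integral_of_contDiff hH x).fderiv]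
    refine ih (continuous_fderiv_param hH) fun σ hσ => ?_
    have := hC σ hσ
    rwa [← norm_iteratedFDeriv_fderiv] at this

theorem SmoothBoundedOn.integral.{u} {E V : Type u} [NormedAddCommGroup E]
    [NormedSpace ℝ E] [NormedAddCommGroup V] [NormedSpace ℝ V] [FiniteDimensional ℝ E]
    {G : Subalgebra ℝ (Eps → ℝ)} {S : Set E} {H : Eps → ℝ → E → V}
    (hH : ∀ ε, ContDiff ℝ ∞ (Function.uncurry (H ε)))
    (h : ∀ k, ∃ r ∈ G, ∀ᶠ ε in toZero, ∀ σ ∈ Set.Icc (0 : ℝ) 1, ∀ x ∈ S,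
      ‖iteratedFDeriv ℝ k (H ε σ) x‖ ≤ r ε) :
    SmoothBoundedOn G S fun ε x => ∫ σ in (0 : ℝ)..1, H ε σ x := by
  refine ⟨fun ε => contDiff_integral_of_contDiff (hH ε), fun k => ?_⟩
  obtain ⟨r, hr, h⟩ := h k
  refine ⟨r, hr, ?_⟩
  filter_upwards [h] with ε h x hx
  exact norm_iteratedFDeriv_integral_le (hH ε) k x fun σ hσ => h σ hσ x hx

/-! ## Negligibility is a condition on the values of a moderate net -/

/-- Landau's inequality. -/
theorem norm_fderiv_le_of_bounds {E V : Type*} [NormedAddCommGroup E] [NormedSpace ℝ E]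
    [NormedAddCommGroup V] [NormedSpace ℝ V] {f : E → V} (hf : ContDiff ℝ 2 f) {x : E} {a b h : ℝ}
    (hh : 0 < h) (ha : ∀ y ∈ Metric.closedBall x h, ‖f y‖ ≤ a)
    (hb : ∀ y ∈ Metric.closedBall x h, ‖fderiv ℝ (fderiv ℝ f) y‖ ≤ b) :
    ‖fderiv ℝ f x‖ ≤ 2 * a / h + b * h := by
  have hx : x ∈ Metric.closedBall x h := Metric.mem_closedBall_self hh.le
  have ha0 : 0 ≤ a := (norm_nonneg _).trans (ha x hx)
  have hb0 : 0 ≤ b := (norm_nonneg (fderiv ℝ (fderiv ℝ f) x)).trans (hb x hx)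
  have hf1 : ContDiff ℝ 1 (fderiv ℝ f) := hf.fderiv_right (by norm_num)
  have h1 : ∀ y ∈ Metric.closedBall x h, ‖fderiv ℝ f y - fderiv ℝ f x‖ ≤ b * h := by
    intro y hy
    refine ((convex_closedBall x h).norm_image_sub_le_of_norm_fderiv_le
      (fun z _ => hf1.differentiable (by simp) z) hb hx hy).trans ?_
    exact mul_le_mul_of_nonneg_left (by simpa [dist_eq_norm] using hy) hb0
  -- On a unit vector v, compare h f'(x)v with f(x + hv) - f(x): the Taylor remainder is at most b
  -- h².
  refine ContinuousLinearMap.opNorm_le_of_unit_norm (by positivity) fun v hv => ?_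
  have hy : x + h • v ∈ Metric.closedBall x h := by
    simp [norm_smul, hv, abs_of_pos hh]
  have h2 := (convex_closedBall x h).norm_image_sub_le_of_norm_fderiv_le'
    (fun z _ => hf.differentiable (by simp) z) h1 hx hy
  simp only [add_sub_cancel_left, map_smul, norm_smul, hv, Real.norm_eq_abs, abs_of_pos hh,
    mul_one] at h2
  have h3 : h * ‖fderiv ℝ f x v‖ ≤ 2 * a + b * h * h := by
    calc h * ‖fderiv ℝ f x v‖ = ‖h • fderiv ℝ f x v‖ := by
          rw [norm_smul, Real.norm_eq_abs, abs_of_pos hh]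
      _ = ‖(f (x + h • v) - f x) - (f (x + h • v) - f x - h • fderiv ℝ f x v)‖ := by
          rw [sub_sub_cancel]
      _ ≤ (‖f (x + h • v)‖ + ‖f x‖) + b * h * h :=
          (norm_sub_le _ _).trans (add_le_add (norm_sub_le _ _) h2)
      _ ≤ 2 * a + b * h * h := by linarith [ha _ hy, ha _ hx]
  rw [div_add' _ _ _ hh.ne', le_div_iff₀ hh]
  linarith

theorem supO_fderiv_of_supO {E V : Type*} [NormedAddCommGroup E] [NormedSpace ℝ E]
    [FiniteDimensional ℝ E] [NormedAddCommGroup V] [NormedSpace ℝ V] {u : Eps → E → V}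
    (hu : ∀ ε, ContDiff ℝ ∞ (u ε))
    (hmod : ∀ K : Set E, IsCompact K → ∀ k : ℕ, ∃ N : ℕ,
      SupO K (fun ε x => ‖iteratedFDeriv ℝ k (u ε) x‖) (fun ε => ((ε : ℝ)⁻¹) ^ N))
    (hneg : ∀ K : Set E, IsCompact K → ∀ q : ℕ,
      SupO K (fun ε x => ‖u ε x‖) (fun ε => (ε : ℝ) ^ q))
    {K : Set E} (hK : IsCompact K) (q : ℕ) :
    SupO K (fun ε x => ‖fderiv ℝ (u ε) x‖) (fun ε => (ε : ℝ) ^ q) := by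
  have : ProperSpace E := FiniteDimensional.proper ℝ E
  have hK' : IsCompact (Metric.cthickening 1 K) := hK.cthickening
  obtain ⟨N, hN⟩ := hmod _ hK' 2
  obtain ⟨B, hB⟩ := hN
  -- Landau's inequality is used with step h = ε ^ (N + q). The second derivative is O(ε^(-N)), so b
  -- h is O(ε ^ q), and values of order q + (N + q) make 2a / h of order ε ^ q as well. Since ε ≤ 1,
  -- the step stays within the 1-thickening of `K`.
  obtain ⟨A, hA⟩ := hneg _ hK' (q + (N + q))
  refine ⟨2 * A + B, ?_⟩
  filter_upwards [hB, hA] with ε hB hA x hx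
  have hε := ε.2.1
  have hsub : Metric.closedBall x ((ε : ℝ) ^ (N + q)) ⊆ Metric.cthickening 1 K :=
    (Metric.closedBall_subset_closedBall (pow_le_one₀ hε.le ε.2.2)).trans
      (Metric.closedBall_subset_cthickening hx 1)
  refine (norm_fderiv_le_of_bounds ((hu ε).of_le (natCast_le_infty 2)) (pow_pos hε (N + q))
    (b := B * (ε : ℝ)⁻¹ ^ N) (fun y hy => hA y (hsub hy)) (fun y hy => ?_)).trans (le_of_eq ?_)
  · have := hB y (hsub hy)
    rwa [← norm_iteratedFDeriv_fderiv, norm_iteratedFDeriv_one] at this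
  · have := hε.ne'
    rw [pow_add, pow_add, inv_pow]
    field_simp

theorem supO_iteratedFDeriv_of_supO.{u} {E V : Type u} [NormedAddCommGroup E] [NormedSpace ℝ E]
    [FiniteDimensional ℝ E] [NormedAddCommGroup V] [NormedSpace ℝ V] {u : Eps → E → V}
    (hu : ∀ ε, ContDiff ℝ ∞ (u ε))
    (hmod : ∀ K : Set E, IsCompact K → ∀ k : ℕ, ∃ N : ℕ,
      SupO K (fun ε x => ‖iteratedFDeriv ℝ k (u ε) x‖) (fun ε => ((ε : ℝ)⁻¹) ^ N))
    (hneg : ∀ K : Set E, IsCompact K → ∀ q : ℕ,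
      SupO K (fun ε x => ‖u ε x‖) (fun ε => (ε : ℝ) ^ q))
    {K : Set E} (hK : IsCompact K) (k q : ℕ) :
    SupO K (fun ε x => ‖iteratedFDeriv ℝ k (u ε) x‖) (fun ε => (ε : ℝ) ^ q) := by
  induction k generalizing V with
  | zero => simpa using hneg K hK q
  | succ k ih =>
    simp only [← norm_iteratedFDeriv_fderiv]
    refine ih (fun ε => (hu ε).fderiv_right (by simp)) (fun K hK k => ?_) (fun K hK q =>
      supO_fderiv_of_supO hu hmod hneg hK q)
    simp only [norm_iteratedFDeriv_fderiv]
    exact hmod K hK (k + 1)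

/-- Moderateness allows interpolation, so only the values of the net have to be estimated. Every
later proof of negligibility of a solution net goes through this. `E` lies in `Type` to match the
universe of ℂ. -/
theorem IsModerate.isNegligibleOn_univ {E : Type} [NormedAddCommGroup E] [NormedSpace ℝ E]
    [FiniteDimensional ℝ E] {u : Eps → E → ℂ} (hu : IsModerate u)
    (h : ∀ K : Set E, IsCompact K → ∀ q : ℕ,
      SupO K (fun ε x => ‖u ε x‖) (fun ε => (ε : ℝ) ^ q)) : IsNegligibleOn Set.univ u :=
  fun _ hK _ k q => supO_iteratedFDeriv_of_supO hu.1 hu.2 h hK k q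

end Calculus

/-! ### Localisation of negligible nets -/

section Local

variable {E : Type*} [NormedAddCommGroup E] [NormedSpace ℝ E]

theorem SupO.subset {X : Type*} {S S' : Set X} (hS : S ⊆ S') {f : Eps → X → ℝ} {g : Eps → ℝ}
    (h : SupO S' f g) : SupO S f g :=
  let ⟨C, hC⟩ := h
  ⟨C, hC.mono fun _ h x hx => h x (hS hx)⟩

theorem SupO.union {X : Type*} {S S' : Set X} {f : Eps → X → ℝ} {g : Eps → ℝ}
    (hg : ∀ ε, 0 ≤ g ε) (h : SupO S f g) (h' : SupO S' f g) : SupO (S ∪ S') f g := by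
  obtain ⟨C, hC⟩ := h
  obtain ⟨C', hC'⟩ := h'
  refine ⟨max C C', ?_⟩
  filter_upwards [hC, hC'] with ε h h' x hx
  rcases hx with hx | hx
  · exact (h x hx).trans (mul_le_mul_of_nonneg_right (le_max_left _ _) (hg ε))
  · exact (h' x hx).trans (mul_le_mul_of_nonneg_right (le_max_right _ _) (hg ε))

theorem IsNegligibleOn.mono {U U' : Set E} (hU : U ⊆ U') {u : Eps → E → ℂ}
    (h : IsNegligibleOn U' u) : IsNegligibleOn U u :=
  fun K hK hKU => h K hK (hKU.trans hU)

theorem isNegligibleOn_of_locally {u : Eps → E → ℂ} {U : Set E}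
    (h : ∀ x ∈ U, ∃ V ∈ 𝓝 x, IsNegligibleOn V u) : IsNegligibleOn U u := by
  intro K hK hKU k q
  suffices h : ∀ x ∈ K, ∃ t ∈ nhdsWithin x K, SupO t
      (fun ε x => ‖iteratedFDeriv ℝ k (u ε) x‖) (fun ε => (ε : ℝ) ^ q) by
    refine hK.induction_on (p := fun t => SupO t
      (fun ε x => ‖iteratedFDeriv ℝ k (u ε) x‖) (fun ε => (ε : ℝ) ^ q)) ⟨0, by simp⟩
      (fun s t hst ht => ht.subset hst) (fun s t hs ht => SupO.union (pow_nonneg' q) hs ht) h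
  intro x hx
  obtain ⟨V, hV, hneg⟩ := h x (hKU hx)
  obtain ⟨r, hr, hrV⟩ := Metric.nhds_basis_closedBall.mem_iff.1 hV
  refine ⟨K ∩ Metric.closedBall x r, inter_mem self_mem_nhdsWithin
    (mem_nhdsWithin_of_mem_nhds (Metric.closedBall_mem_nhds x hr)), ?_⟩
  exact hneg _ (hK.inter_right Metric.isClosed_closedBall) (Set.inter_subset_right.trans hrV) k q

theorem isNegligibleOn_of_eq_zero {U : Set E} (hU : IsOpen U) {u : Eps → E → ℂ}
    (h : ∀ ε, ∀ x ∈ U, u ε x = 0) : IsNegligibleOn U u := by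
  intro K _ hKU k q
  refine ⟨0, Eventually.of_forall fun ε x hx => ?_⟩
  have h0 : u ε =ᶠ[𝓝 x] fun _ => 0 := by
    filter_upwards [hU.mem_nhds (hKU hx)] with y hy using h ε y hy
  have := (h0.iteratedFDeriv ℝ k).eq_of_nhds
  simp [this]

/-! ## Representatives -/

theorem Represents.isModerate {w : Eps → E → ℂ} {u : GenFun E} (h : Represents w u) :
    IsModerate w := h.1

theorem Represents.exists (u : GenFun E) : ∃ w, Represents w u := by
  obtain ⟨⟨w, hw⟩, h⟩ := Ideal.Quotient.mk_surjective u
  exact ⟨w, hw, h⟩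

theorem Represents.isNegligibleOn_sub {w w' : Eps → E → ℂ} {u : GenFun E} (h : Represents w u)
    (h' : Represents w' u) : IsNegligibleOn Set.univ (w - w') := by
  obtain ⟨hw, h⟩ := h
  obtain ⟨hw', h'⟩ := h'
  exact Ideal.Quotient.eq.1 (h.trans h'.symm)

theorem Represents.congr {w w' : Eps → E → ℂ} {u : GenFun E} (h : Represents w u)
    (hw' : IsModerate w') (hneg : IsNegligibleOn Set.univ (w' - w)) : Represents w' u := by
  obtain ⟨hw, h⟩ := h
  exact ⟨hw', (Ideal.Quotient.eq.2 hneg).trans h⟩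

theorem Represents.unique {w : Eps → E → ℂ} {u v : GenFun E} (h : Represents w u)
    (h' : Represents w v) : u = v := by
  obtain ⟨hw, h⟩ := h
  obtain ⟨hw', h'⟩ := h'
  exact h.symm.trans h'

theorem Represents.eq_of_sub {w w' : Eps → E → ℂ} {u v : GenFun E} (h : Represents w u)
    (h' : Represents w' v) (hneg : IsNegligibleOn Set.univ (w' - w)) : u = v :=
  (h.congr h'.isModerate hneg).unique h'

theorem Represents.add {w w' : Eps → E → ℂ} {u v : GenFun E} (h : Represents w u)
    (h' : Represents w' v) : Represents (w + w') (u + v) := by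
  obtain ⟨hw, rfl⟩ := h
  obtain ⟨hw', rfl⟩ := h'
  exact ⟨add_mem hw hw', rfl⟩

theorem Represents.sub {w w' : Eps → E → ℂ} {u v : GenFun E} (h : Represents w u)
    (h' : Represents w' v) : Represents (w - w') (u - v) := by
  obtain ⟨hw, rfl⟩ := h
  obtain ⟨hw', rfl⟩ := h'
  exact ⟨sub_mem hw hw', rfl⟩

theorem Represents.mul {w w' : Eps → E → ℂ} {u v : GenFun E} (h : Represents w u)
    (h' : Represents w' v) : Represents (w * w') (u * v) := by
  obtain ⟨hw, rfl⟩ := h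
  obtain ⟨hw', rfl⟩ := h'
  exact ⟨mul_mem hw hw', rfl⟩

theorem Represents.smul (c : ℂ) {w : Eps → E → ℂ} {u : GenFun E} (h : Represents w u) :
    Represents (c • w) (c • u) := by
  obtain ⟨hw, rfl⟩ := h
  exact ⟨Subalgebra.smul_mem _ hw c, rfl⟩

theorem represents_zero : Represents (0 : Eps → E → ℂ) (0 : GenFun E) :=
  ⟨zero_mem _, rfl⟩

theorem Represents.sum {ι : Type*} (s : Finset ι) {w : ι → Eps → E → ℂ} {u : ι → GenFun E}
    (h : ∀ i ∈ s, Represents (w i) (u i)) : Represents (∑ i ∈ s, w i) (∑ i ∈ s, u i) := by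
  classical
  induction s using Finset.induction_on with
  | empty => simpa using represents_zero
  | insert a s ha ih =>
    rw [Finset.sum_insert ha, Finset.sum_insert ha]
    exact (h a (Finset.mem_insert_self a s)).add
      (ih fun i hi => h i (Finset.mem_insert_of_mem hi))

theorem Represents.dir (v : E) {w : Eps → E → ℂ} {u : GenFun E} (h : Represents w u) :
    Represents (fun ε x => fderiv ℝ (w ε) x v) (GenFun.dir v u) := by
  obtain ⟨hw, rfl⟩ := h
  exact ⟨IsModerate.dir hw v, rfl⟩

theorem Represents.affine {F : Type*} [NormedAddCommGroup F] [NormedSpace ℝ F]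
    (c : F) (L : E →L[ℝ] F) {w : Eps → F → ℂ} {u : GenFun F} (h : Represents w u) :
    Represents (fun ε x => w ε (c + L x)) (GenFun.affine c L u) := by
  obtain ⟨hw, rfl⟩ := h
  exact ⟨IsModerate.affine hw c L, rfl⟩

end Local

section Fourier

open MeasureTheory
open scoped FourierTransform

variable {n : ℕ}

/-! ## The Fourier transform of smooth functions of compact support -/

/-- Change of normalisation: `𝓕` has the kernel exp(-2πi x·ξ), which accounts for the dilation. -/
theorem fourierHat_eq (f : Rn n → ℂ) (ξ : Rn n) :
    fourierHat f ξ = 𝓕 f ((2 * Real.pi)⁻¹ • ξ) := by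
  rw [Real.fourier_eq', fourierHat]
  refine integral_congr_ae (Eventually.of_forall fun x => ?_)
  simp only [inner_smul_right, smul_eq_mul]
  congr 2
  have : (Real.pi : ℂ) ≠ 0 := by exact_mod_cast Real.pi_ne_zero
  push_cast
  field_simp

theorem norm_fourier_comp_add_right (f : Rn n → ℂ) (c ξ : Rn n) :
    ‖𝓕 (fun x => f (x + c)) ξ‖ = ‖𝓕 f ξ‖ := by
  have h := congrFun (VectorFourier.fourierIntegral_comp_add_right Real.fourierChar
    (volume : Measure (Rn n)) (innerₗ (Rn n)) f c) ξ
  change 𝓕 (fun x => f (x + c)) ξ = Real.fourierChar _ • 𝓕 f ξ at h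
  rw [h, Circle.norm_smul]

theorem integrable_fourier_of_contDiff {f : Rn n → ℂ} (hf : ContDiff ℝ ∞ f)
    (hf' : HasCompactSupport f) : Integrable (𝓕 f) := by
  have := (𝓕 (hf'.toSchwartzMap hf)).integrable (μ := volume)
  rwa [SchwartzMap.fourier_coe] at this

theorem fourierInv_fourier_of_contDiff {f : Rn n → ℂ} (hf : ContDiff ℝ ∞ f)
    (hf' : HasCompactSupport f) : 𝓕⁻ (𝓕 f) = f :=
  hf.continuous.fourierInv_fourier_eq (hf.continuous.integrable_of_hasCompactSupport hf')
    (integrable_fourier_of_contDiff hf hf')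

/-- The transform is moved across the pairing of 𝓕 f with x ↦ e^{2πi x·ξ} g(-x). On one side 𝓕 𝓕 f
is the reflection of f; on the other the transform of the modulated, reflected g is η ↦ 𝓕 g (ξ - η).
-/
theorem fourier_mul_eq_integral {f g : Rn n → ℂ} (hf : ContDiff ℝ ∞ f)
    (hf' : HasCompactSupport f) (hg : ContDiff ℝ ∞ g) (hg' : HasCompactSupport g) (ξ : Rn n) :
    𝓕 (fun x => g x * f x) ξ = ∫ η, 𝓕 f η * 𝓕 g (ξ - η) := by
  have hgi := hg.continuous.integrable_of_hasCompactSupport (μ := volume) hg'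
  have hhi : Integrable fun x : Rn n => Real.fourierChar (inner ℝ x ξ) • g (-x) := by
    refine hgi.comp_neg.mono ?_ (Eventually.of_forall fun x => by rw [Circle.norm_smul])
    have h1 : Continuous fun x : Rn n => Real.fourierChar (inner ℝ x ξ) :=
      Real.continuous_fourierChar.comp (by fun_prop)
    exact (h1.smul (hg.continuous.comp continuous_neg)).aestronglyMeasurable
  have key := VectorFourier.integral_bilin_fourierIntegral_eq_flip (ContinuousLinearMap.mul ℂ ℂ)
    (L := innerₗ (Rn n)) Real.continuous_fourierChar continuous_inner
    (integrable_fourier_of_contDiff hf hf') hhi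
  rw [flip_innerₗ] at key
  change ∫ x, 𝓕 (𝓕 f) x * (Real.fourierChar (inner ℝ x ξ) • g (-x)) =
    ∫ η, 𝓕 f η * 𝓕 (fun x : Rn n => Real.fourierChar (inner ℝ x ξ) • g (-x)) η at key
  have h1 : ∀ x, 𝓕 (𝓕 f) x = f (-x) := fun x => by
    conv_rhs => rw [← fourierInv_fourier_of_contDiff hf hf', Real.fourierInv_eq_fourier_neg,
      neg_neg]
  have h2 : ∀ η, 𝓕 (fun x : Rn n => Real.fourierChar (inner ℝ x ξ) • g (-x)) η =
      𝓕 g (ξ - η) := fun η => by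
    rw [Real.fourier_eq, Real.fourier_eq, ← integral_neg_eq_self]
    refine integral_congr_ae (Eventually.of_forall fun x => ?_)
    simp only [neg_neg, ← mul_smul, ← AddChar.map_add_eq_mul, inner_neg_left, inner_sub_right]
    congr 2
    ring
  simp only [h1, h2] at key
  rw [← key, Real.fourier_eq, ← integral_neg_eq_self]
  refine integral_congr_ae (Eventually.of_forall fun x => ?_)
  simp only [inner_neg_left, neg_neg, Circle.smul_def, smul_eq_mul]
  ring

theorem hasCompactSupport_of_eq_zero {R : ℝ} {g : Rn n → ℂ} (h : ∀ x, R < ‖x‖ → g x = 0) :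
    HasCompactSupport g :=
  HasCompactSupport.intro (isCompact_closedBall 0 R) fun x hx => h x (by simpa using hx)

theorem iteratedFDeriv_eq_zero_of_eq_zero {E V : Type*} [NormedAddCommGroup E] [NormedSpace ℝ E]
    [NormedAddCommGroup V] [NormedSpace ℝ V] {U : Set E} (hU : IsOpen U) {g : E → V}
    (h : ∀ x ∈ U, g x = 0) (k : ℕ) {x : E} (hx : x ∈ U) : iteratedFDeriv ℝ k g x = 0 := by
  have h0 : g =ᶠ[𝓝 x] fun _ => 0 := by
    filter_upwards [hU.mem_nhds hx] with y hy using h y hy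
  rw [(h0.iteratedFDeriv ℝ k).eq_of_nhds]
  exact congrFun (iteratedFDeriv_fun_zero) x

/-- The point is uniformity: `C` depends on the support radius and on m (and n), not on g, so the
bound applies to whole nets. -/
theorem pow_mul_norm_fourier_le (R : ℝ) (m : ℕ) : ∃ C : ℝ, 0 ≤ C ∧ ∀ (g : Rn n → ℂ) (B : ℝ),
    ContDiff ℝ ∞ g → (∀ x, R < ‖x‖ → g x = 0) → (∀ j ≤ m, ∀ x, ‖iteratedFDeriv ℝ j g x‖ ≤ B) →
    ∀ ξ, (1 + ‖ξ‖) ^ m * ‖𝓕 g ξ‖ ≤ C * B := by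
  set v : ℝ := (volume : Measure (Rn n)).real (Metric.closedBall 0 R) with hv
  have hv0 : 0 ≤ v := measureReal_nonneg
  -- Each derivative has L¹ norm at most B v. The outer 2 ^ m comes from (1 + t)^m ≤ 2^m (1 + t^m);
  -- the inner one and the m + 1 summands come from the estimate of ‖ξ‖^m times the transform.
  refine ⟨2 ^ m * (v + 2 ^ m * ((m + 1) * v)), by positivity, fun g B hg hR hB ξ => ?_⟩
  have hgc := hasCompactSupport_of_eq_zero hR
  have hint : ∀ j ≤ m, ∫ x, ‖iteratedFDeriv ℝ j g x‖ ≤ B * v := by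
    intro j hj
    rw [← setIntegral_eq_integral_of_forall_compl_eq_zero (s := Metric.closedBall (0 : Rn n) R)]
    · refine (Real.le_norm_self _).trans (norm_setIntegral_le_of_norm_le_const
        (isCompact_closedBall 0 R).measure_lt_top fun x _ => ?_)
      rw [norm_norm]
      exact hB j hj x
    · intro x hx
      rw [iteratedFDeriv_eq_zero_of_eq_zero (U := {x | R < ‖x‖})
        (isOpen_lt continuous_const continuous_norm) hR j (by simpa using hx), norm_zero]
  have h0 : ‖𝓕 g ξ‖ ≤ B * v := by
    refine (VectorFourier.norm_fourierIntegral_le_integral_norm _ _ _ _ _).trans ?_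
    simpa using hint 0 (Nat.zero_le _)
  have h1 : ‖ξ‖ ^ m * ‖𝓕 g ξ‖ ≤ 2 ^ m * ((m + 1) * (B * v)) := by
    have h := Real.pow_mul_norm_iteratedFDeriv_fourier_le (K := 0) (N := ⊤) (k := 0) (n := m)
      (f := g) hg (fun k j hk _ => ?_) le_rfl le_top ξ
    · simp only [norm_iteratedFDeriv_zero, pow_zero, one_mul, Nat.cast_zero, mul_zero, zero_add,
        Finset.range_one, Finset.singleton_product, Finset.sum_map] at h
      refine h.trans (mul_le_mul_of_nonneg_left ?_ (by positivity))
      simp only [Function.Embedding.coeFn_mk, pow_zero, one_mul]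
      refine (Finset.sum_le_card_nsmul (Finset.range (m + 1)) _ (B * v) fun j hj =>
        hint j (by simpa [Nat.lt_succ_iff] using hj)).trans (by simp)
    · obtain rfl : k = 0 := by simpa using hk
      simp only [pow_zero, one_mul]
      exact ((hg.continuous_iteratedFDeriv (natCast_le_infty j)).norm.integrable_of_hasCompactSupport
        (hgc.iteratedFDeriv j).norm)
  have h2 : (1 + ‖ξ‖) ^ m ≤ 2 ^ m * (1 + ‖ξ‖ ^ m) := by
    refine (add_pow_le zero_le_one (norm_nonneg ξ) m).trans ?_
    rw [one_pow]
    exact mul_le_mul_of_nonneg_right (pow_le_pow_right₀ one_le_two (Nat.sub_le _ _))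
      (by positivity)
  calc (1 + ‖ξ‖) ^ m * ‖𝓕 g ξ‖ ≤ 2 ^ m * (1 + ‖ξ‖ ^ m) * ‖𝓕 g ξ‖ :=
        mul_le_mul_of_nonneg_right h2 (norm_nonneg _)
    _ = 2 ^ m * (‖𝓕 g ξ‖ + ‖ξ‖ ^ m * ‖𝓕 g ξ‖) := by ring
    _ ≤ 2 ^ m * (B * v + 2 ^ m * ((m + 1) * (B * v))) :=
        mul_le_mul_of_nonneg_left (add_le_add h0 h1) (by positivity)
    _ = 2 ^ m * (v + 2 ^ m * ((m + 1) * v)) * B := by ring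

/-- The Fourier transform of a product decays in a cone where that of one factor decays. -/
theorem pow_mul_norm_fourier_mul_le {f g : Rn n → ℂ} (hf : ContDiff ℝ ∞ f)
    (hf' : HasCompactSupport f) (hg : ContDiff ℝ ∞ g) (hg' : HasCompactSupport g)
    {Γ : Set (Rn n)} {ξ : Rn n} {κ a a₀ b : ℝ} {m : ℕ} (hκ : 1 ≤ κ)
    (hξ : ∀ η ∉ Γ, ‖ξ‖ ≤ κ * ‖ξ - η‖ ∧ ‖η‖ ≤ κ * ‖ξ - η‖)
    (ha : ∀ η ∈ Γ, (1 + ‖η‖) ^ (m + (n + 1)) * ‖𝓕 f η‖ ≤ a) (ha₀ : ∀ η, ‖𝓕 f η‖ ≤ a₀)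
    (hb : ∀ ζ, (1 + ‖ζ‖) ^ (m + (n + 1)) * ‖𝓕 g ζ‖ ≤ b) (ha' : 0 ≤ a) :
    (1 + ‖ξ‖) ^ m * ‖𝓕 (fun x => g x * f x) ξ‖ ≤
      (a + κ ^ (m + (n + 1)) * a₀) * b * ∫ η : Rn n, (1 + ‖η‖) ^ (-((n : ℝ) + 1)) := by
  have ha₀' : 0 ≤ a₀ := (norm_nonneg _).trans (ha₀ 0)
  have hb' : 0 ≤ b := (by positivity : (0 : ℝ) ≤ _).trans (hb 0)
  have hκ0 : 0 ≤ κ := zero_le_one.trans hκ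
  -- Pointwise bound for the convolution integrand. For η in Γ the decay of 𝓕 f is available, and 1
  -- + |ξ| ≤ (1 + |η|)(1 + |ξ - η|). For η outside Γ the separation bounds both |ξ| and |η| by κ |ξ
  -- - η|, so the decay of 𝓕 g pays for everything. The extra n + 1 powers of 1 + |η| leave an
  -- integrable weight.
  have hpt : ∀ η, (1 + ‖ξ‖) ^ m * (1 + ‖η‖) ^ (n + 1) * (‖𝓕 f η‖ * ‖𝓕 g (ξ - η)‖) ≤
      (a + κ ^ (m + (n + 1)) * a₀) * b := by
    intro η
    by_cases hη : η ∈ Γ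
    · have h1 : 1 + ‖ξ‖ ≤ (1 + ‖η‖) * (1 + ‖ξ - η‖) := by
        have : ‖ξ‖ ≤ ‖η‖ + ‖ξ - η‖ := by simpa using norm_add_le η (ξ - η)
        nlinarith [norm_nonneg η, norm_nonneg (ξ - η)]
      have h2 : (1 + ‖ξ‖) ^ m ≤ (1 + ‖η‖) ^ m * (1 + ‖ξ - η‖) ^ (m + (n + 1)) := by
        refine (pow_le_pow_left₀ (by positivity) h1 m).trans ?_
        rw [mul_pow]
        exact mul_le_mul_of_nonneg_left (pow_le_pow_right₀ (by simp) (Nat.le_add_right _ _))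
          (by positivity)
      calc (1 + ‖ξ‖) ^ m * (1 + ‖η‖) ^ (n + 1) * (‖𝓕 f η‖ * ‖𝓕 g (ξ - η)‖)
          ≤ (1 + ‖η‖) ^ m * (1 + ‖ξ - η‖) ^ (m + (n + 1)) * (1 + ‖η‖) ^ (n + 1) *
            (‖𝓕 f η‖ * ‖𝓕 g (ξ - η)‖) := by gcongr
        _ = ((1 + ‖η‖) ^ (m + (n + 1)) * ‖𝓕 f η‖) *
            ((1 + ‖ξ - η‖) ^ (m + (n + 1)) * ‖𝓕 g (ξ - η)‖) := by ring
        _ ≤ a * b := mul_le_mul (ha η hη) (hb _) (by positivity) ha'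
        _ ≤ (a + κ ^ (m + (n + 1)) * a₀) * b :=
            mul_le_mul_of_nonneg_right (le_add_of_nonneg_right (by positivity)) hb'
    · obtain ⟨h1, h2⟩ := hξ η hη
      have h1 : 1 + ‖ξ‖ ≤ κ * (1 + ‖ξ - η‖) := by linarith
      have h2 : 1 + ‖η‖ ≤ κ * (1 + ‖ξ - η‖) := by linarith
      calc (1 + ‖ξ‖) ^ m * (1 + ‖η‖) ^ (n + 1) * (‖𝓕 f η‖ * ‖𝓕 g (ξ - η)‖)
          ≤ (κ * (1 + ‖ξ - η‖)) ^ m * (κ * (1 + ‖ξ - η‖)) ^ (n + 1) *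
            (‖𝓕 f η‖ * ‖𝓕 g (ξ - η)‖) := by gcongr
        _ = κ ^ (m + (n + 1)) * ‖𝓕 f η‖ *
            ((1 + ‖ξ - η‖) ^ (m + (n + 1)) * ‖𝓕 g (ξ - η)‖) := by rw [mul_pow, mul_pow]; ring
        _ ≤ κ ^ (m + (n + 1)) * a₀ * b := by gcongr; exacts [ha₀ η, hb _]
        _ ≤ (a + κ ^ (m + (n + 1)) * a₀) * b :=
            mul_le_mul_of_nonneg_right (le_add_of_nonneg_left ha') hb'
  have hI : Integrable fun η : Rn n => (1 + ‖η‖) ^ (-((n : ℝ) + 1)) :=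
    integrable_one_add_norm (by simp)
  rw [fourier_mul_eq_integral hf hf' hg hg', ← integral_const_mul]
  calc (1 + ‖ξ‖) ^ m * ‖∫ η, 𝓕 f η * 𝓕 g (ξ - η)‖
      = ‖∫ η, ((1 + ‖ξ‖) ^ m : ℝ) • (𝓕 f η * 𝓕 g (ξ - η))‖ := by
        rw [integral_smul, norm_smul, Real.norm_of_nonneg (by positivity)]
    _ ≤ _ := by
        refine norm_integral_le_of_norm_le (hI.const_mul _) (Eventually.of_forall fun η => ?_)
        have h3 : (1 + ‖η‖) ^ (-((n : ℝ) + 1)) = ((1 + ‖η‖) ^ (n + 1))⁻¹ := by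
          rw [Real.rpow_neg (by positivity), ← Real.rpow_natCast]
          push_cast
          rfl
        rw [norm_smul, Real.norm_of_nonneg (by positivity), norm_mul, h3, ← div_eq_mul_inv,
          le_div_iff₀ (by positivity)]
        refine le_trans (le_of_eq ?_) (hpt η)
        ring

/-- A conic neighbourhood of `ξ₀` which is well separated from the complement of `Γ`. -/
theorem exists_conic_nhd {Γ : Set (Rn n)} (hΓ : IsOpen Γ) {ξ₀ : Rn n} (hξ₀ : ξ₀ ∈ Γ)
    (hcone : ∀ c : ℝ, 0 < c → ∀ ξ ∈ Γ, c • ξ ∈ Γ) :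
    ∃ Γ' ⊆ Γ, IsOpen Γ' ∧ ξ₀ ∈ Γ' ∧ (∀ c : ℝ, 0 < c → ∀ ξ ∈ Γ', c • ξ ∈ Γ') ∧
      ∃ κ : ℝ, 1 ≤ κ ∧ ∀ ξ ∈ Γ', ∀ η ∉ Γ, ‖ξ‖ ≤ κ * ‖ξ - η‖ ∧ ‖η‖ ≤ κ * ‖ξ - η‖ := by
  obtain ⟨r, hr, hball⟩ := Metric.isOpen_iff.1 hΓ ξ₀ hξ₀
  -- The cone over the ball of half the radius. If cξ lies in that ball and η is outside Γ, then cη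
  -- is outside the full ball, so c|ξ - η| ≥ r/2, while c|ξ| ≤ |ξ₀| + r. The summand 1 in κ gives
  -- the bound on |η| by the triangle inequality.
  refine ⟨⋃ c ∈ Set.Ioi (0 : ℝ), (fun ξ => c • ξ) ⁻¹' Metric.ball ξ₀ (r / 2), ?_, ?_, ?_, ?_,
    (‖ξ₀‖ + r) / (r / 2) + 1, ?_, ?_⟩
  · simp only [Set.iUnion_subset_iff]
    intro c hc ξ hξ
    have h := hcone c⁻¹ (inv_pos.2 hc) _ (hball (Metric.ball_subset_ball (by linarith) hξ))
    have hc0 : c ≠ 0 := (Set.mem_Ioi.1 hc).ne'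
    simpa [smul_smul, inv_mul_cancel₀ hc0] using h
  · exact isOpen_biUnion fun c _ => Metric.isOpen_ball.preimage (continuous_const_smul c)
  · simp only [Set.mem_iUnion]
    exact ⟨1, Set.mem_Ioi.2 one_pos, by simpa using half_pos hr⟩
  · simp only [Set.mem_iUnion]
    rintro c hc ξ ⟨d, hd, hξ⟩
    refine ⟨d * c⁻¹, mul_pos hd (inv_pos.2 hc), ?_⟩
    simpa [smul_smul, hc.ne'] using hξ
  · linarith [show 0 ≤ (‖ξ₀‖ + r) / (r / 2) by positivity]
  · simp only [Set.mem_iUnion]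
    rintro ξ ⟨c, hc, hξ⟩ η hη
    have hc : 0 < c := hc
    have hη' : c • η ∉ Metric.ball ξ₀ r := fun h => hη (by
      simpa [smul_smul, inv_mul_cancel₀ hc.ne'] using hcone c⁻¹ (inv_pos.2 hc) _ (hball h))
    simp only [Set.mem_preimage, Metric.mem_ball, not_lt, dist_eq_norm] at hξ hη'
    have h1 : r / 2 ≤ c * ‖ξ - η‖ := by
      have h2 : ‖c • (ξ - η)‖ = c * ‖ξ - η‖ := by rw [norm_smul, Real.norm_of_nonneg hc.le]
      have h3 := norm_sub_le (c • ξ - ξ₀) (c • (ξ - η))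
      rw [show c • ξ - ξ₀ - c • (ξ - η) = c • η - ξ₀ by rw [smul_sub]; abel] at h3
      linarith
    have h2 : c * ‖ξ‖ ≤ ‖ξ₀‖ + r := by
      have h3 : ‖c • ξ‖ = c * ‖ξ‖ := by rw [norm_smul, Real.norm_of_nonneg hc.le]
      have h4 : ‖c • ξ‖ ≤ ‖ξ₀‖ + ‖c • ξ - ξ₀‖ := by
        simpa using norm_add_le ξ₀ (c • ξ - ξ₀)
      linarith
    have h3 : ‖ξ‖ ≤ (‖ξ₀‖ + r) / (r / 2) * ‖ξ - η‖ := by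
      rw [div_mul_eq_mul_div, le_div_iff₀ (half_pos hr)]
      refine le_of_mul_le_mul_left ?_ hc
      calc c * (‖ξ‖ * (r / 2)) = (c * ‖ξ‖) * (r / 2) := by ring
        _ ≤ (‖ξ₀‖ + r) * (c * ‖ξ - η‖) := by gcongr
        _ = c * ((‖ξ₀‖ + r) * ‖ξ - η‖) := by ring
    refine ⟨h3.trans ?_, ?_⟩
    · linarith [norm_nonneg (ξ - η)]
    · have : ‖η‖ ≤ ‖ξ‖ + ‖ξ - η‖ := by simpa using norm_sub_le ξ (ξ - η)
      linarith

end Fourier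

section MicroRegularity

open MeasureTheory
open scoped FourierTransform

variable {n : ℕ}

/-! ## Microlocal regularity -/

theorem sqrt_one_add_sq_le {t : ℝ} (ht : 0 ≤ t) : √(1 + t ^ 2) ≤ 1 + t :=
  Real.sqrt_le_iff.2 ⟨by positivity, by nlinarith⟩

theorem one_add_le_two_mul_sqrt (t : ℝ) : 1 + t ≤ 2 * √(1 + t ^ 2) := by
  have h1 : t ≤ √(1 + t ^ 2) := Real.le_sqrt_of_sq_le (by linarith)
  have h2 : 1 ≤ √(1 + t ^ 2) := Real.le_sqrt_of_sq_le (by nlinarith [sq_nonneg t])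
  linarith

/-- The decay condition of `IsMicroRegular`, with natural exponents. -/
theorem decay_iff {Γ : Set (Rn n)} (hcone : ∀ c : ℝ, 0 < c → ∀ ξ ∈ Γ, c • ξ ∈ Γ)
    (f : Eps → Rn n → ℂ) (N : ℕ) :
    (∀ l : ℝ, SupO Γ (fun ε ξ => (1 + ‖ξ‖ ^ 2) ^ (l / 2) * ‖fourierHat (f ε) ξ‖)
      (fun ε => ((ε : ℝ)⁻¹) ^ N)) ↔
    ∀ m : ℕ, SupO Γ (fun ε ξ => (1 + ‖ξ‖) ^ m * ‖𝓕 (f ε) ξ‖) (fun ε => ((ε : ℝ)⁻¹) ^ N) := by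
  have hpi : 1 ≤ 2 * Real.pi := by linarith [Real.pi_gt_three]
  have hpi0 : 0 < 2 * Real.pi := zero_lt_one.trans_le hpi
  constructor
  · intro h m
    obtain ⟨C, hC⟩ := h m
    refine ⟨2 ^ m * C, ?_⟩
    filter_upwards [hC] with ε hC ξ hξ
    have h1 := hC ((2 * Real.pi) • ξ) (hcone _ hpi0 ξ hξ)
    rw [fourierHat_eq, smul_smul, inv_mul_cancel₀ hpi0.ne', one_smul,
      Real.rpow_div_two_eq_sqrt _ (by positivity), Real.rpow_natCast] at h1
    have h2 : 1 + ‖ξ‖ ≤ 2 * √(1 + ‖(2 * Real.pi) • ξ‖ ^ 2) := by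
      refine le_trans ?_ (one_add_le_two_mul_sqrt _)
      rw [norm_smul, Real.norm_of_nonneg hpi0.le]
      nlinarith [norm_nonneg ξ]
    calc (1 + ‖ξ‖) ^ m * ‖𝓕 (f ε) ξ‖ ≤ (2 * √(1 + ‖(2 * Real.pi) • ξ‖ ^ 2)) ^ m * ‖𝓕 (f ε) ξ‖ := by
          gcongr
      _ = 2 ^ m * (√(1 + ‖(2 * Real.pi) • ξ‖ ^ 2) ^ m * ‖𝓕 (f ε) ξ‖) := by rw [mul_pow]; ring
      _ ≤ 2 ^ m * (C * ((ε : ℝ)⁻¹) ^ N) := by gcongr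
      _ = _ := by ring
  · intro h l
    -- For negative l the natural ceiling is 0, which suffices because the weight has base at least
    -- 1.
    obtain ⟨C, hC⟩ := h ⌈l⌉₊
    refine ⟨(2 * Real.pi) ^ ⌈l⌉₊ * C, ?_⟩
    filter_upwards [hC] with ε hC ξ hξ
    have h1 := hC _ (hcone _ (inv_pos.2 hpi0) ξ hξ)
    rw [fourierHat_eq, Real.rpow_div_two_eq_sqrt _ (by positivity)]
    set ζ := (2 * Real.pi)⁻¹ • ξ with hζ
    have h2 : 1 + ‖ξ‖ ≤ 2 * Real.pi * (1 + ‖ζ‖) := by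
      have : ‖ξ‖ = 2 * Real.pi * ‖ζ‖ := by
        rw [hζ, norm_smul, Real.norm_of_nonneg (inv_nonneg.2 hpi0.le), mul_inv_cancel_left₀ hpi0.ne']
      rw [this]
      linarith
    have h3 : √(1 + ‖ξ‖ ^ 2) ^ l ≤ (2 * Real.pi * (1 + ‖ζ‖)) ^ ⌈l⌉₊ := by
      have h4 : 1 ≤ √(1 + ‖ξ‖ ^ 2) := Real.le_sqrt_of_sq_le (by nlinarith [sq_nonneg ‖ξ‖])
      refine (Real.rpow_le_rpow_of_exponent_le h4 (Nat.le_ceil l)).trans ?_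
      rw [Real.rpow_natCast]
      exact pow_le_pow_left₀ (by positivity) ((sqrt_one_add_sq_le (norm_nonneg ξ)).trans h2) _
    calc √(1 + ‖ξ‖ ^ 2) ^ l * ‖𝓕 (f ε) ζ‖ ≤ (2 * Real.pi * (1 + ‖ζ‖)) ^ ⌈l⌉₊ * ‖𝓕 (f ε) ζ‖ := by
          gcongr
      _ = (2 * Real.pi) ^ ⌈l⌉₊ * ((1 + ‖ζ‖) ^ ⌈l⌉₊ * ‖𝓕 (f ε) ζ‖) := by rw [mul_pow]; ring
      _ ≤ (2 * Real.pi) ^ ⌈l⌉₊ * (C * ((ε : ℝ)⁻¹) ^ N) := by gcongr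
      _ = _ := by ring

/-! ### Smooth bounds on compact sets and for cutoffs -/

section

variable {E : Type*} [NormedAddCommGroup E] [NormedSpace ℝ E] {G : Subalgebra ℝ (Eps → ℝ)}

theorem smoothBoundedOn_const {V : Type*} [NormedAddCommGroup V] [NormedSpace ℝ V] {φ : E → V}
    (hφ : ContDiff ℝ ∞ φ) {K : Set E} (hK : IsCompact K) :
    SmoothBoundedOn G K fun _ => φ := by
  refine ⟨fun _ => hφ, fun k => ?_⟩
  obtain ⟨C, hC⟩ := hK.exists_bound_of_continuousOn
    (hφ.continuous_iteratedFDeriv (natCast_le_infty k)).continuousOn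
  exact ⟨fun _ => C, const_mem_growth G C, Eventually.of_forall fun _ => hC⟩

theorem SmoothBoundedOn.of_eq_zero {V : Type*} [NormedAddCommGroup V] [NormedSpace ℝ V]
    {K S : Set E} {f : Eps → E → V} {U : Set E} (hU : IsOpen U)
    (hf : SmoothBoundedOn G K f) (h : ∀ ε, ∀ x ∈ U, f ε x = 0) (hS : S ⊆ K ∪ U) :
    SmoothBoundedOn G S f := by
  refine ⟨hf.1, fun k => ?_⟩
  obtain ⟨r, hr, hrb⟩ := hf.2 k
  -- The bound r may be negative when `K` is empty; r² + 1 dominates both r and 0.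
  refine ⟨r * r + (fun _ => 1), add_mem (mul_mem hr hr) (const_mem_growth G 1), ?_⟩
  filter_upwards [hrb] with ε hrb x hx
  rcases hS hx with hx | hx
  · refine (hrb x hx).trans ?_
    simp only [Pi.add_apply, Pi.mul_apply]
    nlinarith [sq_nonneg (r ε - 1)]
  · rw [iteratedFDeriv_eq_zero_of_eq_zero hU (h ε) k hx, norm_zero]
    simp only [Pi.add_apply, Pi.mul_apply]
    nlinarith [sq_nonneg (r ε)]

theorem smoothBoundedOn_const_univ {φ : E → ℂ} (hφ : ContDiff ℝ ∞ φ) (hφ' : HasCompactSupport φ) :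
    SmoothBoundedOn G Set.univ fun _ => φ :=
  (smoothBoundedOn_const hφ hφ').of_eq_zero (U := (tsupport φ)ᶜ)
    (isClosed_tsupport φ).isOpen_compl
    (fun _ _ hx => image_eq_zero_of_notMem_tsupport hx)
    (by rw [Set.union_compl_self])

theorem SmoothBoundedOn.cutoff_mul {φ : E → ℂ} (hφ : ContDiff ℝ ∞ φ) (hφ' : HasCompactSupport φ)
    {f : Eps → E → ℂ} (hf : SmoothBoundedOn G (tsupport φ) f) :
    SmoothBoundedOn G Set.univ fun ε x => φ x * f ε x :=
  ((smoothBoundedOn_const hφ hφ').mul hf).of_eq_zero (U := (tsupport φ)ᶜ)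
    (isClosed_tsupport φ).isOpen_compl
    (fun ε x hx => by rw [image_eq_zero_of_notMem_tsupport hx, zero_mul])
    (by rw [Set.union_compl_self])

theorem IsModerate.smoothBoundedOn {u : Eps → E → ℂ} (hu : IsModerate u) {K : Set E}
    (hK : IsCompact K) : SmoothBoundedOn moderateScale K u := by
  refine ⟨hu.1, fun k => ?_⟩
  obtain ⟨N, hN⟩ := hu.2 K hK k
  obtain ⟨C, hC0, hC⟩ := hN.exists_nonneg (inv_pow_nonneg N)
  refine ⟨fun ε => C * ((ε : ℝ)⁻¹) ^ N, ⟨N, C, hC0, Eventually.of_forall fun ε => ?_⟩, hC⟩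
  rw [abs_of_nonneg (mul_nonneg hC0 (inv_pow_nonneg N ε))]

theorem isModerate_of_smoothBoundedOn {u : Eps → E → ℂ}
    (hs : ∀ ε, ContDiff ℝ ∞ (u ε))
    (hu : ∀ K : Set E, IsCompact K → SmoothBoundedOn moderateScale K u) : IsModerate u := by
  refine ⟨hs, fun K hK k => ?_⟩
  obtain ⟨r, ⟨N, C, _, hC⟩, h⟩ := (hu K hK).2 k
  refine ⟨N, C, ?_⟩
  filter_upwards [hC, h] with ε hC h x hx
  exact (h x hx).trans ((le_abs_self _).trans hC)

/-- The class `⊥` consists of the constant nets. Boundedness is all that is kept of negligibility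
here, so that changing representatives never worsens a bound by a power of ε⁻¹. -/
theorem IsNegligibleOn.smoothBoundedOn {u : Eps → E → ℂ} (hs : ∀ ε, ContDiff ℝ ∞ (u ε))
    {U : Set E} (hu : IsNegligibleOn U u) {K : Set E} (hK : IsCompact K) (hKU : K ⊆ U) :
    SmoothBoundedOn ⊥ K u := by
  refine ⟨hs, fun k => ?_⟩
  obtain ⟨C, hC⟩ := hu K hK hKU k 0
  exact ⟨fun _ => C, const_mem_growth ⊥ C, by simpa using hC⟩

end

theorem SmoothBoundedOn.fourier_decay {G : Subalgebra ℝ (Eps → ℝ)} {g : Eps → Rn n → ℂ}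
    (hg : SmoothBoundedOn G Set.univ g) {R : ℝ} (hR : ∀ ε x, R < ‖x‖ → g ε x = 0) (m : ℕ) :
    ∃ r ∈ G, ∀ᶠ ε in toZero, ∀ ξ, (1 + ‖ξ‖) ^ m * ‖𝓕 (g ε) ξ‖ ≤ r ε := by
  obtain ⟨C, _, hC⟩ := pow_mul_norm_fourier_le (n := n) R m
  choose r hr h using hg.2
  refine ⟨(fun _ => C) * ∑ j ∈ Finset.range (m + 1), r j,
    mul_mem (const_mem_growth G C) (sum_mem fun j _ => hr j), ?_⟩
  filter_upwards [(eventually_all_finset (Finset.range (m + 1))).2 fun j _ => h j] with ε h ξ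
  refine hC (g ε) _ (hg.1 ε) (hR ε) (fun j hj x => ?_) ξ
  have hj : j ∈ Finset.range (m + 1) := Finset.mem_range.2 (by omega)
  rw [Finset.sum_apply]
  exact (h j hj x trivial).trans (Finset.single_le_sum (f := fun j => r j ε)
    (fun i hi => (norm_nonneg _).trans (h i hi x trivial)) hj)

theorem HasCompactSupport.exists_eq_zero_of_norm_gt {φ : Rn n → ℂ} (hφ : HasCompactSupport φ) :
    ∃ R : ℝ, ∀ x, R < ‖x‖ → φ x = 0 := by
  obtain ⟨R, hR⟩ := hφ.isCompact.isBounded.exists_norm_le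
  exact ⟨R, fun x hx => image_eq_zero_of_notMem_tsupport fun h => (hR x h).not_gt hx⟩

/-- Microlocal regularity can be tested on any representative. -/
theorem IsMicroRegular.exists_decay {u : GenFun (Rn n)} {x₀ ξ₀ : Rn n}
    (h : IsMicroRegular u x₀ ξ₀) {w : Eps → Rn n → ℂ} (hw : Represents w u) :
    ∃ φ : Rn n → ℂ, ContDiff ℝ ∞ φ ∧ HasCompactSupport φ ∧ φ x₀ = 1 ∧
      ∃ Γ : Set (Rn n), IsOpen Γ ∧ ξ₀ ∈ Γ ∧ (∀ c : ℝ, 0 < c → ∀ ξ ∈ Γ, c • ξ ∈ Γ) ∧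
        ∃ N : ℕ, ∀ m : ℕ, SupO Γ (fun ε ξ => (1 + ‖ξ‖) ^ m * ‖𝓕 (fun x => φ x * w ε x) ξ‖)
          (fun ε => ((ε : ℝ)⁻¹) ^ N) := by
  obtain ⟨w', hw', φ, hφ, hφc, hφ1, Γ, hΓ, hξ₀, hcone, N, hN⟩ := h
  refine ⟨φ, hφ, hφc, hφ1, Γ, hΓ, hξ₀, hcone, N, fun m => ?_⟩
  obtain ⟨C, hC⟩ := (decay_iff hcone (fun ε x => φ x * w' ε x) N).1 hN m
  obtain ⟨R, hR⟩ := HasCompactSupport.exists_eq_zero_of_norm_gt hφc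
  -- The difference of representatives, cut off by φ, has a rapidly decreasing transform with bounds
  -- constant in ε. These are absorbed into ε^(-N) with the same N.
  have hneg := ((hw.isNegligibleOn_sub hw').smoothBoundedOn
    (fun ε => (hw.isModerate.1 ε).sub (hw'.isModerate.1 ε)) hφc.isCompact
    (Set.subset_univ _)).cutoff_mul hφ hφc
  obtain ⟨r, hr, hrb⟩ := hneg.fourier_decay (R := R) (fun ε x hx => by simp [hR x hx]) m
  obtain ⟨D, rfl⟩ := Algebra.mem_bot.1 hr
  refine ⟨C + |D|, ?_⟩
  filter_upwards [hC, hrb] with ε hC hD ξ hξ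
  have hint : ∀ {v : Eps → Rn n → ℂ}, IsModerate v → Integrable fun x => φ x * v ε x :=
    fun {v} hv => (hφ.continuous.mul (hv.1 ε).continuous).integrable_of_hasCompactSupport
      hφc.mul_right
  have hsum : 𝓕 (fun x => φ x * w ε x) ξ =
      𝓕 (fun x => φ x * w' ε x) ξ + 𝓕 (fun x => φ x * (w - w') ε x) ξ := by
    have h1 : (fun x => φ x * w ε x) =
        (fun x => φ x * w' ε x) + fun x => φ x * (w - w') ε x := by
      ext x
      simp only [Pi.add_apply, Pi.sub_apply]
      ring
    have h2 := congrFun (VectorFourier.fourierIntegral_add Real.continuous_fourierChar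
      (L := innerₗ (Rn n)) continuous_inner (hint hw'.isModerate)
      (hint (hw.sub hw').isModerate)) ξ
    rw [h1]
    exact h2
  have hD' : (algebraMap ℝ (Eps → ℝ)) D ε ≤ |D| * ((ε : ℝ)⁻¹) ^ N :=
    (le_abs_self D).trans (le_mul_of_one_le_right (abs_nonneg D)
      (one_le_pow₀ (one_le_inv_eps ε)))
  calc (1 + ‖ξ‖) ^ m * ‖𝓕 (fun x => φ x * w ε x) ξ‖
      ≤ (1 + ‖ξ‖) ^ m * (‖𝓕 (fun x => φ x * w' ε x) ξ‖ + ‖𝓕 (fun x => φ x * (w - w') ε x) ξ‖) := by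
        rw [hsum]
        gcongr
        exact norm_add_le _ _
    _ ≤ C * ((ε : ℝ)⁻¹) ^ N + |D| * ((ε : ℝ)⁻¹) ^ N := by
        rw [mul_add]
        exact add_le_add (hC ξ hξ) ((hD ξ).trans hD')
    _ = _ := by ring

theorem SmoothBoundedOn.comp_add_right {E : Type*} [NormedAddCommGroup E] [NormedSpace ℝ E]
    {G : Subalgebra ℝ (Eps → ℝ)} {f : Eps → E → ℂ} (hf : SmoothBoundedOn G Set.univ f)
    (c : Eps → E) : SmoothBoundedOn G Set.univ fun ε x => f ε (x + c ε) := by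
  refine ⟨fun ε => (hf.1 ε).comp (contDiff_id.add contDiff_const), fun k => ?_⟩
  obtain ⟨r, hr, h⟩ := hf.2 k
  refine ⟨r, hr, ?_⟩
  filter_upwards [h] with ε h x _
  rw [iteratedFDeriv_comp_add_right]
  exact h _ trivial

/-- Division of a smooth cutoff by a function without zeros near its support. -/
theorem contDiff_div_of_tsupport {E : Type*} [NormedAddCommGroup E] [NormedSpace ℝ E]
    {θ φ : E → ℂ} (hθ : ContDiff ℝ ∞ θ) (hφ : ContDiff ℝ ∞ φ)
    (h : ∀ x ∈ tsupport θ, φ x ≠ 0) : ContDiff ℝ ∞ fun x => θ x / φ x := by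
  refine contDiff_iff_contDiffAt.2 fun x => ?_
  by_cases hx : x ∈ tsupport θ
  · simp only [div_eq_mul_inv]
    exact hθ.contDiffAt.mul (hφ.contDiffAt.inv (h x hx))
  · have h0 : (fun x => θ x / φ x) =ᶠ[𝓝 x] fun _ => 0 := by
      filter_upwards [(isClosed_tsupport θ).isOpen_compl.mem_nhds hx] with y hy
      rw [image_eq_zero_of_notMem_tsupport hy, zero_div]
    exact contDiffAt_const.congr_of_eventuallyEq h0

theorem exists_complex_bump (x₀ : Rn n) {r R : ℝ} (hr : 0 < r) (hR : r < R) :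
    ∃ θ : Rn n → ℂ, ContDiff ℝ ∞ θ ∧ tsupport θ ⊆ Metric.closedBall x₀ R ∧
      (∀ x ∈ Metric.closedBall x₀ r, θ x = 1) ∧ ∀ x ∉ Metric.ball x₀ R, θ x = 0 := by
  let b : ContDiffBump x₀ := ⟨r, R, hr, hR⟩
  refine ⟨fun x => (b x : ℂ), Complex.ofRealCLM.contDiff.comp b.contDiff, ?_, fun x hx => ?_,
    fun x hx => ?_⟩
  · rw [← b.tsupport_eq]
    exact tsupport_comp_subset (g := ((↑) : ℝ → ℂ)) Complex.ofReal_zero b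
  · simp [b.one_of_mem_closedBall hx]
  · simp [b.zero_of_le_dist (by simpa using hx)]

/-- Multiplication by a slow scale regular net and translation by a convergent net preserve
microlocal regularity. -/
theorem IsMicroRegular.mul_translate {v v' : GenFun (Rn n)} {w z : Eps → Rn n → ℂ}
    (hw : Represents w v) (hz : Represents z v') {g : Eps → Rn n → ℂ}
    (hg : SmoothBoundedOn slowScale Set.univ g) {c : Eps → Rn n} {c₀ : Rn n}
    (hc : Tendsto c toZero (𝓝 c₀)) (hzw : ∀ ε x, z ε x = g ε x * w ε (x + c ε)) {x₀ ξ₀ : Rn n}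
    (h : IsMicroRegular v (x₀ + c₀) ξ₀) : IsMicroRegular v' x₀ ξ₀ := by
  obtain ⟨φ, hφ, hφc, hφ1, Γ, hΓ, hξ₀, hcone, N, hN⟩ := h.exists_decay hw
  obtain ⟨Γ', hΓΓ', hΓ', hξ₀', hcone', κ, hκ, hsep⟩ := exists_conic_nhd hΓ hξ₀ hcone
  have hφ0 : ∀ᶠ x in 𝓝 (x₀ + c₀), φ x ≠ 0 :=
    hφ.continuous.continuousAt.eventually_ne (by rw [hφ1]; exact one_ne_zero)
  obtain ⟨ρ, hρ, hρφ⟩ := Metric.nhds_basis_closedBall.eventually_iff.1 hφ0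
  -- If x is within ρ/3 of x₀ and c_ε within ρ/3 of c₀, then x + c_ε is within 2ρ/3 of x₀ + c₀,
  -- where θ = 1. The support of θ stays in the ball of radius ρ, where φ has no zeros, so θ/φ is
  -- smooth and cancels φ.
  obtain ⟨θ, hθ, hθs, hθ1, -⟩ := exists_complex_bump (x₀ + c₀) (r := 2 * ρ / 3) (R := ρ)
    (by positivity) (by linarith)
  obtain ⟨ψ, hψ, hψs, hψ1, hψ0⟩ := exists_complex_bump x₀ (r := ρ / 6) (R := ρ / 3)
    (by positivity) (by linarith)
  have hθc : HasCompactSupport θ :=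
    (isCompact_closedBall _ _).of_isClosed_subset (isClosed_tsupport _) hθs
  have hψc : HasCompactSupport ψ :=
    (isCompact_closedBall _ _).of_isClosed_subset (isClosed_tsupport _) hψs
  set χ : Rn n → ℂ := fun x => θ x / φ x with hχ
  have hχs : ContDiff ℝ ∞ χ := contDiff_div_of_tsupport hθ hφ fun x hx => hρφ (hθs hx)
  have hχc : HasCompactSupport χ := by
    simp only [hχ, div_eq_mul_inv]
    exact hθc.mul_right
  obtain ⟨R, hR⟩ := HasCompactSupport.exists_eq_zero_of_norm_gt hψc
  obtain ⟨R', hR'⟩ := HasCompactSupport.exists_eq_zero_of_norm_gt hφc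
  have hG : SmoothBoundedOn slowScale Set.univ fun ε x => ψ x * (g ε x * χ (x + c ε)) :=
    SmoothBoundedOn.mul (smoothBoundedOn_const_univ hψ hψc)
      (hg.mul ((smoothBoundedOn_const_univ hχs hχc).comp_add_right c))
  have hF : SmoothBoundedOn moderateScale Set.univ fun ε x => φ x * w ε x :=
    (hw.isModerate.smoothBoundedOn hφc.isCompact).cutoff_mul hφ hφc
  obtain ⟨r₀, ⟨N₀, C₀, hC₀, hr₀⟩, hF₀⟩ :=
    hF.fourier_decay (R := R') (fun ε x hx => by simp [hR' x hx]) 0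
  -- N comes from the decay in Γ and N₀ from the global bound of the transform of φ w, used without
  -- weight. The last power pays for the slow scale kernel, which is O(ε⁻¹) for each m. None of the
  -- three depends on m.
  refine ⟨z, hz, ψ, hψ, hψc, hψ1 x₀ (Metric.mem_closedBall_self (by positivity)), Γ', hΓ', hξ₀',
    hcone', max N N₀ + 1, (decay_iff hcone' (fun ε x => ψ x * z ε x) _).2 fun m => ?_⟩
  obtain ⟨C, hC0, hC⟩ := (hN (m + (n + 1))).exists_nonneg (inv_pow_nonneg N)
  obtain ⟨r₁, hr₁, hG₁⟩ := hG.fourier_decay (R := R) (fun ε x hx => by simp [hR x hx])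
    (m + (n + 1))
  obtain ⟨C₁, hC₁⟩ := hr₁ 1 zero_le_one
  set I : ℝ := ∫ η : Rn n, (1 + ‖η‖) ^ (-((n : ℝ) + 1)) with hI
  have hI0 : 0 ≤ I := integral_nonneg fun η => by positivity
  refine ⟨(C + κ ^ (m + (n + 1)) * C₀) * C₁ * I, ?_⟩
  filter_upwards [hC, hr₀, hF₀, hC₁, hG₁, hc (Metric.ball_mem_nhds c₀ (by positivity : 0 < ρ / 3))]
    with ε hC hr₀ hF₀ hC₁ hG₁ hcε ξ hξ
  have hFc : HasCompactSupport fun x => φ x * w ε x := hφc.mul_right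
  -- The cut-off net is a slow scale kernel times the translate of φ w; this is the product to which
  -- the convolution estimate applies.
  have hprod : (fun x => ψ x * z ε x) =
      fun x => (ψ x * (g ε x * χ (x + c ε))) * (φ (x + c ε) * w ε (x + c ε)) := by
    ext x
    rw [hzw]
    by_cases hx : x ∈ Metric.ball x₀ (ρ / 3)
    · have hxc : x + c ε ∈ Metric.closedBall (x₀ + c₀) (2 * ρ / 3) := by
        rw [Metric.mem_closedBall]
        have h1 : dist (c ε) c₀ < ρ / 3 := hcε
        linarith [dist_add_add_le x (c ε) x₀ c₀, Metric.mem_ball.1 hx]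
      have hφx : φ (x + c ε) ≠ 0 := hρφ (Metric.closedBall_subset_closedBall (by linarith) hxc)
      simp only [hχ, hθ1 _ hxc]
      field_simp
    · simp [hψ0 x hx]
  have h1 : ContDiff ℝ ∞ fun x => φ (x + c ε) * w ε (x + c ε) :=
    (hF.1 ε).comp (contDiff_id.add contDiff_const)
  have h2 : HasCompactSupport fun x => φ (x + c ε) * w ε (x + c ε) :=
    hFc.comp_homeomorph (Homeomorph.addRight (c ε))
  have hr₁ε : r₁ ε ≤ C₁ * (ε : ℝ)⁻¹ := (le_abs_self _).trans (by simpa using hC₁)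
  have key := pow_mul_norm_fourier_mul_le h1 h2 (hG.1 ε) (hψc.mul_right) (Γ := Γ) (ξ := ξ) (m := m)
    (a := C * ((ε : ℝ)⁻¹) ^ N) (a₀ := C₀ * ((ε : ℝ)⁻¹) ^ N₀) (b := C₁ * (ε : ℝ)⁻¹) hκ
    (hsep ξ hξ) (fun η hη => ?_) (fun η => ?_) (fun η => (hG₁ η).trans hr₁ε)
    (mul_nonneg hC0 (inv_pow_nonneg N ε))
  · have hb : 0 ≤ C₁ * (ε : ℝ)⁻¹ := (by positivity : (0 : ℝ) ≤ _).trans ((hG₁ 0).trans hr₁ε)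
    have hb' : 0 ≤ C₁ := nonneg_of_mul_nonneg_left hb (inv_pos.2 ε.2.1)
    rw [hprod]
    refine key.trans ?_
    have e1 := inv_pow_mono (le_max_left N N₀) ε
    have e2 := inv_pow_mono (le_max_right N N₀) ε
    calc (C * ((ε : ℝ)⁻¹) ^ N + κ ^ (m + (n + 1)) * (C₀ * ((ε : ℝ)⁻¹) ^ N₀)) *
          (C₁ * (ε : ℝ)⁻¹) * I
        ≤ (C * ((ε : ℝ)⁻¹) ^ max N N₀ + κ ^ (m + (n + 1)) * (C₀ * ((ε : ℝ)⁻¹) ^ max N N₀)) *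
          (C₁ * (ε : ℝ)⁻¹) * I := by gcongr
      _ = _ := by ring
  · rw [norm_fourier_comp_add_right (fun x => φ x * w ε x) (c ε)]
    exact hC η hη
  · rw [norm_fourier_comp_add_right (fun x => φ x * w ε x) (c ε)]
    have := hF₀ η
    rw [pow_zero, one_mul] at this
    exact this.trans ((le_abs_self _).trans hr₀)

end MicroRegularity

section Slabs

variable {E : Type*} [NormedAddCommGroup E] [NormedSpace ℝ E]
variable {F : Type*} [NormedAddCommGroup F] [NormedSpace ℝ F]
variable {V : Type*} [NormedAddCommGroup V] [NormedSpace ℝ V]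
variable {G : Subalgebra ℝ (Eps → ℝ)}

/-! ## Shears and primitives -/

theorem boundedOn_iteratedFDeriv_clm (L : E →L[ℝ] V) (S : Set E) {k : ℕ} (hk : 1 ≤ k) :
    BoundedOn G S fun _ : Eps => iteratedFDeriv ℝ k L := by
  obtain ⟨j, rfl⟩ := Nat.exists_eq_add_of_le' hk
  refine ⟨fun _ => ‖L‖, const_mem_growth G _, Eventually.of_forall fun ε x _ => ?_⟩
  have h : fderiv ℝ L = fun _ => L := by
    ext1 x
    exact L.fderiv
  rw [← norm_iteratedFDeriv_fderiv, h]
  rcases Nat.eq_zero_or_pos j with rfl | hj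
  · simp
  · simp [iteratedFDeriv_const_of_ne hj.ne']

theorem smoothBoundedOn_clm (L : E →L[ℝ] V) {S : Set E} {C : ℝ} (hC : ∀ x ∈ S, ‖L x‖ ≤ C) :
    SmoothBoundedOn G S fun _ => L := by
  refine ⟨fun _ => L.contDiff, fun k => ?_⟩
  rcases Nat.eq_zero_or_pos k with rfl | hk
  · exact ⟨fun _ => C, const_mem_growth G C, Eventually.of_forall fun ε x hx => by
      simpa using hC x hx⟩
  · exact boundedOn_iteratedFDeriv_clm L S hk

theorem SmoothBoundedOn.sum {ι : Type*} (s : Finset ι) {S : Set E} {f : ι → Eps → E → V}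
    (hf : ∀ i ∈ s, SmoothBoundedOn G S (f i)) :
    SmoothBoundedOn G S fun ε x => ∑ i ∈ s, f i ε x := by
  classical
  induction s using Finset.induction_on with
  | empty =>
    simp only [Finset.sum_empty]
    exact smoothBoundedOn_clm (0 : E →L[ℝ] V) (C := 0) (by simp)
  | insert a s ha ih =>
    simp only [Finset.sum_insert ha]
    exact (hf a (Finset.mem_insert_self a s)).add
      (ih fun i hi => hf i (Finset.mem_insert_of_mem hi))

/-- Translation by a net of vectors whose derivatives are controlled. -/
theorem SmoothBoundedOn.comp_clm_add {S : Set E} {S' : Set F} {g : Eps → F → V}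
    (hg : SmoothBoundedOn G S' g) (L : E →L[ℝ] F) {h : Eps → E → F} (hh : SmoothBoundedOn G S h)
    (hS : ∀ᶠ ε in toZero, Set.MapsTo (fun x => L x + h ε x) S S') :
    SmoothBoundedOn G S fun ε x => g ε (L x + h ε x) := by
  refine hg.comp (fun ε => L.contDiff.add (hh.1 ε)) (fun k hk => ?_) hS
  obtain ⟨r, hr, h1⟩ := boundedOn_iteratedFDeriv_clm (G := G) L S hk
  obtain ⟨s, hs, h2⟩ := hh.2 k
  refine ⟨r + s, add_mem hr hs, ?_⟩
  filter_upwards [h1, h2] with ε h1 h2 x hx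
  have := iteratedFDeriv_add_apply (x := x) (L.contDiff (n := k)).contDiffAt
    ((hh.1 ε).of_le (natCast_le_infty k)).contDiffAt
  exact (congrArg norm this).le.trans ((norm_add_le _ _).trans (add_le_add (h1 x hx) (h2 x hx)))

theorem SmoothBoundedOn.comp_clm {S : Set E} {S' : Set F} {g : Eps → F → V}
    (hg : SmoothBoundedOn G S' g) (c : F) (L : E →L[ℝ] F)
    (hS : Set.MapsTo (fun x => c + L x) S S') : SmoothBoundedOn G S fun ε x => g ε (c + L x) := by
  have h := hg.comp_clm_add L (h := fun _ _ => c) (S := S)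
    ⟨fun _ => contDiff_const, fun k => ?_⟩ (Eventually.of_forall fun _ => by
      simpa [add_comm] using hS)
  · simpa [add_comm] using h
  · rcases Nat.eq_zero_or_pos k with rfl | hk
    · exact ⟨fun _ => ‖c‖, const_mem_growth G _, Eventually.of_forall fun _ x _ => by simp⟩
    · exact ⟨fun _ => 0, const_mem_growth G _, Eventually.of_forall fun _ x _ => by
        simp [iteratedFDeriv_const_of_ne hk.ne']⟩

/-- The slab `|t| ≤ T` in space-time. -/
def slab (F : Type*) (T : ℝ) : Set (ℝ × F) := {p | |p.1| ≤ T}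

/-- Rescaling to the fixed interval [0, 1] moves the variable endpoint into the integrand, where the
results on parameter integrals apply. -/
theorem integral_eq_mul_integral (f : ℝ → ℂ) (t : ℝ) :
    ∫ s in (0 : ℝ)..t, f s = (t : ℂ) * ∫ σ in (0 : ℝ)..1, f (σ * t) := by
  have h := intervalIntegral.smul_integral_comp_mul_right (a := 0) (b := 1) f t
  rw [zero_mul, one_mul, Complex.real_smul] at h
  exact h.symm

/-- For σ in [0, 1] the map (t, x) ↦ (σt, x) has norm at most 1 and preserves the slab, so
derivative bounds pass to the rescaled integrand without loss. -/
theorem SmoothBoundedOn.primitive {F : Type} [NormedAddCommGroup F] [NormedSpace ℝ F]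
    [FiniteDimensional ℝ F] {T : ℝ} {f : Eps → ℝ × F → ℂ} (hf : SmoothBoundedOn G (slab F T) f) :
    SmoothBoundedOn G (slab F T) fun ε p => ∫ s in (0 : ℝ)..p.1, f ε (s, p.2) := by
  simp only [fun ε (p : ℝ × F) => integral_eq_mul_integral (fun s => f ε (s, p.2)) p.1]
  refine SmoothBoundedOn.mul (f := fun _ (p : ℝ × F) => (p.1 : ℂ)) ?_ ?_
  · refine smoothBoundedOn_clm (Complex.ofRealCLM.comp (ContinuousLinearMap.fst ℝ ℝ F)) (C := T)
      fun p hp => ?_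
    have hp : |p.1| ≤ T := hp
    simpa using hp
  · refine SmoothBoundedOn.integral (H := fun ε σ (p : ℝ × F) => f ε (σ * p.1, p.2)) (fun ε => ?_)
      fun k => ?_
    · exact (hf.1 ε).comp ((contDiff_fst.mul (contDiff_fst.comp contDiff_snd)).prodMk
        (contDiff_snd.comp contDiff_snd))
    · obtain ⟨r, hr, h⟩ := hf.2 k
      refine ⟨r, hr, ?_⟩
      filter_upwards [h] with ε h σ hσ p hp
      let L : ℝ × F →L[ℝ] ℝ × F :=
        (σ • ContinuousLinearMap.fst ℝ ℝ F).prod (ContinuousLinearMap.snd ℝ ℝ F)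
      have hL : ‖L‖ ≤ 1 := by
        refine ContinuousLinearMap.opNorm_le_bound _ zero_le_one fun q => ?_
        rw [one_mul]
        refine max_le_max ?_ le_rfl
        change ‖σ • q.1‖ ≤ ‖q.1‖
        rw [norm_smul]
        exact mul_le_of_le_one_left (norm_nonneg _) (by
          rw [Real.norm_of_nonneg hσ.1]; exact hσ.2)
      have h1 := norm_iteratedFDeriv_affine_le (hf.1 ε) 0 L k p
      simp only [zero_add] at h1
      refine h1.trans ((mul_le_of_le_one_left (norm_nonneg _)
        (pow_le_one₀ (norm_nonneg _) hL)).trans (h _ ?_))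
      change |σ * p.1| ≤ T
      rw [abs_mul, abs_of_nonneg hσ.1]
      exact (mul_le_of_le_one_left (abs_nonneg _) hσ.2).trans hp

/-! ## Slow scale regular coefficients -/

theorem IsSlowScaleRegular.smoothBoundedOn {a : GenFun E} (ha : IsSlowScaleRegular a)
    {w : Eps → E → ℂ} (hw : Represents w a) {K : Set E} (hK : IsCompact K) :
    SmoothBoundedOn slowScale K w := by
  obtain ⟨w₀, hw₀, h⟩ := ha
  have h1 : SmoothBoundedOn slowScale K w₀ := by
    refine ⟨hw₀.isModerate.1, fun k => ?_⟩
    obtain ⟨μ, hμ, C, hC⟩ := h K hK k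
    have hμ' : (fun ε => |μ ε|) ∈ slowScale := fun q hq => by simpa using hμ q hq
    exact ⟨_, mul_mem (const_mem_growth slowScale C) hμ', hC⟩
  have h2 : SmoothBoundedOn slowScale K (w - w₀) :=
    ((hw.isNegligibleOn_sub hw₀).smoothBoundedOn (hw.sub hw₀).isModerate.1 hK
      (Set.subset_univ _)).mono_scale bot_le
  simpa using h1.add h2

/-- The additive c absorbs the change of representative, which log μ cannot do where μ = 1. -/
theorem IsSlowScaleLog.bound {a : GenFun E} (ha : IsSlowScaleLog a)
    {w : Eps → E → ℂ} (hw : Represents w a) {K : Set E} (hK : IsCompact K) :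
    ∃ (μ : Eps → ℝ) (c : ℝ), IsSlowScale μ ∧ (∀ ε, 1 ≤ μ ε) ∧ 0 ≤ c ∧
      ∀ᶠ ε in toZero, ∀ x ∈ K, ‖w ε x‖ ≤ c * Real.log (μ ε) + c := by
  obtain ⟨w₀, hw₀, h⟩ := ha
  obtain ⟨μ, hμ, hμ1, hC⟩ := h K hK
  obtain ⟨C, hC0, hC⟩ := hC.exists_nonneg fun ε => Real.log_nonneg (hμ1 ε)
  obtain ⟨D, hD⟩ := (hw.isNegligibleOn_sub hw₀) K hK (Set.subset_univ _) 0 0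
  refine ⟨μ, max C D, hμ, hμ1, le_max_of_le_left hC0, ?_⟩
  filter_upwards [hC, hD] with ε hC hD x hx
  have h1 := hD x hx
  simp only [norm_iteratedFDeriv_zero, pow_zero, mul_one, Pi.sub_apply] at h1
  have h2 : ‖w ε x‖ ≤ ‖w₀ ε x‖ + ‖w ε x - w₀ ε x‖ := by
    simpa using norm_add_le (w₀ ε x) (w ε x - w₀ ε x)
  exact h2.trans (add_le_add ((hC x hx).trans (mul_le_mul_of_nonneg_right (le_max_left _ _)
    (Real.log_nonneg (hμ1 ε)))) (h1.trans (le_max_right _ _)))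

theorem IsSlowScale.rpow {μ : Eps → ℝ} (hμ : IsSlowScale μ) (h1 : ∀ ε, 1 ≤ μ ε) {a : ℝ}
    (ha : 0 ≤ a) : IsSlowScale fun ε => μ ε ^ a := by
  intro q hq
  obtain ⟨C, hC⟩ := hμ (a * q) (mul_nonneg ha hq)
  refine ⟨C, ?_⟩
  filter_upwards [hC] with ε hC
  have h0 : 0 ≤ μ ε := zero_le_one.trans (h1 ε)
  rw [abs_of_nonneg (Real.rpow_nonneg h0 a), ← Real.rpow_mul h0]
  rwa [abs_of_nonneg h0] at hC

end Slabs

section Transport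

variable {n : ℕ}

/-! ## The flow of the transport equation -/

/-- Nets on space-time which vanish outside a bounded set in `x`, locally uniformly in `t`. -/
def VanishesAtInfinity (A : Eps → ℝ × Rn n → ℂ) : Prop :=
  ∀ T : ℝ, ∃ R : ℝ, ∀ ε t x, |t| ≤ T → R < ‖x‖ → A ε (t, x) = 0

theorem isCompact_box (n : ℕ) (T R : ℝ) :
    IsCompact (Set.Icc (-T) T ×ˢ Metric.closedBall (0 : Rn n) R) :=
  isCompact_Icc.prod (isCompact_closedBall 0 R)

theorem SmoothBoundedOn.slab_of_compact {G : Subalgebra ℝ (Eps → ℝ)} {A : Eps → ℝ × Rn n → ℂ}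
    (hA : ∀ K, IsCompact K → SmoothBoundedOn G K A) (h0 : VanishesAtInfinity A) (T : ℝ) :
    SmoothBoundedOn G (slab (Rn n) T) A := by
  -- The larger time bound provides an open set of zeros containing the part of the closed slab
  -- outside the ball, so the derivatives vanish there too.
  obtain ⟨R, hR⟩ := h0 (T + 1)
  refine (hA _ (isCompact_box n T R)).of_eq_zero (U := {p | |p.1| < T + 1 ∧ R < ‖p.2‖})
    ((isOpen_lt (f := fun p : ℝ × Rn n => |p.1|) (by fun_prop) continuous_const).and
      (isOpen_lt (g := fun p : ℝ × Rn n => ‖p.2‖) continuous_const (by fun_prop)))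
    (fun ε p hp => hR ε p.1 p.2 hp.1.le hp.2) fun p hp => ?_
  have hp : |p.1| ≤ T := hp
  by_cases h : ‖p.2‖ ≤ R
  · exact Or.inl ⟨abs_le.1 hp, by simpa using h⟩
  · exact Or.inr ⟨by linarith, not_le.1 h⟩

/-- `B_ε(t,y) = a_{0,ε}(t, y + Λ_ε(t))`. -/
def shiftedPotential (A₁ : Fin n → Eps → ℝ → ℝ) (A₀ : Eps → ℝ × Rn n → ℂ) (ε : Eps)
    (p : ℝ × Rn n) : ℂ :=
  A₀ ε (p.1, p.2 + lam A₁ ε p.1)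

/-- `C_ε(t,y) = ∫₀ᵗ a_{0,ε}(s, y + Λ_ε(s)) ds`. -/
def potentialIntegral (A₁ : Fin n → Eps → ℝ → ℝ) (A₀ : Eps → ℝ × Rn n → ℂ) (ε : Eps)
    (p : ℝ × Rn n) : ℂ :=
  ∫ s in (0 : ℝ)..p.1, shiftedPotential A₁ A₀ ε (s, p.2)

/-- The solution along the characteristics, written without oscillatory integrals. -/
def transportNet (A₁ : Fin n → Eps → ℝ → ℝ) (A₀ : Eps → ℝ × Rn n → ℂ) (U₀ : Eps → Rn n → ℂ)
    (ε : Eps) (p : ℝ × Rn n) : ℂ :=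
  Complex.exp (Complex.I * potentialIntegral A₁ A₀ ε (p.1, p.2 - lam A₁ ε p.1)) *
    U₀ ε (p.2 - lam A₁ ε p.1)

/-- Writes Λ_ε through primitives of ℂ-valued nets, to which `SmoothBoundedOn.primitive` applies. -/
theorem lam_eq_sum (A₁ : Fin n → Eps → ℝ → ℝ) (ε : Eps) (t : ℝ) :
    lam A₁ ε t = ∑ j, (-(∫ z in (0 : ℝ)..t, (A₁ j ε z : ℂ)).re) • EuclideanSpace.single j 1 := by
  ext i
  simp [lam, intervalIntegral.integral_ofReal, Finset.sum_apply, Pi.single_apply]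

theorem lam_zero (A₁ : Fin n → Eps → ℝ → ℝ) (ε : Eps) : lam A₁ ε 0 = 0 := by
  ext i
  simp [lam]

theorem smoothBoundedOn_lam {a₁ : Fin n → GenFun ℝ} (ha₁ : ∀ j, IsSlowScaleRegular (a₁ j))
    {A₁ : Fin n → Eps → ℝ → ℝ} (hA₁ : ∀ j, Represents (fun ε t => (A₁ j ε t : ℂ)) (a₁ j)) (T : ℝ) :
    SmoothBoundedOn slowScale (slab (Rn n) T) fun ε p => lam A₁ ε p.1 := by
  simp only [lam_eq_sum]
  refine SmoothBoundedOn.sum _ fun j _ => ?_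
  have h1 : SmoothBoundedOn slowScale (slab (Rn n) T) fun ε p => (A₁ j ε p.1 : ℂ) := by
    have h := ((ha₁ j).smoothBoundedOn (hA₁ j) (isCompact_Icc (a := -T) (b := T))).comp_clm
      (S := slab (Rn n) T) 0 (ContinuousLinearMap.fst ℝ ℝ (Rn n))
      (fun p hp => by simpa using abs_le.1 hp)
    simpa using h
  exact h1.primitive.clm_comp
    ((-Complex.reCLM).smulRight (EuclideanSpace.single j (1 : ℝ) : Rn n))

theorem lam_hasDerivAt {A₁ : Fin n → Eps → ℝ → ℝ} {ε : Eps} (hA : ∀ j, Continuous (A₁ j ε))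
    (t : ℝ) : HasDerivAt (lam A₁ ε) (WithLp.toLp 2 fun j => -A₁ j ε t) t := by
  have h : HasDerivAt (fun t j => -∫ z in (0 : ℝ)..t, A₁ j ε z) (fun j => -A₁ j ε t) t :=
    hasDerivAt_pi.2 fun j => ((hA j).integral_hasStrictDerivAt 0 t).hasDerivAt.neg
  exact (EuclideanSpace.equiv (Fin n) ℝ).symm.toContinuousLinearMap.hasFDerivAt.comp_hasDerivAt t h

end Transport

section Transport

variable {n : ℕ}

/-- The coefficients of the transport equation and their chosen representatives. -/
structure IsTransportData (a₁ : Fin n → GenFun ℝ) (a₀ : GenFun (ℝ × Rn n))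
    (A₁ : Fin n → Eps → ℝ → ℝ) (A₀ : Eps → ℝ × Rn n → ℂ) : Prop where
  regular₁ : ∀ j, IsSlowScaleRegular (a₁ j)
  represents₁ : ∀ j, Represents (fun ε t => (A₁ j ε t : ℂ)) (a₁ j)
  regular₀ : IsSlowScaleRegular a₀
  log₀ : IsSlowScaleLog a₀
  represents₀ : Represents A₀ a₀
  vanishes₀ : VanishesAtInfinity A₀

variable {a₁ : Fin n → GenFun ℝ} {a₀ : GenFun (ℝ × Rn n)} {u₀ : GenFun (Rn n)}
  {A₁ : Fin n → Eps → ℝ → ℝ} {A₀ A₀' : Eps → ℝ × Rn n → ℂ} {U₀ U₀' : Eps → Rn n → ℂ}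

theorem IsTransportData.continuous₁ (h : IsTransportData a₁ a₀ A₁ A₀) (j : Fin n) (ε : Eps) :
    Continuous (A₁ j ε) := by
  have := Complex.continuous_re.comp ((h.represents₁ j).isModerate.1 ε).continuous
  simpa [Function.comp_def] using this

theorem IsTransportData.lam_bounded (h : IsTransportData a₁ a₀ A₁ A₀) (T : ℝ) :
    SmoothBoundedOn slowScale (slab (Rn n) T) fun ε p => lam A₁ ε p.1 :=
  smoothBoundedOn_lam h.regular₁ h.represents₁ T

/-- The shift by Λ_ε is only slow scale and may leave every compact set. This is harmless because
the potential is bounded on the whole slab, thanks to its support in x. -/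
theorem IsTransportData.potential_bounded (h : IsTransportData a₁ a₀ A₁ A₀) (T : ℝ) :
    SmoothBoundedOn slowScale (slab (Rn n) T) (shiftedPotential A₁ A₀) := by
  have h1 := SmoothBoundedOn.slab_of_compact
    (fun K hK => h.regular₀.smoothBoundedOn h.represents₀ hK) h.vanishes₀ T
  have h2 := h1.comp_clm_add (S := slab (Rn n) T) (ContinuousLinearMap.id ℝ _)
    ((h.lam_bounded T).clm_comp (ContinuousLinearMap.inr ℝ ℝ (Rn n)))
    (Eventually.of_forall fun ε p hp => by simpa [slab] using hp)
  convert h2 using 3 with ε p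
  change _ = A₀ ε (p.1 + 0, p.2 + lam A₁ ε p.1)
  rw [add_zero, shiftedPotential]

theorem IsTransportData.continuous_potential (h : IsTransportData a₁ a₀ A₁ A₀) (ε : Eps) :
    Continuous (shiftedPotential A₁ A₀ ε) :=
  ((h.potential_bounded 0).1 ε).continuous

theorem IsTransportData.integral_bounded (h : IsTransportData a₁ a₀ A₁ A₀) (T : ℝ) :
    SmoothBoundedOn slowScale (slab (Rn n) T) (potentialIntegral A₁ A₀) :=
  (h.potential_bounded T).primitive

theorem norm_potentialIntegral_le {ε : Eps} {T D : ℝ} (hD : 0 ≤ D)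
    (hA : ∀ p ∈ slab (Rn n) T, ‖A₀ ε p‖ ≤ D) {p : ℝ × Rn n} (hp : p ∈ slab (Rn n) T) :
    ‖potentialIntegral A₁ A₀ ε p‖ ≤ D * T := by
  have hp : |p.1| ≤ T := hp
  refine (intervalIntegral.norm_integral_le_of_norm_le_const (C := D) fun s hs => ?_).trans ?_
  · refine hA _ (le_trans ?_ hp : |s| ≤ T)
    have := Set.uIoc_subset_uIcc hs
    simpa using Set.abs_sub_left_of_mem_uIcc this
  · rw [sub_zero]
    exact mul_le_mul_of_nonneg_left hp hD

/-- The logarithmic type enters here: |C_ε| ≤ T (d log μ + d) gives |exp(c C_ε)| ≤ e^(dT) μ^(dT), a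
power of a slow scale net. A general `c` covers both exp(i C_ε) and its inverse. -/
theorem IsTransportData.exp_integral_bounded (h : IsTransportData a₁ a₀ A₁ A₀) {c : ℂ}
    (hc : ‖c‖ ≤ 1) (T : ℝ) : SmoothBoundedOn slowScale (slab (Rn n) T)
      fun ε p => Complex.exp (c * potentialIntegral A₁ A₀ ε p) := by
  rcases lt_or_ge T 0 with hT | hT
  · refine ⟨fun ε => Complex.contDiff_exp.comp
      (contDiff_const.mul ((h.integral_bounded 0).1 ε)), fun k => ⟨_, const_mem_growth _ 0,
      Eventually.of_forall fun ε p hp => ?_⟩⟩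
    exact absurd ((abs_nonneg _).trans (hp : |p.1| ≤ T)) (not_le.2 hT)
  have h1 : SmoothBoundedOn slowScale (slab (Rn n) T)
      fun ε p => c * potentialIntegral A₁ A₀ ε p :=
    (h.integral_bounded T).clm_comp (ContinuousLinearMap.mul ℝ ℂ c)
  refine h1.cexp ?_
  obtain ⟨R, hR⟩ := h.vanishes₀ T
  obtain ⟨μ, d, hμ, hμ1, hd, hb⟩ := h.log₀.bound h.represents₀ (isCompact_box n T R)
  refine ⟨fun ε => Real.exp (d * T) * μ ε ^ (d * T), mul_mem (const_mem_growth slowScale _)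
    (hμ.rpow hμ1 (mul_nonneg hd hT)), ?_⟩
  filter_upwards [hb] with ε hb p hp
  have hlog := Real.log_nonneg (hμ1 ε)
  have hD : 0 ≤ d * Real.log (μ ε) + d := by positivity
  have h2 := norm_potentialIntegral_le (A₁ := A₁) (A₀ := A₀) (ε := ε) hD (fun q hq => ?_) hp
  · rw [Complex.norm_exp, Real.rpow_def_of_pos (zero_lt_one.trans_le (hμ1 ε)), ← Real.exp_add]
    refine Real.exp_le_exp.2 ((Complex.re_le_norm _).trans ?_)
    rw [norm_mul]
    refine (mul_le_of_le_one_left (norm_nonneg _) hc).trans (h2.trans (le_of_eq ?_))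
    ring
  · have hq : |q.1| ≤ T := hq
    by_cases hx : ‖q.2‖ ≤ R
    · exact hb q ⟨abs_le.1 hq, by simpa using hx⟩
    · rw [show A₀ ε q = 0 from hR ε q.1 q.2 hq (not_le.1 hx), norm_zero]
      exact hD

theorem SmoothBoundedOn.comp_unshift {G : Subalgebra ℝ (Eps → ℝ)} (hG : slowScale ≤ G)
    (h : IsTransportData a₁ a₀ A₁ A₀) {T : ℝ} {f : Eps → ℝ × Rn n → ℂ}
    (hf : SmoothBoundedOn G (slab (Rn n) T) f) :
    SmoothBoundedOn G (slab (Rn n) T) fun ε p => f ε (p.1, p.2 - lam A₁ ε p.1) := by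
  have h2 := hf.comp_clm_add (S := slab (Rn n) T) (ContinuousLinearMap.id ℝ _)
    (((h.lam_bounded T).mono_scale hG).clm_comp (-ContinuousLinearMap.inr ℝ ℝ (Rn n)))
    (Eventually.of_forall fun ε p hp => by simpa [slab] using hp)
  convert h2 using 3 with ε p
  change _ = f ε (p.1 + -0, p.2 + -lam A₁ ε p.1)
  rw [neg_zero, add_zero, sub_eq_add_neg]

theorem smoothBoundedOn_initial (hU₀ : Represents U₀ u₀) {R : ℝ}
    (hR : ∀ ε x, R < ‖x‖ → U₀ ε x = 0) : SmoothBoundedOn moderateScale Set.univ U₀ :=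
  (hU₀.isModerate.smoothBoundedOn (isCompact_closedBall 0 R)).of_eq_zero
    (U := {x | R < ‖x‖}) (isOpen_lt continuous_const continuous_norm) (fun ε x hx => hR ε x hx)
    fun x _ => by simpa using le_or_gt ‖x‖ R

theorem IsTransportData.isModerate_transportNet (h : IsTransportData a₁ a₀ A₁ A₀)
    (hU₀ : Represents U₀ u₀) {R : ℝ} (hR : ∀ ε x, R < ‖x‖ → U₀ ε x = 0) :
    IsModerate (transportNet A₁ A₀ U₀) := by
  have key : ∀ T, SmoothBoundedOn moderateScale (slab (Rn n) T) (transportNet A₁ A₀ U₀) := by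
    intro T
    have h1 := ((h.exp_integral_bounded (c := Complex.I) (by simp) T).mono_scale
      slowScale_le_moderateScale).comp_unshift slowScale_le_moderateScale h
    have h2 := ((smoothBoundedOn_initial hU₀ hR).comp_clm (S := slab (Rn n) T) 0
      (ContinuousLinearMap.snd ℝ ℝ (Rn n)) (Set.mapsTo_univ _ _)).comp_unshift
      slowScale_le_moderateScale h
    simp only [zero_add, ContinuousLinearMap.coe_snd'] at h2
    exact h1.mul h2
  refine isModerate_of_smoothBoundedOn (key 0).1 fun K hK => ?_
  obtain ⟨T, hT⟩ := hK.isBounded.exists_norm_le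
  exact (key T).mono fun p hp => (norm_fst_le p).trans (hT p hp)

/-! ## The equation along the characteristics -/

/-- The curve has velocity (1, -a₁), so the principal part of the equation is differentiation along
it. -/
theorem hasDerivAt_along_characteristic {ε : Eps} (hA : ∀ j, Continuous (A₁ j ε))
    {w : ℝ × Rn n → ℂ} (hw : Differentiable ℝ w) (y : Rn n) (t : ℝ) :
    HasDerivAt (fun s => w (s, y + lam A₁ ε s))
      (fderiv ℝ w (t, y + lam A₁ ε t) (1, 0) - ∑ j, (A₁ j ε t : ℂ) *
        fderiv ℝ w (t, y + lam A₁ ε t) (0, EuclideanSpace.single j 1)) t := by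
  have h1 := (hasDerivAt_id t).prodMk ((lam_hasDerivAt hA t).const_add y)
  have h2 := (hw (t, y + lam A₁ ε t)).hasFDerivAt.comp_hasDerivAt t h1
  have h3 : ((1 : ℝ), (WithLp.toLp 2 fun j => -A₁ j ε t : Rn n)) =
      (1, 0) - ∑ j, A₁ j ε t • ((0 : ℝ), (EuclideanSpace.single j (1 : ℝ) : Rn n)) := by
    ext i
    · simp [Prod.fst_sum]
    · simp [Prod.snd_sum, Pi.single_apply]
  refine h2.congr_deriv ?_
  rw [h3, map_sub, map_sum]
  simp only [map_smul, Complex.real_smul]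

theorem IsTransportData.hasDerivAt_potentialIntegral (h : IsTransportData a₁ a₀ A₁ A₀) (ε : Eps)
    (y : Rn n) (t : ℝ) : HasDerivAt (fun s => potentialIntegral A₁ A₀ ε (s, y))
      (A₀ ε (t, y + lam A₁ ε t)) t := by
  have hc : Continuous fun s => shiftedPotential A₁ A₀ ε (s, y) :=
    (h.continuous_potential ε).comp (by fun_prop)
  exact (hc.integral_hasStrictDerivAt 0 t).hasDerivAt

theorem transportNet_along (ε : Eps) (y : Rn n) (t : ℝ) :
    transportNet A₁ A₀ U₀ ε (t, y + lam A₁ ε t) =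
      Complex.exp (Complex.I * potentialIntegral A₁ A₀ ε (t, y)) * U₀ ε y := by
  simp [transportNet]

theorem IsTransportData.transportNet_equation (h : IsTransportData a₁ a₀ A₁ A₀)
    (hU₀ : Represents U₀ u₀) {R : ℝ} (hR : ∀ ε x, R < ‖x‖ → U₀ ε x = 0) (ε : Eps)
    (p : ℝ × Rn n) :
    fderiv ℝ (transportNet A₁ A₀ U₀ ε) p (1, 0) =
      ∑ j, (A₁ j ε p.1 : ℂ) *
        fderiv ℝ (transportNet A₁ A₀ U₀ ε) p (0, EuclideanSpace.single j 1) +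
      Complex.I * A₀ ε p * transportNet A₁ A₀ U₀ ε p := by
  obtain ⟨t, x⟩ := p
  obtain ⟨y, rfl⟩ : ∃ y, x = y + lam A₁ ε t := ⟨x - lam A₁ ε t, by simp⟩
  have h1 := hasDerivAt_along_characteristic (h.continuous₁ · ε)
    (((h.isModerate_transportNet hU₀ hR).1 ε).differentiable (by simp)) y t
  have h2 := (((h.hasDerivAt_potentialIntegral ε y t).const_mul Complex.I).cexp.mul_const
    (U₀ ε y))
  simp only [transportNet_along] at h1
  have h3 := h1.unique h2
  rw [transportNet_along]
  linear_combination h3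

theorem represents_ofTime {a : GenFun ℝ} {A : Eps → ℝ → ℝ}
    (hA : Represents (fun ε t => (A ε t : ℂ)) a) :
    Represents (fun ε (p : ℝ × Rn n) => (A ε p.1 : ℂ)) (ofTime a) := by
  simpa [ofTime] using hA.affine 0 (ContinuousLinearMap.fst ℝ ℝ (Rn n))

theorem Represents.slice {u : GenFun (ℝ × Rn n)} {w : Eps → ℝ × Rn n → ℂ} (hw : Represents w u)
    (t : ℝ) : Represents (fun ε x => w ε (t, x)) (slice t u) := by
  simpa [Colombeau.slice] using hw.affine (t, 0) (ContinuousLinearMap.inr ℝ ℝ (Rn n))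

/-- The net which has to be negligible for `w` to represent a solution. -/
def residual (A₁ : Fin n → Eps → ℝ → ℝ) (A₀ w : Eps → ℝ × Rn n → ℂ) (ε : Eps) (p : ℝ × Rn n) : ℂ :=
  fderiv ℝ (w ε) p (1, 0) - (∑ j, (A₁ j ε p.1 : ℂ) *
    fderiv ℝ (w ε) p (0, EuclideanSpace.single j 1) + Complex.I * A₀ ε p * w ε p)

/-- The factor i turns D = -i∂ back into ∂. -/
theorem IsTransportData.represents_residual (h : IsTransportData a₁ a₀ A₁ A₀)
    {u : GenFun (ℝ × Rn n)} {w : Eps → ℝ × Rn n → ℂ} (hw : Represents w u) :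
    Represents (residual A₁ A₀ w)
      (Complex.I • (Dt u - (∑ j, ofTime (a₁ j) * Dx j u + a₀ * u))) := by
  have h1 := (((hw.dir ((1 : ℝ), (0 : Rn n))).smul (-Complex.I)).sub
    ((Represents.sum Finset.univ fun j _ => (represents_ofTime (n := n) (h.represents₁ j)).mul
      ((hw.dir ((0 : ℝ), EuclideanSpace.single j (1 : ℝ))).smul (-Complex.I))).add
      (h.represents₀.mul hw))).smul Complex.I
  convert h1 using 1
  swap
  · rfl
  ext ε p
  simp only [residual, Pi.smul_apply, Pi.sub_apply, Pi.add_apply, Pi.mul_apply, Finset.sum_apply,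
    smul_eq_mul, mul_sub, mul_add, Finset.mul_sum]
  congr 1
  · linear_combination (fderiv ℝ (w ε) p (1, 0)) * Complex.I_mul_I
  · congr 1
    · refine Finset.sum_congr rfl fun j _ => ?_
      linear_combination (A₁ j ε p.1 : ℂ) *
        (fderiv ℝ (w ε) p (0, EuclideanSpace.single j 1)) * Complex.I_mul_I
    · ring

theorem IsTransportData.equation_iff (h : IsTransportData a₁ a₀ A₁ A₀) {u : GenFun (ℝ × Rn n)}
    {w : Eps → ℝ × Rn n → ℂ} (hw : Represents w u) :
    Dt u = ∑ j, ofTime (a₁ j) * Dx j u + a₀ * u ↔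
      Represents (residual A₁ A₀ w) (0 : GenFun (ℝ × Rn n)) := by
  have h1 := h.represents_residual hw
  constructor
  · intro h2
    rwa [h2, sub_self, smul_zero] at h1
  · intro h2
    have h3 := h1.unique h2
    have h4 := congrArg (fun z => (-Complex.I) • z) h3
    simp only [smul_smul, neg_mul, Complex.I_mul_I, neg_neg, one_smul, smul_zero] at h4
    exact sub_eq_zero.1 h4

theorem IsTransportData.solvesTransport (h : IsTransportData a₁ a₀ A₁ A₀)
    (hU₀ : Represents U₀ u₀) {R : ℝ} (hR : ∀ ε x, R < ‖x‖ → U₀ ε x = 0)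
    {u : GenFun (ℝ × Rn n)} (hu : Represents (transportNet A₁ A₀ U₀) u) :
    SolvesTransport a₁ a₀ u₀ u := by
  refine ⟨(h.equation_iff hu).2 ?_, ?_⟩
  · have h0 : residual A₁ A₀ (transportNet A₁ A₀ U₀) = 0 := by
      ext ε p
      simp only [residual, h.transportNet_equation hU₀ hR ε p]
      exact sub_self _
    rw [h0]
    exact represents_zero
  · have h1 := hu.slice 0
    simp only [transportNet, potentialIntegral, lam_zero, intervalIntegral.integral_same, mul_zero,
      Complex.exp_zero, one_mul, sub_zero] at h1
    exact h1.unique hU₀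

end Transport

section Negligible

/-! ## Negligible values -/

/-- The values of the net `f` are `O(ε^q)` on `S` for every `q`. -/
def ZeroNegligibleOn {X : Type*} (S : Set X) (f : Eps → X → ℂ) : Prop :=
  ∀ q : ℕ, SupO S (fun ε x => ‖f ε x‖) fun ε => (ε : ℝ) ^ q

variable {X Y : Type*} {S : Set X} {f g : Eps → X → ℂ}

theorem ZeroNegligibleOn.subset {S' : Set X} (hS : S ⊆ S') (hf : ZeroNegligibleOn S' f) :
    ZeroNegligibleOn S f := fun q => (hf q).subset hS

theorem ZeroNegligibleOn.add (hf : ZeroNegligibleOn S f) (hg : ZeroNegligibleOn S g) :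
    ZeroNegligibleOn S fun ε x => f ε x + g ε x := fun q =>
  ((hf q).add (hg q)).mono (pow_nonneg' q) (fun _ _ _ => norm_add_le _ _) fun _ => le_rfl

theorem ZeroNegligibleOn.of_norm_le (hg : ZeroNegligibleOn S g) {c : ℝ} (hc : 0 ≤ c)
    (h : ∀ᶠ ε in toZero, ∀ x ∈ S, ‖f ε x‖ ≤ c * ‖g ε x‖) : ZeroNegligibleOn S f := by
  intro q
  obtain ⟨C, hC⟩ := hg q
  refine ⟨c * C, ?_⟩
  filter_upwards [h, hC] with ε h hC x hx
  rw [mul_assoc]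
  exact (h x hx).trans (mul_le_mul_of_nonneg_left (hC x hx) hc)

theorem ZeroNegligibleOn.comp (hf : ZeroNegligibleOn S f) {S' : Set Y} {φ : Eps → Y → X}
    (hφ : ∀ᶠ ε in toZero, Set.MapsTo (φ ε) S' S) : ZeroNegligibleOn S' fun ε y => f ε (φ ε y) := by
  intro q
  obtain ⟨C, hC⟩ := hf q
  refine ⟨C, ?_⟩
  filter_upwards [hφ, hC] with ε hφ hC y hy using hC _ (hφ hy)

theorem ZeroNegligibleOn.mul (hf : BoundedOn moderateScale S f) (hg : ZeroNegligibleOn S g) :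
    ZeroNegligibleOn S fun ε x => f ε x * g ε x := by
  intro q
  obtain ⟨r, ⟨N, C, hC, hr⟩, h⟩ := hf
  obtain ⟨D, hD⟩ := hg (N + q)
  refine ⟨C * D, ?_⟩
  filter_upwards [hr, h, hD] with ε hr h hD x hx
  have hε := ε.2.1.ne'
  rw [norm_mul]
  calc ‖f ε x‖ * ‖g ε x‖ ≤ (C * ((ε : ℝ)⁻¹) ^ N) * (D * (ε : ℝ) ^ (N + q)) :=
        mul_le_mul ((h x hx).trans ((le_abs_self _).trans hr)) (hD x hx) (norm_nonneg _)
          (mul_nonneg hC (inv_pow_nonneg N ε))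
    _ = C * D * (ε : ℝ) ^ q := by
        rw [pow_add, inv_pow]
        field_simp

/-- Negligible values eventually have modulus at most 1, where |e^z - 1| ≤ 2|z|. -/
theorem ZeroNegligibleOn.exp_sub_one (hf : ZeroNegligibleOn S f) :
    ZeroNegligibleOn S fun ε x => Complex.exp (f ε x) - 1 := by
  refine hf.of_norm_le zero_le_two ?_
  obtain ⟨C, hC⟩ := hf 1
  have h1 : ∀ᶠ ε : Eps in toZero, C * (ε : ℝ) ≤ 1 := by
    refine eventually_toZero (P := fun x => C * x ≤ 1) ?_
    have : Tendsto (fun x : ℝ => C * x) (𝓝 0) (𝓝 (C * 0)) :=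
      (continuous_const.mul continuous_id).tendsto 0
    rw [mul_zero] at this
    exact (this.eventually_lt_const one_pos).mono fun x hx => hx.le
  filter_upwards [h1, hC] with ε h1 hC x hx
  have h2 := hC x hx
  rw [pow_one] at h2
  exact Complex.norm_exp_sub_one_le (h2.trans h1)

theorem IsNegligibleOn.zeroNegligibleOn {E : Type*} [NormedAddCommGroup E] [NormedSpace ℝ E]
    {U K : Set E} {u : Eps → E → ℂ} (hu : IsNegligibleOn U u) (hK : IsCompact K) (hKU : K ⊆ U) :
    ZeroNegligibleOn K u := fun q => by
  simpa using hu K hK hKU 0 q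

theorem ZeroNegligibleOn.of_eq_zero {S' : Set X} (hf : ZeroNegligibleOn S f)
    (h : ∀ ε, ∀ x ∈ S', x ∉ S → f ε x = 0) : ZeroNegligibleOn S' f := by
  intro q
  obtain ⟨C, hC0, hC⟩ := (hf q).exists_nonneg (pow_nonneg' q)
  refine ⟨C, ?_⟩
  filter_upwards [hC] with ε hC x hx
  by_cases hxS : x ∈ S
  · exact hC x hxS
  · simp only [h ε x hx hxS, norm_zero]
    exact mul_nonneg hC0 (pow_nonneg' q ε)

end Negligible

/-! ### Independence of representatives, and uniqueness -/

section Transport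

variable {n : ℕ} {a₁ : Fin n → GenFun ℝ} {a₀ : GenFun (ℝ × Rn n)} {u₀ : GenFun (Rn n)}
  {A₁ : Fin n → Eps → ℝ → ℝ} {A₀ A₀' : Eps → ℝ × Rn n → ℂ} {U₀ U₀' : Eps → Rn n → ℂ}

theorem slab_maps_unshift (A₁ : Fin n → Eps → ℝ → ℝ) (ε : Eps) (T : ℝ) :
    Set.MapsTo (fun p : ℝ × Rn n => (p.1, p.2 - lam A₁ ε p.1)) (slab (Rn n) T) (slab (Rn n) T) :=
  fun _ hp => hp

theorem exists_subset_slab {K : Set (ℝ × Rn n)} (hK : IsCompact K) :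
    ∃ T : ℝ, 0 ≤ T ∧ K ⊆ slab (Rn n) T := by
  obtain ⟨T, hT⟩ := hK.isBounded.exists_norm_le
  exact ⟨max T 0, le_max_right _ _, fun p hp =>
    ((norm_fst_le p).trans (hT p hp)).trans (le_max_left _ _)⟩

/-- Independence of the solution net of the representatives. -/
theorem IsTransportData.transportNet_sub_negligible (h : IsTransportData a₁ a₀ A₁ A₀)
    (h' : IsTransportData a₁ a₀ A₁ A₀') (hU₀ : Represents U₀ u₀) (hU₀' : Represents U₀' u₀)
    {R R' : ℝ} (hR : ∀ ε x, R < ‖x‖ → U₀ ε x = 0) (hR' : ∀ ε x, R' < ‖x‖ → U₀' ε x = 0) :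
    IsNegligibleOn Set.univ (transportNet A₁ A₀' U₀' - transportNet A₁ A₀ U₀) := by
  have hm := h.isModerate_transportNet hU₀ hR
  have hm' := h'.isModerate_transportNet hU₀' hR'
  refine IsModerate.isNegligibleOn_univ ((moderateNets _).sub_mem hm' hm) fun K hK => ?_
  obtain ⟨T, hT, hKT⟩ := exists_subset_slab hK
  change ZeroNegligibleOn K _
  -- Bounded supports upgrade negligibility from compact sets to the whole space, and likewise to
  -- the slab for the potentials. The unbounded shift by Λ_ε requires this.
  have hU : ZeroNegligibleOn Set.univ (U₀' - U₀) := by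
    refine ((hU₀'.isNegligibleOn_sub hU₀).zeroNegligibleOn
      (isCompact_closedBall 0 (max R R')) (Set.subset_univ _)).of_eq_zero fun ε x _ hx => ?_
    have hx : max R R' < ‖x‖ := by simpa using hx
    simp [hR ε x ((le_max_left _ _).trans_lt hx), hR' ε x ((le_max_right _ _).trans_lt hx)]
  have hA : ZeroNegligibleOn (slab (Rn n) T) (A₀' - A₀) := by
    obtain ⟨ρ, hρ⟩ := h.vanishes₀ T
    obtain ⟨ρ', hρ'⟩ := h'.vanishes₀ T
    refine ((h'.represents₀.isNegligibleOn_sub h.represents₀).zeroNegligibleOn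
      (isCompact_box n T (max ρ ρ')) (Set.subset_univ _)).of_eq_zero fun ε p hp hpK => ?_
    have hx : max ρ ρ' < ‖p.2‖ := by
      by_contra hx
      exact hpK ⟨abs_le.1 hp, by simpa using not_lt.1 hx⟩
    have e := hρ ε p.1 p.2 hp ((le_max_left _ _).trans_lt hx)
    have e' := hρ' ε p.1 p.2 hp ((le_max_right _ _).trans_lt hx)
    simp only [Pi.sub_apply]
    exact (congrArg₂ (· - ·) e' e).trans (sub_zero 0)
  have hC : ZeroNegligibleOn (slab (Rn n) T) fun ε p => Complex.I *
      (potentialIntegral A₁ A₀' ε p - potentialIntegral A₁ A₀ ε p) := by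
    intro q
    obtain ⟨D, hD0, hD⟩ := (hA q).exists_nonneg (pow_nonneg' q)
    refine ⟨D * T, ?_⟩
    filter_upwards [hD] with ε hD p hp
    have h1 : potentialIntegral A₁ A₀' ε p - potentialIntegral A₁ A₀ ε p =
        potentialIntegral A₁ (A₀' - A₀) ε p := by
      have hc : ∀ {A}, IsTransportData a₁ a₀ A₁ A → IntervalIntegrable
          (fun s => shiftedPotential A₁ A ε (s, p.2)) MeasureTheory.volume 0 p.1 := fun hA =>
        ((hA.continuous_potential ε).comp (by fun_prop :
          Continuous fun s : ℝ => (s, p.2))).intervalIntegrable _ _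
      exact (intervalIntegral.integral_sub (hc h') (hc h)).symm
    simp only [h1, norm_mul, Complex.norm_I, one_mul]
    refine (norm_potentialIntegral_le (mul_nonneg hD0 (pow_nonneg' q ε)) hD hp).trans_eq ?_
    ring
  have hE := (h.exp_integral_bounded (c := Complex.I) (by simp) T).zeroth.mono_scale
    slowScale_le_moderateScale
  have key := (ZeroNegligibleOn.mul hE (hC.exp_sub_one)).comp
    (Eventually.of_forall fun ε => slab_maps_unshift A₁ ε T)
  have hB := (((smoothBoundedOn_initial hU₀' hR').comp_clm (S := slab (Rn n) T) 0
      (ContinuousLinearMap.snd ℝ ℝ (Rn n)) (Set.mapsTo_univ _ _)).comp_unshift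
      slowScale_le_moderateScale h).zeroth
  have hE' := ((h.exp_integral_bounded (c := Complex.I) (by simp) T).comp_unshift le_rfl
    h).zeroth.mono_scale slowScale_le_moderateScale
  have hU' := hU.comp (S' := slab (Rn n) T) (φ := fun ε p => p.2 - lam A₁ ε p.1)
    (Eventually.of_forall fun ε => Set.mapsTo_univ _ _)
  -- The splitting is e^{iC'} U' - e^{iC} U = U' e^{iC} (e^{i(C' - C)} - 1) + e^{iC} (U' - U),
  -- evaluated at the shifted point.
  have hfin := (ZeroNegligibleOn.mul hB key).add (ZeroNegligibleOn.mul hE' hU')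
  refine (hfin.subset hKT).of_norm_le zero_le_one (Eventually.of_forall fun ε p _ => ?_)
  rw [one_mul]
  refine (congrArg norm ?_).le
  simp only [Pi.sub_apply, transportNet, zero_add, ContinuousLinearMap.coe_snd', mul_sub,
    Complex.exp_sub]
  have := Complex.exp_ne_zero (Complex.I * potentialIntegral A₁ A₀ ε (p.1, p.2 - lam A₁ ε p.1))
  field_simp
  ring

/-- Uniqueness when the characteristics stay in compact sets. -/
theorem IsTransportData.eq_zero_of_solves (h : IsTransportData a₁ a₀ A₁ A₀)
    (hΛ : ∀ T : ℝ, ∃ C : ℝ, ∀ᶠ ε in toZero, ∀ t, |t| ≤ T → ‖lam A₁ ε t‖ ≤ C)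
    {v : GenFun (ℝ × Rn n)} (hv : SolvesTransport a₁ a₀ 0 v) : v = 0 := by
  obtain ⟨w, hw⟩ := Represents.exists v
  have hres := (h.equation_iff hw).1 hv.1
  have hini := hw.slice 0
  rw [hv.2] at hini
  refine represents_zero.eq_of_sub hw ?_ |>.symm
  rw [sub_zero]
  refine hw.isModerate.isNegligibleOn_univ fun K hK => ?_
  obtain ⟨T, hT, hKT⟩ := exists_subset_slab hK
  obtain ⟨ρ, hρ⟩ := hK.isBounded.exists_norm_le
  obtain ⟨C, hC⟩ := hΛ T
  -- A point with |x| ≤ ρ has foot y = x - Λ_ε(t) with |y| ≤ ρ + C, and its characteristic y +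
  -- Λ_ε(s) stays in the ball of radius ρ + 2C.
  have hN : ZeroNegligibleOn (Set.Icc (-T) T ×ˢ Metric.closedBall (0 : Rn n) (ρ + 2 * C))
      (residual A₁ A₀ w) := by
    simpa using (hres.isNegligibleOn_sub represents_zero).zeroNegligibleOn (isCompact_box n T _)
      (Set.subset_univ _)
  have hI : ZeroNegligibleOn (Metric.closedBall (0 : Rn n) (ρ + C)) fun ε x => w ε (0, x) := by
    simpa using (hini.isNegligibleOn_sub represents_zero).zeroNegligibleOn
      (isCompact_closedBall 0 _) (Set.subset_univ _)
  obtain ⟨r, ⟨N, D, hD, hr⟩, hE⟩ := ((h.exp_integral_bounded (c := Complex.I) (by simp)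
    T).zeroth.mono_scale slowScale_le_moderateScale)
  obtain ⟨r', ⟨N', D', hD', hr'⟩, hE'⟩ := ((h.exp_integral_bounded (c := -Complex.I) (by simp)
    T).zeroth.mono_scale slowScale_le_moderateScale)
  intro q
  -- The order N' is spent on exp(-i C_ε) in the integrand, and N on exp(i C_ε) when the integrating
  -- factor is removed at the end.
  obtain ⟨B, hB0, hB⟩ := (hN (N' + (N + q))).exists_nonneg (pow_nonneg' _)
  obtain ⟨B', hB0', hB'⟩ := (hI (N + q)).exists_nonneg (pow_nonneg' _)
  refine ⟨D * (B' + D' * B * T), ?_⟩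
  filter_upwards [hC, hr, hE, hr', hE', hB, hB'] with ε hC hr hE hr' hE' hB hB' p hp
  obtain ⟨t, x⟩ := p
  have ht : |t| ≤ T := hKT hp
  have hx : ‖x‖ ≤ ρ := (norm_snd_le (t, x)).trans (hρ _ hp)
  obtain ⟨y, rfl⟩ : ∃ y, x = y + lam A₁ ε t := ⟨x - lam A₁ ε t, by simp⟩
  have hy : ‖y‖ ≤ ρ + C := by
    have := norm_sub_le (y + lam A₁ ε t) (lam A₁ ε t)
    rw [add_sub_cancel_right] at this
    linarith [hC t ht]
  have hε := ε.2.1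
  -- The integrating factor removes the zeroth order term: the derivative along the characteristic
  -- is the residual times exp(-i C_ε).
  have hder : ∀ s, HasDerivAt
      (fun s => Complex.exp (-Complex.I * potentialIntegral A₁ A₀ ε (s, y)) *
        w ε (s, y + lam A₁ ε s))
      (Complex.exp (-Complex.I * potentialIntegral A₁ A₀ ε (s, y)) *
        residual A₁ A₀ w ε (s, y + lam A₁ ε s)) s := by
    intro s
    have h1 := hasDerivAt_along_characteristic (h.continuous₁ · ε)
      ((hw.isModerate.1 ε).differentiable (by simp)) y s
    have h2 := ((h.hasDerivAt_potentialIntegral ε y s).const_mul (-Complex.I)).cexp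
    refine (h2.mul h1).congr_deriv ?_
    simp only [residual]
    ring
  have hbound : ∀ s ∈ Set.Icc (-T) T,
      ‖Complex.exp (-Complex.I * potentialIntegral A₁ A₀ ε (s, y)) *
        residual A₁ A₀ w ε (s, y + lam A₁ ε s)‖ ≤ D' * B * (ε : ℝ) ^ (N + q) := by
    intro s hs
    have hs' : |s| ≤ T := abs_le.2 hs
    have h1 := hB (s, y + lam A₁ ε s) ⟨hs, by
      rw [mem_closedBall_zero_iff]
      linarith [norm_add_le y (lam A₁ ε s), hC s hs']⟩
    have h2 := (hE' (s, y) hs').trans ((le_abs_self _).trans hr')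
    rw [norm_mul]
    refine (mul_le_mul h2 h1 (norm_nonneg _) (mul_nonneg hD' (inv_pow_nonneg N' ε))).trans_eq ?_
    rw [pow_add, inv_pow]
    have := hε.ne'
    field_simp
  have hmv := (convex_Icc (-T) T).norm_image_sub_le_of_norm_hasDerivWithin_le
    (fun s _ => (hder s).hasDerivWithinAt) hbound (x := 0) (y := t) ⟨by linarith, hT⟩
    (abs_le.1 ht)
  have h0 : potentialIntegral A₁ A₀ ε (0, y) = 0 := by simp [potentialIntegral]
  simp only [h0, lam_zero, add_zero, mul_zero, Complex.exp_zero, one_mul, sub_zero,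
    Real.norm_eq_abs] at hmv
  have h1 : ‖Complex.exp (-Complex.I * potentialIntegral A₁ A₀ ε (t, y)) *
      w ε (t, y + lam A₁ ε t)‖ ≤ (B' + D' * B * T) * (ε : ℝ) ^ (N + q) := by
    have h2 := hB' y (by simpa using hy)
    have h3 := norm_le_norm_add_norm_sub' (Complex.exp (-Complex.I *
      potentialIntegral A₁ A₀ ε (t, y)) * w ε (t, y + lam A₁ ε t)) (w ε (0, y))
    have h4 : D' * B * (ε : ℝ) ^ (N + q) * |t| ≤ D' * B * (ε : ℝ) ^ (N + q) * T := by gcongr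
    linarith
  have h2 := (hE (t, y) ht).trans ((le_abs_self _).trans hr)
  have h3 : w ε (t, y + lam A₁ ε t) = Complex.exp (Complex.I * potentialIntegral A₁ A₀ ε (t, y)) *
      (Complex.exp (-Complex.I * potentialIntegral A₁ A₀ ε (t, y)) *
        w ε (t, y + lam A₁ ε t)) := by
    rw [← mul_assoc, ← Complex.exp_add, neg_mul, add_neg_cancel, Complex.exp_zero, one_mul]
  rw [h3, norm_mul]
  refine (mul_le_mul h2 h1 (norm_nonneg _) (mul_nonneg hD (inv_pow_nonneg N ε))).trans_eq ?_
  rw [pow_add, inv_pow]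
  have := hε.ne'
  field_simp

theorem SolvesTransport.sub {u v : GenFun (ℝ × Rn n)} (hu : SolvesTransport a₁ a₀ u₀ u)
    (hv : SolvesTransport a₁ a₀ u₀ v) : SolvesTransport a₁ a₀ 0 (v - u) := by
  have hs : slice 0 (v - u) = slice 0 v - slice 0 u := map_sub _ _ _
  have hx : ∀ j, Dx j (v - u) = Dx j v - Dx j u := fun j => by simp [Dx, smul_sub]
  have ht : Dt (v - u) = Dt v - Dt u := by simp [Dt, smul_sub]
  refine ⟨?_, by rw [hs, hu.2, hv.2, sub_self]⟩
  have hsum : ∑ j, ofTime (a₁ j) * Dx j (v - u) =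
      ∑ j, ofTime (a₁ j) * Dx j v - ∑ j, ofTime (a₁ j) * Dx j u := by
    rw [← Finset.sum_sub_distrib]
    exact Finset.sum_congr rfl fun j _ => by rw [hx, mul_sub]
  rw [ht, hu.1, hv.1, hsum, mul_sub]
  exact add_sub_add_comm _ _ _ _

end Transport

section Cutoff

variable {E : Type*} [NormedAddCommGroup E] [NormedSpace ℝ E]

/-! ## Representatives with small support -/

theorem VanishesOn.isNegligibleOn {U : Set E} {u : GenFun E} (h : VanishesOn U u)
    {w : Eps → E → ℂ} (hw : Represents w u) : IsNegligibleOn U w := by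
  obtain ⟨w', hw', hneg⟩ := h
  simpa using ((hw.isNegligibleOn_sub hw').mono (Set.subset_univ U)).add
    (hw.sub hw').isModerate.1 hw'.isModerate.1 hneg

theorem isModerate_of_contDiff {ψ : E → ℂ} (hψ : ContDiff ℝ ∞ ψ) :
    IsModerate fun _ : Eps => ψ :=
  isModerate_of_smoothBoundedOn (fun _ => hψ) fun _ hK => smoothBoundedOn_const hψ hK

/-- Multiplication by a smooth function which equals `1` near every point outside the open set
where `u` vanishes. -/
theorem Represents.mul_cutoff {u : GenFun E} {w : Eps → E → ℂ} (hw : Represents w u) {ψ : E → ℂ}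
    (hψ : ContDiff ℝ ∞ ψ)
    (h : ∀ x, (∃ U ∈ 𝓝 x, VanishesOn U u) ∨ ∀ᶠ y in 𝓝 x, ψ y = 1) :
    Represents (fun ε x => ψ x * w ε x) u := by
  have hm := (isModerate_of_contDiff hψ).mul hw.isModerate
  have hd : IsModerate fun (_ : Eps) x => ψ x - 1 :=
    isModerate_of_contDiff (hψ.sub contDiff_const)
  refine hw.congr hm ?_
  have he : (fun ε x => ψ x * w ε x) - w = (fun _ x => ψ x - 1) * w := by
    ext ε x
    simp only [Pi.sub_apply, Pi.mul_apply]
    ring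
  rw [he]
  refine isNegligibleOn_of_locally fun x _ => ?_
  rcases h x with ⟨U, hU, hneg⟩ | h1
  · exact ⟨U, hU, (hneg.isNegligibleOn hw).moderate_mul hd hw.isModerate.1⟩
  · obtain ⟨U, hU1, hUo, hxU⟩ := eventually_nhds_iff.1 h1
    refine ⟨U, hUo.mem_nhds hxU, isNegligibleOn_of_eq_zero hUo fun ε y hy => ?_⟩
    simp [hU1 y hy]

variable {n : ℕ}

theorem HasCompactSupp.exists_representative {u : GenFun (Rn n)} (hu : HasCompactSupp u) :
    ∃ w, Represents w u ∧ ∃ R : ℝ, ∀ ε x, R < ‖x‖ → w ε x = 0 := by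
  obtain ⟨K, hK, hneg⟩ := hu
  obtain ⟨w, hw⟩ := Represents.exists u
  obtain ⟨R, hR⟩ := hK.isBounded.exists_norm_le
  set ρ : ℝ := max R 0 + 1 with hρ
  have hρ0 : 0 < ρ := by positivity
  obtain ⟨ψ, hψ, -, hψ1, hψ0⟩ := exists_complex_bump (0 : Rn n) hρ0 (lt_add_one ρ)
  refine ⟨fun ε x => ψ x * w ε x, hw.mul_cutoff hψ fun x => ?_, ρ + 1, fun ε x hx => ?_⟩
  · by_cases hx : x ∈ K
    · right
      have h1 : ‖x‖ < ρ := by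
        have := hR x hx
        have := le_max_left R 0
        linarith
      filter_upwards [Metric.isOpen_ball.mem_nhds (mem_ball_zero_iff.2 h1)] with y hy
      exact hψ1 y (Metric.ball_subset_closedBall hy)
    · exact Or.inl ⟨Kᶜ, hK.isClosed.isOpen_compl.mem_nhds hx, hneg⟩
  · simp [hψ0 x (by simpa using hx.le)]

/-- The admissible values at each t form a convex set and one constant works near each point, so a
smooth partition of unity glues the choices. -/
theorem exists_contDiff_ge_of_nat (r : ℕ → ℝ) :
    ∃ ρ : ℝ → ℝ, ContDiff ℝ ∞ ρ ∧ ∀ t, 0 < ρ t ∧ r (⌊|t|⌋₊ + 1) < ρ t := by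
  obtain ⟨g, hg⟩ := exists_contMDiffMap_forall_mem_convex_of_local_const (n := ⊤)
    (modelWithCornersSelf ℝ ℝ) (M := ℝ) (F := ℝ)
    (t := fun t => Set.Ioi (max 0 (r (⌊|t|⌋₊ + 1)))) (fun t => convex_Ioi _) fun t => by
      refine ⟨∑ i ∈ Finset.range (⌊|t|⌋₊ + 3), |r i| + 1, ?_⟩
      have hlt : ∀ᶠ s in 𝓝 t, |s| < (⌊|t|⌋₊ : ℝ) + 1 :=
        continuous_abs.continuousAt.eventually_lt continuousAt_const (Nat.lt_floor_add_one _)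
      filter_upwards [hlt] with s hs
      have hs' : ⌊|s|⌋₊ < ⌊|t|⌋₊ + 1 :=
        (Nat.floor_lt (abs_nonneg s)).2 (by exact_mod_cast hs)
      have h0 : ∀ i ∈ Finset.range (⌊|t|⌋₊ + 3), 0 ≤ |r i| := fun i _ => abs_nonneg _
      have h1 := Finset.single_le_sum h0 (Finset.mem_range.2 (by omega :
        ⌊|s|⌋₊ + 1 < ⌊|t|⌋₊ + 3))
      have h2 := Finset.sum_nonneg h0
      rw [Set.mem_Ioi, max_lt_iff]
      exact ⟨by linarith, by linarith [le_abs_self (r (⌊|s|⌋₊ + 1))]⟩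
  exact ⟨g, g.contMDiff.contDiff, fun t => max_lt_iff.1 (hg t)⟩

/-- The radius in the support condition may vary arbitrarily with T. It is majorised by a smooth
ρ(t), and the cutoff equals 1 for |x| ≤ ρ(t) and vanishes for |x|² ≥ 2ρ(t)². -/
theorem HasCompactSuppInX.exists_representative {a : GenFun (ℝ × Rn n)}
    (ha : HasCompactSuppInX a) : ∃ w, Represents w a ∧ VanishesAtInfinity w := by
  obtain ⟨w, hw⟩ := Represents.exists a
  choose r hr using ha
  obtain ⟨ρ, hρ, hρr⟩ := exists_contDiff_ge_of_nat fun k => r k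
  let q : ℝ × Rn n → ℝ := fun p => 2 - ‖p.2‖ ^ 2 / ρ p.1 ^ 2
  have hq : ContDiff ℝ ∞ q := by
    refine contDiff_const.sub (ContDiff.div ?_ ?_ fun p => (pow_pos (hρr p.1).1 2).ne')
    · exact contDiff_snd.norm_sq ℝ
    · exact (hρ.comp contDiff_fst).pow 2
  have hψ : ContDiff ℝ ∞ fun p => (Real.smoothTransition (q p) : ℂ) :=
    Complex.ofRealCLM.contDiff.comp (Real.smoothTransition.contDiff.comp hq)
  refine ⟨fun ε p => (Real.smoothTransition (q p) : ℂ) * w ε p, hw.mul_cutoff hψ fun p => ?_,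
    fun T => ?_⟩
  · by_cases hp : ‖p.2‖ < ρ p.1
    · right
      have h1 : ∀ᶠ y : ℝ × Rn n in 𝓝 p, ‖y.2‖ < ρ y.1 :=
        (by fun_prop : Continuous fun y : ℝ × Rn n => ‖y.2‖).continuousAt.eventually_lt
          (hρ.continuous.comp continuous_fst).continuousAt hp
      filter_upwards [h1] with y hy
      have h2 : ‖y.2‖ ^ 2 / ρ y.1 ^ 2 ≤ 1 :=
        div_le_one_of_le₀ (pow_le_pow_left₀ (norm_nonneg _) hy.le 2) (sq_nonneg _)
      rw [Real.smoothTransition.one_of_one_le (by simp only [q]; linarith), Complex.ofReal_one]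
    · left
      -- The index ⌊|t|⌋ + 1 exceeds |t| strictly, which puts the point inside the open set of
      -- zeros.
      refine ⟨_, IsOpen.mem_nhds ?_ ?_, hr ((⌊|p.1|⌋₊ + 1 : ℕ) : ℝ)⟩
      · exact (isOpen_lt (f := fun p : ℝ × Rn n => |p.1|) (by fun_prop) continuous_const).and
          (isOpen_lt (g := fun p : ℝ × Rn n => ‖p.2‖) continuous_const (by fun_prop))
      · exact ⟨by push_cast; exact Nat.lt_floor_add_one _, (hρr p.1).2.trans_le (not_lt.1 hp)⟩
  · obtain ⟨D, hD⟩ := (isCompact_Icc (a := -T) (b := T)).exists_bound_of_continuousOn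
      hρ.continuous.continuousOn
    refine ⟨2 * D, fun ε t x ht hx => ?_⟩
    have h1 : ρ t ≤ D := (le_abs_self _).trans (hD t (abs_le.1 ht))
    have h0 := (hρr t).1
    have h2 : 2 ≤ ‖x‖ ^ 2 / ρ t ^ 2 := by
      rw [le_div_iff₀ (pow_pos h0 2)]
      nlinarith
    have h3 : Real.smoothTransition (q (t, x)) = 0 :=
      Real.smoothTransition.zero_of_nonpos (by simp only [q]; linarith)
    simp [h3]

end Cutoff

section FourierIntegral

open MeasureTheory
open scoped FourierTransform

variable {n : ℕ} {a₁ : Fin n → GenFun ℝ} {a₀ : GenFun (ℝ × Rn n)} {u₀ : GenFun (Rn n)}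
  {A₁ : Fin n → Eps → ℝ → ℝ} {A₀ A₀' : Eps → ℝ × Rn n → ℂ} {U₀ U₀' : Eps → Rn n → ℂ}

/-! ## The Fourier integral operator formula -/

/-- Fourier inversion after the substitution η = 2πζ, whose Jacobian is the factor (2π)ⁿ. -/
theorem integral_exp_mul_fourierHat {f : Rn n → ℂ} (hf : ContDiff ℝ ∞ f)
    (hf' : HasCompactSupport f) (x : Rn n) :
    (((2 * Real.pi) ^ n)⁻¹ : ℝ) * ∫ η, Complex.exp (Complex.I * ((inner ℝ x η : ℝ) : ℂ)) *
      fourierHat f η = f x := by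
  have hpi : 0 < 2 * Real.pi := by positivity
  have h1 := congrFun (fourierInv_fourier_of_contDiff hf hf') x
  rw [Real.fourierInv_eq'] at h1
  have h2 := Measure.integral_comp_smul (volume : Measure (Rn n))
    (fun ζ => Complex.exp (((2 * Real.pi * inner ℝ ζ x : ℝ) : ℂ) * Complex.I) • 𝓕 f ζ)
    (2 * Real.pi)⁻¹
  rw [h1, finrank_euclideanSpace_fin, inv_pow, inv_inv, abs_of_pos (by positivity)] at h2
  have h3 : (∫ η, Complex.exp (Complex.I * ((inner ℝ x η : ℝ) : ℂ)) * fourierHat f η) =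
      (2 * Real.pi) ^ n • f x := by
    rw [← h2]
    refine integral_congr_ae (Eventually.of_forall fun η => ?_)
    simp only [fourierHat_eq, smul_eq_mul, inner_smul_left, real_inner_comm x η]
    congr 2
    rw [mul_comm]
    congr 2
    simp only [map_inv₀, conj_trivial]
    rw [mul_inv_cancel_left₀ hpi.ne']
  rw [h3, Complex.real_smul, ← mul_assoc, ← Complex.ofReal_mul,
    inv_mul_cancel₀ (by positivity), Complex.ofReal_one, one_mul]

/-- Since Λ_ε(0) = 0, the phase is (x - Λ_ε(t))·η. The amplitude leaves the integral, and inversion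
evaluates the initial net at x - Λ_ε(t). -/
theorem fioNet_eq_transportNet (hU₀ : ∀ ε, ContDiff ℝ ∞ (U₀ ε)) {R : ℝ}
    (hR : ∀ ε x, R < ‖x‖ → U₀ ε x = 0) : fioNet A₁ A₀ U₀ = transportNet A₁ A₀ U₀ := by
  ext ε p
  obtain ⟨t, x⟩ := p
  have hph : ∀ η, phase A₁ ε t x η = inner ℝ (x - lam A₁ ε t) η := fun η => by
    simp [phase, charCurve, lam_zero, PiLp.inner_apply, mul_comm]
  have hamp : amplitude A₁ A₀ ε t x =
      Complex.exp (Complex.I * potentialIntegral A₁ A₀ ε (t, x - lam A₁ ε t)) := by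
    have : ∀ s, charCurve A₁ ε x t s = x - lam A₁ ε t + lam A₁ ε s := fun s => by
      rw [charCurve]
      abel
    simp only [amplitude, potentialIntegral, shiftedPotential, this]
  simp only [fioNet, hph, mul_right_comm _ (amplitude A₁ A₀ ε t x), integral_mul_const]
  rw [← mul_assoc, integral_exp_mul_fourierHat (hU₀ ε) (hasCompactSupport_of_eq_zero (hR ε)),
    hamp, mul_comm, transportNet]

/-! ## Propagation of the wave front set -/

theorem IsTransportData.exp_slice_bounded (h : IsTransportData a₁ a₀ A₁ A₀) {c : ℂ}
    (hc : ‖c‖ ≤ 1) (t : ℝ) : SmoothBoundedOn slowScale Set.univ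
      fun ε (y : Rn n) => Complex.exp (c * potentialIntegral A₁ A₀ ε (t, y)) := by
  simpa using (h.exp_integral_bounded hc |t|).comp_clm (S := Set.univ) (t, 0)
    (ContinuousLinearMap.inr ℝ ℝ (Rn n)) (fun y _ => by simp [slab])

/-- The passage from u₀ to the slice is invertible within the same class of operations: translate
back by Λ_ε(t) and multiply by exp(-i C_ε). One propagation lemma therefore gives both directions.
-/
theorem IsTransportData.isMicroRegular_slice_iff (h : IsTransportData a₁ a₀ A₁ A₀)
    (hU₀ : Represents U₀ u₀) {u : GenFun (ℝ × Rn n)} (hu : Represents (transportNet A₁ A₀ U₀) u)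
    {Λ : Rn n} {t : ℝ} (hΛ : Tendsto (fun ε => lam A₁ ε t) toZero (𝓝 Λ)) (y η : Rn n) :
    IsMicroRegular (slice t u) (y + Λ) η ↔ IsMicroRegular u₀ y η := by
  have hI : ‖Complex.I‖ ≤ 1 := by simp
  have hI' : ‖-Complex.I‖ ≤ 1 := by simp
  constructor
  · refine IsMicroRegular.mul_translate (hu.slice t) hU₀ (h.exp_slice_bounded hI' t) hΛ
      fun ε x => ?_
    rw [transportNet_along, ← mul_assoc, ← Complex.exp_add, neg_mul, neg_add_cancel,
      Complex.exp_zero, one_mul]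
  · intro hy
    refine IsMicroRegular.mul_translate hU₀ (hu.slice t)
      ((h.exp_slice_bounded hI t).comp_add_right fun ε => -lam A₁ ε t) hΛ.neg
      (fun ε x => ?_) (by rwa [add_neg_cancel_right])
    simp only [transportNet, sub_eq_add_neg]

theorem IsTransportData.waveFront_slice (h : IsTransportData a₁ a₀ A₁ A₀)
    (hU₀ : Represents U₀ u₀) {u : GenFun (ℝ × Rn n)} (hu : Represents (transportNet A₁ A₀ U₀) u)
    {Λ : ℝ → Rn n} {t : ℝ} (hΛ : Tendsto (fun ε => lam A₁ ε t) toZero (𝓝 (Λ t))) :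
    waveFront (slice t u) = flowInv Λ t '' waveFront u₀ := by
  ext ⟨x, η⟩
  simp only [Set.mem_image, waveFront, Set.mem_ofPred_eq, flowInv, Prod.mk.injEq, Prod.exists]
  constructor
  · rintro ⟨hη, hx⟩
    refine ⟨x - Λ t, η, ⟨hη, fun h0 => hx ?_⟩, by simp, rfl⟩
    simpa using (h.isMicroRegular_slice_iff hU₀ hu hΛ (x - Λ t) η).2 h0
  · rintro ⟨y, η', ⟨hη, hy⟩, rfl, rfl⟩
    exact ⟨hη, fun h0 => hy ((h.isMicroRegular_slice_iff hU₀ hu hΛ y η').1 h0)⟩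

end FourierIntegral

end Colombeau

end

/-! ### Assembly of the theorem -/

theorem mainTheorem9 (n : ℕ) (a₁ : Fin n → Colombeau.GenFun ℝ)
    (a₀ : Colombeau.GenFun (ℝ × Colombeau.Rn n)) (u₀ : Colombeau.GenFun (Colombeau.Rn n))
    (ha₁ : ∀ j, Colombeau.IsSlowScaleRegular (a₁ j))
    (ha₀ : Colombeau.IsSlowScaleRegular a₀) (ha₀_supp : Colombeau.HasCompactSuppInX a₀)
    (ha₀_log : Colombeau.IsSlowScaleLog a₀) (hu₀ : Colombeau.HasCompactSupp u₀)
    -- real valued representatives of the principal coefficients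
    (A₁ : Fin n → Colombeau.Eps → ℝ → ℝ)
    (hA₁ : ∀ j, Colombeau.Represents (fun ε t => (A₁ j ε t : ℂ)) (a₁ j))
    (Λ : ℝ → Colombeau.Rn n)
    (hΛ : ∀ t j, Filter.Tendsto (fun ε => Colombeau.lam A₁ ε t j) Colombeau.toZero
      (nhds (Λ t j))) :
    ∃ u : Colombeau.GenFun (ℝ × Colombeau.Rn n),
      Colombeau.SolvesTransport a₁ a₀ u₀ u ∧
      -- `u` is given by the Fourier integral operator formula
      (∀ (A₀ : Colombeau.Eps → ℝ × Colombeau.Rn n → ℂ)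
          (U₀ : Colombeau.Eps → Colombeau.Rn n → ℂ),
        Colombeau.Represents A₀ a₀ →
        (∀ T : ℝ, ∃ R : ℝ, ∀ ε t x, |t| ≤ T → R < ‖x‖ → A₀ ε (t, x) = 0) →
        Colombeau.Represents U₀ u₀ →
        (∃ R : ℝ, ∀ ε x, R < ‖x‖ → U₀ ε x = 0) →
        Colombeau.Represents (Colombeau.fioNet A₁ A₀ U₀) u) ∧
      -- `u` is the unique solution if the characteristics stay in compact sets
      ((∀ T : ℝ, ∃ C : ℝ, ∀ᶠ ε in Colombeau.toZero, ∀ t, |t| ≤ T →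
          ‖Colombeau.lam A₁ ε t‖ ≤ C) →
        ∀ v, Colombeau.SolvesTransport a₁ a₀ u₀ v → v = u) ∧
      ∀ t : ℝ, Colombeau.waveFront (Colombeau.slice t u) =
        Colombeau.flowInv Λ t '' Colombeau.waveFront u₀ := by
  obtain ⟨A₀, hA₀, hA₀v⟩ := ha₀_supp.exists_representative
  obtain ⟨U₀, hU₀, R, hR⟩ := hu₀.exists_representative
  have h : Colombeau.IsTransportData a₁ a₀ A₁ A₀ := ⟨ha₁, hA₁, ha₀, ha₀_log, hA₀, hA₀v⟩
  have hm := h.isModerate_transportNet hU₀ hR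
  -- The class is built from one choice of representatives with controlled supports; all other
  -- admissible choices differ by a negligible net.
  refine ⟨Ideal.Quotient.mk _ ⟨_, hm⟩, ?_⟩
  set u := Ideal.Quotient.mk (Colombeau.negligibleNets (ℝ × Colombeau.Rn n)) ⟨_, hm⟩
  have hu : Colombeau.Represents (Colombeau.transportNet A₁ A₀ U₀) u := ⟨hm, rfl⟩
  have hsol := h.solvesTransport hU₀ hR hu
  refine ⟨hsol, fun A₀' U₀' hA₀' hA₀v' hU₀' ⟨R', hR'⟩ => ?_, fun hΛb v hv => ?_, fun t => ?_⟩
  · have h' : Colombeau.IsTransportData a₁ a₀ A₁ A₀' := ⟨ha₁, hA₁, ha₀, ha₀_log, hA₀', hA₀v'⟩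
    rw [Colombeau.fioNet_eq_transportNet hU₀'.isModerate.1 hR']
    exact hu.congr (h'.isModerate_transportNet hU₀' hR')
      (h.transportNet_sub_negligible h' hU₀ hU₀' hR hR')
  · exact sub_eq_zero.1 (h.eq_zero_of_solves hΛb (hsol.sub hv))
  · refine h.waveFront_slice hU₀ hu ?_
    have h1 := (EuclideanSpace.equiv (Fin n) ℝ).symm.continuous.continuousAt.tendsto.comp
      (tendsto_pi_nhds.2 fun j => hΛ t j)
    exact h1
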